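/- Let $p$ be a prime, $k$ a finite field of characteristic $p$, $W=W(k)$ its ring of Witt vectors, $\sigma$ its Frobenius, $W_1=W/p^2W$. Let $n,l,r\ge 0$ be integers with $n$ prime to $p$, $l+1=rn$ and $p\nmid l$. Let $f\in W[t]$ have degree $l$, with leading coefficient a unit, $(f,f')=W[t]$ and $f(0)\not\equiv 0 \bmod p$, and put $f_2(s)=s^{l+1}f(1/s)$. We write $f,f_2$ also for the reductions of these polynomials, $g[m]$ for the coefficient of index $m$ of a polynomial $g$ (zero if $m<0$), and a superscript $\sigma$ for the action of $\sigma$ on coefficients. *The curve.* Let $X_0$ be the smooth projective curve over $k$ with affine equation $y^n=f(t)$. It is covered by the affine open sets $\bar U=\{y\ne 0\}$, with ring $k[t,y,y^{-1}]/(y^n-f(t))$, and $V$, with ring $k[s,z]/(z^n-f_2(s))$, where $s=1/t$, $z=s^ry$ on $\bar U\cap V=\{ty\neq0\}$. Let $X_0'$ be the Frobenius twist of $X_0$ ($f$ replaced by $f^\sigma$), and for a form $\omega$ on $X_0$ let $\omega'$ be its base change to $X_0'$ (apply $\sigma$ to constants, keep $t,y,s,z$). By means of this covering, $H^0(X_0,\Omega^1)$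 is the space of pairs $(\omega_{\bar U},\omega_V)$ of forms which agree on $\bar U\cap V$; $H^1(X_0,\mathcal O)=\mathcal O(\bar U\cap V)/(\mathcal O(\bar U)+\mathcal O(V))$; and $H^1_{dR}(X_0)$ is the space of triples $(\omega_{\bar U},\omega_V,h)\in\Omega^1(\bar U)\times\Omega^1(V)\times\mathcal O(\bar U\cap V)$ with $\omega_V-\omega_{\bar U}+dh=0$, modulo the triples $(da,db,a-b)$. *Lifts of Frobenius.* Over $W_1$ there are the lifts $$F_U:\ t\mapsto t^p,\quad y\mapsto y^p+p\,y^p\,\tfrac{\mathcal P(t)}{n}\,y^{-np},\qquad p\,\mathcal P(t)=f^\sigma(t^p)-f(t)^p,$$ on $\bar U$, and $$F_V:\ s\mapsto s^p+p\,v(s),\quad z\mapsto z^p+p\,z^p\,w(s)$$ on $V$, where $v,w\in k[s]$ are any polynomials such that $f_2(s)^p-f_2^\sigma(s^p)=p\,\bigl(v(s)f_2'(s)^p-n\,w(s)f_2(s)^p\bigr)$ in $W_1[s]$ (for $g\in k[s]$, $pg$ is the class of $p\tilde g$ for any lift $\tilde g$). Each maps the coordinate ring over $W_1$ of the twist to that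 of the curve. Put $\varphi_U=F_U^*/p$ and $\varphi_V=F_V^*/p$ on differential forms, and let $h$ be the Frobenius-semilinear map $\alpha\,d\beta\mapsto \alpha^p\,(F_U(\beta)-F_V(\beta))/p$ on $\bar U\cap V$. Let $$\Phi(\omega)=\bigl[(\varphi_U(\omega'),\ \varphi_V(\omega'),\ h(\omega'))\bigr]\in H^1_{dR}(X_0),\qquad \omega\in H^0(X_0,\Omega^1),$$ the Deligne–Illusie description of the divided Frobenius on $H^0(X_0,\Omega^1)$. *The splitting.* For $1\le j\le n-1$ and $1\le i\le rj-1$ let $h_{i,j}=y^j/t^i$, $$\alpha^U_{i,j}=\sum_{m=i+1}^{l}\tfrac{jm-in}{n}f[m]\,t^{m-i-1}y^{j-1}\frac{dt}{y^{n-1}},\qquad \alpha^V_{i,j}=\sum_{m=0}^{i}\tfrac{in-jm}{n}f[m]\,s^{\,i-m+(n-j)r-1}z^{j-1}\frac{ds}{z^{n-1}},$$ where $ds/z^{n-1}$ denotes the regular form on $V$ with this expression where $z\neq 0$. Let $\tau:H^1(X_0,\mathcal O)\to H^1_{dR}(X_0)$ be the $k$-linear map with $\tau([h_{i,j}])=[(\alpha^U_{i,j},-\alpha^V_{i,j},h_{i,j})]$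 for all these $(i,j)$. Let $P_2:H^1_{dR}(X_0)\to H^0(X_0,\Omega^1)$ be the projection given by the decomposition $H^0(X_0,\Omega^1)\oplus H^1(X_0,\mathcal O)\cong H^1_{dR}(X_0)$, $(\omega,x)\mapsto[(\omega_{\bar U},\omega_V,0)]+\tau(x)$. **Proposition.** Let $1\le j\le n-1$ and $0\le i\le rj-2$, and let $\omega_{i,j}=t^iy^{-j}dt\in H^0(X_0,\Omega^1)$. Let $pj=an+b$ with $0\le b<n$, let $d=\max(0,\deg v-2p)$, let $I_d\in k[t]$ be any polynomial with $f\,I_d\equiv1 \bmod t^{d+1}$, let $IP=I_d^{\,a+1}$, and $$Q(s)=\frac{s^{p-1}+v'(s)}{f_2(s)^a}.$$ Then $1\le b\le n-1$; $Q$ is a polynomial; the Deligne–Illusie morphism is well defined, that is, there is exactly one $k$-linear map $H^0(X_0',\Omega^1)\to H^1_{dR}(X_0)$ sending each form $\eta$ to $[(\varphi_U(\eta),\varphi_V(\eta),h(\eta))]$; $\tau$ exists and is unique; the map $H^0(X_0,\Omega^1)\oplus H^1(X_0,\mathcal O)\to H^1_{dR}(X_0)$ above is an isomorphism; and $$P_2(\Phi(\omega_{i,j}))=\sum_{\mu=0}^{rb-2}\Bigl(c_\mu+Q[\,rb-2+p(i+2-rj)-\mu\,]\Bigr)\,t^\mu\frac{dt}{y^b},$$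 $$c_\mu=\sum_{\kappa=0}^{\deg IP}\ \sum_{m=r(n-b)}^{d-(pi+\kappa)}\frac{n(\mu+1)-b(\mu+m+1)}{n}\;IP[\kappa]\;f[\mu+m+1]\;v[\,p(i+2)+\kappa+m\,],$$ where empty sums are zero. -/

import Mathlib

open Polynomial

namespace Superelliptic

/-! ### Maps between modules of Kähler differentials -/

section Kaehler

variable {R S A B : Type*} [CommRing R] [CommRing S] [CommRing A] [CommRing B]
  [Algebra R A] [Algebra S B]

/-- The additive map underlying `kaehlerMap`. -/
noncomputable def kaehlerMapAux (ψ : R →+* S) (φ : A →+* B)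
    (h : φ.comp (algebraMap R A) = (algebraMap S B).comp ψ) :
    {F : Ω[A⁄R] →+ Ω[B⁄S] // ∀ a b : A, F (a • KaehlerDifferential.D R A b) =
      φ a • KaehlerDifferential.D S B (φ b)} := by
  letI := ψ.toAlgebra
  letI := φ.toAlgebra
  letI := ((algebraMap S B).comp ψ).toAlgebra
  haveI : IsScalarTower R S B := IsScalarTower.of_algebraMap_eq fun _ => rfl
  haveI : IsScalarTower R A B := IsScalarTower.of_algebraMap_eq fun x => (RingHom.congr_fun h x).symm
  refine ⟨(KaehlerDifferential.map R S A B).toAddMonoidHom, fun a b => ?_⟩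
  change KaehlerDifferential.map R S A B (a • KaehlerDifferential.D R A b) = _
  rw [map_smul, KaehlerDifferential.map_D]
  exact algebraMap_smul (R := A) B a (KaehlerDifferential.D S B (φ b))

theorem kaehler_induction {P : Ω[A⁄R] → Prop} (h0 : P 0) (hadd : ∀ x y, P x → P y → P (x + y))
    (hD : ∀ a b : A, P (a • KaehlerDifferential.D R A b)) (x : Ω[A⁄R]) : P x := by
  have hx : x ∈ Submodule.span A (Set.range (KaehlerDifferential.D R A)) := by
    rw [KaehlerDifferential.span_range_derivation]; trivial
  obtain ⟨c, rfl⟩ := (Finsupp.mem_span_range_iff_exists_finsupp).1 hx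
  classical
  refine Finset.sum_induction _ P hadd h0 fun i _ => hD _ _

/-- For a commutative square of rings `R → S`, `A → B`, the induced map `Ω[A/R] → Ω[B/S]`,
`a db ↦ φ(a) d(φ(b))`, which is semilinear with respect to `R → S`. -/
noncomputable def kaehlerMap (ψ : R →+* S) (φ : A →+* B)
    (h : φ.comp (algebraMap R A) = (algebraMap S B).comp ψ) : Ω[A⁄R] →ₛₗ[ψ] Ω[B⁄S] where
  toFun := (kaehlerMapAux ψ φ h).1
  map_add' := map_add _
  map_smul' := fun c x => by
    refine kaehler_induction (P := fun x => (kaehlerMapAux ψ φ h).1 (c • x) =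
      ψ c • (kaehlerMapAux ψ φ h).1 x) (by simp) (fun x y hx hy => by
        simp only [smul_add, map_add, hx, hy]) (fun a b => ?_) x
    have e : φ (algebraMap R A c) = algebraMap S B (ψ c) := RingHom.congr_fun h c
    rw [← algebraMap_smul A c, smul_smul, (kaehlerMapAux ψ φ h).2, (kaehlerMapAux ψ φ h).2,
      map_mul, e, mul_smul, algebraMap_smul]

theorem kaehlerMap_smul_D (ψ : R →+* S) (φ : A →+* B) (h) (a b : A) :
    kaehlerMap ψ φ h (a • KaehlerDifferential.D R A b) =
      φ a • KaehlerDifferential.D S B (φ b) :=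
  (kaehlerMapAux ψ φ h).2 a b

theorem kaehlerMap_D (ψ : R →+* S) (φ : A →+* B) (h) (b : A) :
    kaehlerMap ψ φ h (KaehlerDifferential.D R A b) = KaehlerDifferential.D S B (φ b) := by
  simpa using kaehlerMap_smul_D ψ φ h 1 b

theorem kaehlerMap_smul (ψ : R →+* S) (φ : A →+* B) (h) (a : A) (x : Ω[A⁄R]) :
    kaehlerMap ψ φ h (a • x) = φ a • kaehlerMap ψ φ h x := by
  refine kaehler_induction (P := fun x => kaehlerMap ψ φ h (a • x) =
    φ a • kaehlerMap ψ φ h x) (by simp) (fun x y hx hy => by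
      simp only [smul_add, map_add, hx, hy]) (fun c b => ?_) x
  rw [smul_smul, kaehlerMap_smul_D, kaehlerMap_smul_D, map_mul, mul_smul]

theorem kaehlerMap_comp {T C : Type*} [CommRing T] [CommRing C] [Algebra T C]
    {U E : Type*} [CommRing U] [CommRing E] [Algebra U E]
    (ψ₁ : R →+* S) (φ₁ : A →+* B) (h₁) (ψ₂ : S →+* T) (φ₂ : B →+* C) (h₂)
    (ψ₃ : R →+* U) (φ₃ : A →+* E) (h₃) (ψ₄ : U →+* T) (φ₄ : E →+* C) (h₄)
    (e : φ₂.comp φ₁ = φ₄.comp φ₃) (x : Ω[A⁄R]) :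
    kaehlerMap ψ₂ φ₂ h₂ (kaehlerMap ψ₁ φ₁ h₁ x) = kaehlerMap ψ₄ φ₄ h₄ (kaehlerMap ψ₃ φ₃ h₃ x) := by
  refine kaehler_induction (P := fun x => kaehlerMap ψ₂ φ₂ h₂ (kaehlerMap ψ₁ φ₁ h₁ x) =
    kaehlerMap ψ₄ φ₄ h₄ (kaehlerMap ψ₃ φ₃ h₃ x)) (by simp) (fun x y hx hy => by
      simp only [map_add, hx, hy]) (fun a b => ?_) x
  have e' : ∀ a, φ₂ (φ₁ a) = φ₄ (φ₃ a) := RingHom.congr_fun e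
  simp only [kaehlerMap_smul_D, e']

end Kaehler

/-! ### The coordinate rings -/

section Rings

variable {R : Type*} [CommRing R]

/-- `R[t, y] / (y ^ n - g(t))`. -/
abbrev Plane (n : ℕ) (g : R[X]) : Type _ := AdjoinRoot ((X : R[X][X]) ^ n - C g)

/-- The first coordinate of `R[t, y] / (y ^ n - g(t))`. -/
noncomputable def Plane.fst (n : ℕ) (g : R[X]) : Plane n g := AdjoinRoot.of _ X

/-- The second coordinate of `R[t, y] / (y ^ n - g(t))`. -/
noncomputable def Plane.snd (n : ℕ) (g : R[X]) : Plane n g := AdjoinRoot.root _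

/-- `R[t, y, y⁻¹] / (y ^ n - f(t))`, the ring of functions on the open set where `y ≠ 0`. -/
abbrev UBar (n : ℕ) (f : R[X]) : Type _ := Localization.Away (Plane.snd n f)

/-- `R[t, t⁻¹, y, y⁻¹] / (y ^ n - f(t))`. -/
abbrev UV (n : ℕ) (f : R[X]) : Type _ := Localization.Away (Plane.fst n f * Plane.snd n f)

/-- `f₂(s) = s ^ (r n) f(1/s)`. -/
noncomputable def infPoly (n r : ℕ) (f : R[X]) : R[X] := reflect (r * n) f

/-- `R[s, z] / (z ^ n - f₂(s))`. -/
abbrev VRing (n r : ℕ) (f : R[X]) : Type _ := Plane n (infPoly n r f)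

variable (n : ℕ) (f : R[X])

/-- The function `t` on `y ≠ 0`. -/
noncomputable def UBar.t : UBar n f := algebraMap (Plane n f) _ (Plane.fst n f)

/-- The function `y` on `y ≠ 0`. -/
noncomputable def UBar.y : UBar n f := algebraMap (Plane n f) _ (Plane.snd n f)

/-- The function `t` on `t y ≠ 0`. -/
noncomputable def UV.t : UV n f := algebraMap (Plane n f) _ (Plane.fst n f)

/-- The function `y` on `t y ≠ 0`. -/
noncomputable def UV.y : UV n f := algebraMap (Plane n f) _ (Plane.snd n f)

/-- The function `s` on `V`. -/
noncomputable def VRing.s (r : ℕ) : VRing n r f := Plane.fst n _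

/-- The function `z` on `V`. -/
noncomputable def VRing.z (r : ℕ) : VRing n r f := Plane.snd n _

variable {n f}

theorem UBar.isUnit_y : IsUnit (UBar.y n f) := IsLocalization.Away.algebraMap_isUnit _

theorem UV.isUnit_ty : IsUnit (UV.t n f * UV.y n f) := by
  have := IsLocalization.Away.algebraMap_isUnit (S := UV n f) (Plane.fst n f * Plane.snd n f)
  rwa [map_mul] at this

theorem UV.isUnit_t : IsUnit (UV.t n f) := isUnit_of_mul_isUnit_left UV.isUnit_ty

theorem UV.isUnit_y : IsUnit (UV.y n f) := isUnit_of_mul_isUnit_right UV.isUnit_ty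

/-- `y⁻¹` on `y ≠ 0`. -/
noncomputable def UBar.yInv (n : ℕ) (f : R[X]) : UBar n f := Ring.inverse (UBar.y n f)

/-- `y⁻¹` on `t y ≠ 0`. -/
noncomputable def UV.yInv (n : ℕ) (f : R[X]) : UV n f := Ring.inverse (UV.y n f)

/-- `t⁻¹` on `t y ≠ 0`. -/
noncomputable def UV.tInv (n : ℕ) (f : R[X]) : UV n f := Ring.inverse (UV.t n f)

theorem UBar.y_mul_yInv : UBar.y n f * UBar.yInv n f = 1 := Ring.mul_inverse_cancel _ UBar.isUnit_y

theorem UV.y_mul_yInv : UV.y n f * UV.yInv n f = 1 := Ring.mul_inverse_cancel _ UV.isUnit_y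

theorem UV.t_mul_tInv : UV.t n f * UV.tInv n f = 1 := Ring.mul_inverse_cancel _ UV.isUnit_t

theorem eval₂_comp_algebraMap {A S : Type*} [CommRing A] [Algebra R A] [CommRing S]
    (φ : A →+* S) (t : A) (g : R[X]) :
    φ (aeval t g) = g.eval₂ (φ.comp (algebraMap R A)) (φ t) := by
  rw [aeval_def, hom_eval₂]

theorem Plane.aeval_fst (g h : R[X]) : aeval (Plane.fst n g) h = AdjoinRoot.of _ h := by
  induction h using Polynomial.induction_on' with
  | add p q hp hq => simp [hp, hq]
  | monomial m a =>
    rw [aeval_monomial, Plane.fst, ← map_pow, ← C_mul_X_pow_eq_monomial, map_mul]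
    rfl

theorem Plane.rel (g : R[X]) : Plane.snd n g ^ n = aeval (Plane.fst n g) g := by
  have h := AdjoinRoot.eval₂_root ((X : R[X][X]) ^ n - C g)
  rw [eval₂_sub, eval₂_X_pow, eval₂_C, sub_eq_zero] at h
  rw [Plane.aeval_fst]
  exact h

theorem UBar.rel : UBar.y n f ^ n = aeval (UBar.t n f) f := by
  rw [UBar.y, ← map_pow, Plane.rel, UBar.t, aeval_algebraMap_apply]

theorem UV.rel : UV.y n f ^ n = aeval (UV.t n f) f := by
  rw [UV.y, ← map_pow, Plane.rel, UV.t, aeval_algebraMap_apply]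

theorem VRing.rel (r : ℕ) : VRing.z n f r ^ n = aeval (VRing.s n f r) (infPoly n r f) := Plane.rel _

section Lift

variable {S : Type*} [CommRing S]

/-- The ring homomorphism out of `R[t, y] / (y ^ n - g(t))` given by the images of `R`, `t`, `y`. -/
noncomputable def Plane.lift {g : R[X]} (φ : R →+* S) (t y : S) (h : y ^ n = g.eval₂ φ t) :
    Plane n g →+* S :=
  AdjoinRoot.lift (eval₂RingHom φ t) y (by
    rw [eval₂_sub, eval₂_X_pow, eval₂_C, coe_eval₂RingHom, h, sub_self])

theorem Plane.lift_fst {g : R[X]} (φ : R →+* S) (t y : S) (h : y ^ n = g.eval₂ φ t) :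
    Plane.lift φ t y h (Plane.fst n g) = t := by
  simp [Plane.lift, Plane.fst]

theorem Plane.lift_snd {g : R[X]} (φ : R →+* S) (t y : S) (h : y ^ n = g.eval₂ φ t) :
    Plane.lift φ t y h (Plane.snd n g) = y := by
  simp [Plane.lift, Plane.snd]

theorem Plane.lift_comp {g : R[X]} (φ : R →+* S) (t y : S) (h : y ^ n = g.eval₂ φ t) :
    (Plane.lift φ t y h).comp (algebraMap R (Plane n g)) = φ := by
  ext a
  change Plane.lift φ t y h (AdjoinRoot.of _ (C a)) = _
  simp [Plane.lift]

theorem Plane.hom_ext {g : R[X]} {φ ψ : Plane n g →+* S}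
    (h : φ.comp (algebraMap R _) = ψ.comp (algebraMap R _))
    (ht : φ (Plane.fst n g) = ψ (Plane.fst n g)) (hy : φ (Plane.snd n g) = ψ (Plane.snd n g)) :
    φ = ψ := by
  refine AdjoinRoot.ringHom_ext (Polynomial.ringHom_ext (fun a => ?_) ht) hy
  exact RingHom.congr_fun h a

/-- The ring homomorphism out of `R[t, y, y⁻¹] / (y ^ n - f(t))` given by the images of
`R`, `t`, `y`. -/
noncomputable def UBar.lift (φ : R →+* S) (t y : S) (h : y ^ n = f.eval₂ φ t) (hy : IsUnit y) :
    UBar n f →+* S :=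
  IsLocalization.Away.lift (Plane.snd n f) (g := Plane.lift φ t y h)
    (by rwa [Plane.lift_snd])

theorem UBar.lift_t (φ : R →+* S) (t y : S) (h : y ^ n = f.eval₂ φ t) (hy) :
    UBar.lift φ t y h hy (UBar.t n f) = t := by
  rw [UBar.lift, UBar.t, IsLocalization.Away.lift_eq, Plane.lift_fst]

theorem UBar.lift_y (φ : R →+* S) (t y : S) (h : y ^ n = f.eval₂ φ t) (hy) :
    UBar.lift φ t y h hy (UBar.y n f) = y := by
  rw [UBar.lift, UBar.y, IsLocalization.Away.lift_eq, Plane.lift_snd]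

theorem UBar.lift_comp (φ : R →+* S) (t y : S) (h : y ^ n = f.eval₂ φ t) (hy) :
    (UBar.lift φ t y h hy).comp (algebraMap R _) = φ := by
  rw [IsScalarTower.algebraMap_eq R (Plane n f) (UBar n f), ← RingHom.comp_assoc, UBar.lift,
    IsLocalization.Away.lift_comp, Plane.lift_comp]

theorem UBar.hom_ext {φ ψ : UBar n f →+* S}
    (h : φ.comp (algebraMap R _) = ψ.comp (algebraMap R _))
    (ht : φ (UBar.t n f) = ψ (UBar.t n f)) (hy : φ (UBar.y n f) = ψ (UBar.y n f)) : φ = ψ := by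
  refine IsLocalization.ringHom_ext (Submonoid.powers (Plane.snd n f)) (Plane.hom_ext ?_ ht hy)
  rw [RingHom.comp_assoc, RingHom.comp_assoc, ← IsScalarTower.algebraMap_eq, h]

/-- The ring homomorphism out of `R[t, t⁻¹, y, y⁻¹] / (y ^ n - f(t))` given by the images of
`R`, `t`, `y`. -/
noncomputable def UV.lift (φ : R →+* S) (t y : S) (h : y ^ n = f.eval₂ φ t) (ht : IsUnit t)
    (hy : IsUnit y) : UV n f →+* S :=
  IsLocalization.Away.lift (Plane.fst n f * Plane.snd n f) (g := Plane.lift φ t y h)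
    (by rw [map_mul, Plane.lift_snd, Plane.lift_fst]; exact ht.mul hy)

theorem UV.lift_t (φ : R →+* S) (t y : S) (h : y ^ n = f.eval₂ φ t) (ht) (hy) :
    UV.lift φ t y h ht hy (UV.t n f) = t := by
  rw [UV.lift, UV.t, IsLocalization.Away.lift_eq, Plane.lift_fst]

theorem UV.lift_y (φ : R →+* S) (t y : S) (h : y ^ n = f.eval₂ φ t) (ht) (hy) :
    UV.lift φ t y h ht hy (UV.y n f) = y := by
  rw [UV.lift, UV.y, IsLocalization.Away.lift_eq, Plane.lift_snd]

theorem UV.lift_comp (φ : R →+* S) (t y : S) (h : y ^ n = f.eval₂ φ t) (ht) (hy) :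
    (UV.lift φ t y h ht hy).comp (algebraMap R _) = φ := by
  rw [IsScalarTower.algebraMap_eq R (Plane n f) (UV n f), ← RingHom.comp_assoc, UV.lift,
    IsLocalization.Away.lift_comp, Plane.lift_comp]

end Lift

end Rings

/-! ### Change of base ring and restriction maps -/

section Maps

variable {R S : Type*} [CommRing R] [CommRing S] {n : ℕ} {f : R[X]} {g : S[X]}

theorem eval₂_of_map {A : Type*} [CommRing A] [Algebra S A] (φ : R →+* S) (h : g = f.map φ)
    (t : A) : aeval t g = f.eval₂ ((algebraMap S A).comp φ) t := by
  rw [h, aeval_def, eval₂_map]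

/-- Reduction (or twist) of coefficients `R → S` on `R[t, y] / (y ^ n - f(t))`. -/
noncomputable def Plane.map (φ : R →+* S) (h : g = f.map φ) : Plane n f →+* Plane n g :=
  Plane.lift ((algebraMap S _).comp φ) (Plane.fst n g) (Plane.snd n g)
    ((Plane.rel g).trans (eval₂_of_map φ h _))

/-- Change of coefficients `R → S` on functions on `y ≠ 0`. -/
noncomputable def UBar.map (φ : R →+* S) (h : g = f.map φ) : UBar n f →+* UBar n g :=
  UBar.lift ((algebraMap S _).comp φ) (UBar.t n g) (UBar.y n g)
    (UBar.rel.trans (eval₂_of_map φ h _)) UBar.isUnit_y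

/-- Change of coefficients `R → S` on functions on `t y ≠ 0`. -/
noncomputable def UV.map (φ : R →+* S) (h : g = f.map φ) : UV n f →+* UV n g :=
  UV.lift ((algebraMap S _).comp φ) (UV.t n g) (UV.y n g)
    (UV.rel.trans (eval₂_of_map φ h _)) UV.isUnit_t UV.isUnit_y

theorem infPoly_map (r : ℕ) (φ : R →+* S) (h : g = f.map φ) : infPoly n r g = (infPoly n r f).map φ := by
  rw [infPoly, h, reflect_map]; rfl

/-- Change of coefficients `R → S` on functions on `V`. -/
noncomputable def VRing.map (r : ℕ) (φ : R →+* S) (h : g = f.map φ) :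
    VRing n r f →+* VRing n r g :=
  Plane.map φ (infPoly_map r φ h)

theorem Plane.map_comp (φ : R →+* S) (h : g = f.map φ) :
    (Plane.map (n := n) φ h).comp (algebraMap R _) = (algebraMap S _).comp φ := Plane.lift_comp ..

theorem UBar.map_comp (φ : R →+* S) (h : g = f.map φ) :
    (UBar.map (n := n) φ h).comp (algebraMap R _) = (algebraMap S _).comp φ := UBar.lift_comp ..

theorem UV.map_comp (φ : R →+* S) (h : g = f.map φ) :
    (UV.map (n := n) φ h).comp (algebraMap R _) = (algebraMap S _).comp φ := UV.lift_comp ..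

theorem VRing.map_comp (r : ℕ) (φ : R →+* S) (h : g = f.map φ) :
    (VRing.map (n := n) r φ h).comp (algebraMap R _) = (algebraMap S _).comp φ :=
  Plane.map_comp φ (infPoly_map r φ h)

variable (n f) in
/-- Restriction of functions from `y ≠ 0` to `t y ≠ 0`. -/
noncomputable def resU : UBar n f →+* UV n f :=
  UBar.lift (algebraMap R _) (UV.t n f) (UV.y n f) UV.rel UV.isUnit_y

theorem resU_comp : (resU n f).comp (algebraMap R _) =
    (algebraMap R _).comp (RingHom.id R) := UBar.lift_comp ..

theorem resU_t : resU n f (UBar.t n f) = UV.t n f := UBar.lift_t ..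

theorem resU_y : resU n f (UBar.y n f) = UV.y n f := UBar.lift_y ..

theorem UBar.map_t (φ : R →+* S) (h : g = f.map φ) : UBar.map φ h (UBar.t n f) = UBar.t n g :=
  UBar.lift_t ..

theorem UBar.map_y (φ : R →+* S) (h : g = f.map φ) : UBar.map φ h (UBar.y n f) = UBar.y n g :=
  UBar.lift_y ..

theorem UV.map_t (φ : R →+* S) (h : g = f.map φ) : UV.map φ h (UV.t n f) = UV.t n g :=
  UV.lift_t ..

theorem UV.map_y (φ : R →+* S) (h : g = f.map φ) : UV.map φ h (UV.y n f) = UV.y n g :=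
  UV.lift_y ..

theorem resU_yInv : resU n f (UBar.yInv n f) = UV.yInv n f := by
  have h1 := congrArg (resU n f) (UBar.y_mul_yInv (n := n) (f := f))
  rw [map_mul, map_one, resU_y, ← UV.y_mul_yInv] at h1
  exact UV.isUnit_y.mul_left_cancel h1

theorem resV_rel (r : ℕ) (hf : f.natDegree ≤ r * n) :
    (UV.tInv n f ^ r * UV.y n f) ^ n =
      (infPoly n r f).eval₂ (algebraMap R (UV n f)) (UV.tInv n f) := by
  let _ : Invertible (UV.t n f) := ⟨UV.tInv n f, by rw [mul_comm, UV.t_mul_tInv], UV.t_mul_tInv⟩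
  have h := eval₂_reflect_mul_pow (algebraMap R (UV n f)) (UV.t n f) (r * n) f hf
  have h2 : ⅟(UV.t n f) = UV.tInv n f := rfl
  rw [h2, ← aeval_def (UV.t n f), ← UV.rel] at h
  rw [mul_pow, ← h, infPoly, mul_comm, mul_assoc, ← pow_mul, ← mul_pow, UV.t_mul_tInv, one_pow, mul_one]

variable (n f) in
/-- Restriction of functions from `V` to `t y ≠ 0`, given by the gluing `s = t⁻¹`, `z = s ^ r y`. -/
noncomputable def resV (r : ℕ) (hf : f.natDegree ≤ r * n) : VRing n r f →+* UV n f :=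
  Plane.lift (algebraMap R _) (UV.tInv n f) (UV.tInv n f ^ r * UV.y n f) (resV_rel r hf)

theorem resV_comp (r : ℕ) (hf : f.natDegree ≤ r * n) : (resV n f r hf).comp (algebraMap R _) =
    (algebraMap R _).comp (RingHom.id R) := Plane.lift_comp ..

theorem UV.map_tInv (φ : R →+* S) (h : g = f.map φ) :
    UV.map φ h (UV.tInv n f) = UV.tInv n g := by
  have h1 := congrArg (UV.map φ h) (UV.t_mul_tInv (n := n) (f := f))
  have h2 := UV.t_mul_tInv (n := n) (f := g)
  rw [map_mul, map_one, UV.map_t, ← h2] at h1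
  exact UV.isUnit_t.mul_left_cancel h1

theorem map_resU (φ : R →+* S) (h : g = f.map φ) :
    (UV.map φ h).comp (resU n f) = (resU n g).comp (UBar.map φ h) := by
  refine UBar.hom_ext ?_ ?_ ?_
  · rw [RingHom.comp_assoc, resU_comp, RingHom.comp_id, UV.map_comp, RingHom.comp_assoc,
      UBar.map_comp, ← RingHom.comp_assoc, resU_comp, RingHom.comp_id]
  · rw [RingHom.comp_apply, RingHom.comp_apply, resU_t, UV.map_t, UBar.map_t, resU_t]
  · rw [RingHom.comp_apply, RingHom.comp_apply, resU_y, UV.map_y, UBar.map_y, resU_y]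

theorem map_resV (r : ℕ) (φ : R →+* S) (h : g = f.map φ) (hf : f.natDegree ≤ r * n)
    (hg : g.natDegree ≤ r * n) :
    (UV.map φ h).comp (resV n f r hf) = (resV n g r hg).comp (VRing.map r φ h) := by
  refine Plane.hom_ext ?_ ?_ ?_
  · rw [RingHom.comp_assoc, resV_comp, RingHom.comp_id, UV.map_comp, RingHom.comp_assoc,
      VRing.map_comp, ← RingHom.comp_assoc, resV_comp, RingHom.comp_id]
  · simp only [RingHom.comp_apply, resV, Plane.lift_fst, UV.map_tInv, VRing.map, Plane.map]
  · simp only [RingHom.comp_apply, resV, Plane.lift_snd, UV.map_tInv, VRing.map, Plane.map,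
      map_mul, map_pow, UV.map_y]

end Maps

/-! ### Čech complexes of the curve, for the covering by `y ≠ 0` and `V` -/

section Cech

variable {R : Type*} [CommRing R] (n r : ℕ) (f : R[X])

/-- Restriction of differential forms from `y ≠ 0` to the intersection with `V`. -/
noncomputable def resΩU : Ω[UBar n f⁄R] →ₗ[R] Ω[UV n f⁄R] :=
  kaehlerMap (RingHom.id R) (resU n f) resU_comp

/-- Restriction of differential forms from `V` to the intersection with `y ≠ 0`. -/
noncomputable def resΩV (hf : f.natDegree ≤ r * n) : Ω[VRing n r f⁄R] →ₗ[R] Ω[UV n f⁄R] :=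
  kaehlerMap (RingHom.id R) (resV n f r hf) (resV_comp r hf)

/-- The restriction of functions from `y ≠ 0`, as a linear map. -/
noncomputable def resULin : UBar n f →ₗ[R] UV n f where
  toFun := resU n f
  map_add' := map_add _
  map_smul' c x := by
    rw [Algebra.smul_def, map_mul, ← RingHom.comp_apply, resU_comp, Algebra.smul_def]; rfl

/-- The restriction of functions from `V`, as a linear map. -/
noncomputable def resVLin (hf : f.natDegree ≤ r * n) : VRing n r f →ₗ[R] UV n f where
  toFun := resV n f r hf
  map_add' := map_add _
  map_smul' c x := by
    rw [Algebra.smul_def, map_mul, ← RingHom.comp_apply, resV_comp, Algebra.smul_def]; rfl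

/-- Global differential forms: pairs of forms on `y ≠ 0` and on `V` with equal restrictions. -/
noncomputable def H0Ω (hf : f.natDegree ≤ r * n) :
    Submodule R (Ω[UBar n f⁄R] × Ω[VRing n r f⁄R]) :=
  LinearMap.eqLocus (resΩU n f ∘ₗ LinearMap.fst R _ _) (resΩV n r f hf ∘ₗ LinearMap.snd R _ _)

/-- `H¹(𝒪)`: functions on the intersection modulo those which are differences of a function on
`y ≠ 0` and a function on `V`. -/
abbrev H1O (hf : f.natDegree ≤ r * n) : Type _ :=
  UV n f ⧸ (LinearMap.range (resULin n f) ⊔ LinearMap.range (resVLin n r f hf))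

/-- The degree one term of the total Čech–de Rham complex. -/
abbrev CechTriple : Type _ := Ω[UBar n f⁄R] × Ω[VRing n r f⁄R] × UV n f

/-- The differential `(a, b) ↦ (da, db, a - b)` of the total Čech–de Rham complex. -/
noncomputable def cechD0 (hf : f.natDegree ≤ r * n) :
    (UBar n f × VRing n r f) →ₗ[R] CechTriple n r f :=
  ((KaehlerDifferential.D R (UBar n f)).toLinearMap ∘ₗ LinearMap.fst R _ _).prod
    (((KaehlerDifferential.D R (VRing n r f)).toLinearMap ∘ₗ LinearMap.snd R _ _).prod
      (resULin n f ∘ₗ LinearMap.fst R _ _ - resVLin n r f hf ∘ₗ LinearMap.snd R _ _))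

/-- The differential `(ω_U, ω_V, h) ↦ ω_V - ω_U + dh` of the total Čech–de Rham complex. -/
noncomputable def cechD1 (hf : f.natDegree ≤ r * n) : CechTriple n r f →ₗ[R] Ω[UV n f⁄R] :=
  resΩV n r f hf ∘ₗ LinearMap.fst R _ _ ∘ₗ LinearMap.snd R _ _ - resΩU n f ∘ₗ LinearMap.fst R _ _ +
    (KaehlerDifferential.D R (UV n f)).toLinearMap ∘ₗ LinearMap.snd R _ _ ∘ₗ LinearMap.snd R _ _

/-- The first de Rham cohomology group: `ker (cechD1) / im (cechD0)`. -/
abbrev H1dR (hf : f.natDegree ≤ r * n) : Type _ :=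
  LinearMap.ker (cechD1 n r f hf) ⧸
    (LinearMap.range (cechD0 n r f hf)).submoduleOf (LinearMap.ker (cechD1 n r f hf))

variable {n r f}

/-- The triple `x` is a cocycle, with class `c` in de Rham cohomology. -/
def HasClass (hf : f.natDegree ≤ r * n) (x : CechTriple n r f) (c : H1dR n r f hf) : Prop :=
  ∃ hx : x ∈ LinearMap.ker (cechD1 n r f hf), Submodule.Quotient.mk ⟨x, hx⟩ = c

variable (n r f)

/-- The inclusion `H⁰(Ω) → H¹_dR`, `ω ↦ [(ω, ω, 0)]`. -/
noncomputable def H0Ω.toH1dR (hf : f.natDegree ≤ r * n) : H0Ω n r f hf →ₗ[R] H1dR n r f hf :=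
  Submodule.mkQ _ ∘ₗ LinearMap.codRestrict (LinearMap.ker (cechD1 n r f hf))
    ((LinearMap.fst R _ _ ∘ₗ (H0Ω n r f hf).subtype).prod
      ((LinearMap.snd R _ _ ∘ₗ (H0Ω n r f hf).subtype).prod 0)) (fun x => by
        have hx : resΩU n f x.1.1 = resΩV n r f hf x.1.2 := x.2
        simp [cechD1, hx])

end Cech

/-! ### Bases of differential forms and the splitting of the Hodge filtration -/

section Field

variable {k : Type*} [Field k]

theorem X_mul_derivative_reflect (N : ℕ) (f : k[X]) (hf : f.natDegree ≤ N) :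
    X * derivative (reflect N f) = C (N : k) * reflect N f - reflect N (X * derivative f) := by
  refine induction_with_natDegree_le (fun f => X * derivative (reflect N f) =
    C (N : k) * reflect N f - reflect N (X * derivative f)) N (by simp) ?_ ?_ f hf
  · intro m a _ hm
    have e : ∀ m : ℕ, X * derivative (C a * X ^ m) = C (m : k) * (C a * X ^ m) := by
      rintro (_ | m)
      · simp
      · rw [derivative_C_mul, derivative_X_pow, Nat.add_sub_cancel, pow_succ]; ring
    rw [e, reflect_C_mul (C a * X ^ m) (m : k) N, reflect_C_mul_X_pow, revAt_le hm, e, Nat.cast_sub hm,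
      C_sub, sub_mul]
  · intro f g _ _ hf hg
    simp only [reflect_add, derivative_add, mul_add, hf, hg]
    ring

/-- If `f` is separable of degree `l`, with `l + 1 = r n`, then `f₂` is separable. -/
theorem infPoly_isCoprime {n r : ℕ} {f : k[X]} (hl : f.natDegree + 1 = r * n)
    (hf : IsCoprime f (derivative f)) : IsCoprime (infPoly n r f) (derivative (infPoly n r f)) := by
  have hN : f.natDegree ≤ r * n := by omega
  rw [Polynomial.isCoprime_iff_aeval_ne_zero_of_isAlgClosed k (AlgebraicClosure k)] at hf ⊢
  intro x
  by_contra! hx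
  obtain ⟨hx1, hx2⟩ := hx
  rcases eq_or_ne x 0 with rfl | h0
  · rw [← coeff_zero_eq_aeval_zero', coeff_derivative, infPoly, coeff_reflect, revAt_le (by omega),
      map_eq_zero] at hx2
    have : r * n - (0 + 1) = f.natDegree := by omega
    rw [this] at hx2
    simp only [Nat.cast_zero, zero_add, mul_one] at hx2
    have hf0 : f = 0 := leadingCoeff_eq_zero.1 hx2
    simp [hf0] at hf
  · let _ : Invertible x⁻¹ := ⟨x, mul_inv_cancel₀ h0, inv_mul_cancel₀ h0⟩
    have hinv : ⅟(x⁻¹) = x := rfl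
    have h1 := eval₂_reflect_mul_pow (algebraMap k (AlgebraicClosure k)) x⁻¹ (r * n) f hN
    have hd : (X * derivative f).natDegree ≤ r * n := by
      refine natDegree_mul_le.trans ?_
      have := natDegree_derivative_le f
      have := natDegree_X_le (R := k)
      omega
    have h2 := eval₂_reflect_mul_pow (algebraMap k (AlgebraicClosure k)) x⁻¹ (r * n) _ hd
    have h3 := congrArg (aeval x) (X_mul_derivative_reflect (r * n) f hN)
    rw [hinv, ← aeval_def, ← aeval_def] at h1 h2
    rw [infPoly] at hx1 hx2
    rw [map_mul, map_sub, map_mul, hx1, hx2, mul_zero, mul_zero, zero_sub, eq_comm,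
      neg_eq_zero] at h3
    rw [hx1, zero_mul] at h1
    rw [h3, zero_mul, map_mul, aeval_X, eq_comm, mul_eq_zero] at h2
    exact (hf x⁻¹).elim (fun h => h h1.symm) (fun h => h (h2.resolve_left (inv_ne_zero h0)))

variable {n r : ℕ} {f : k[X]}

/-- The differential form `ds / z ^ (n - 1)` on `V`, defined through a Bézout relation
`u f₂ + w f₂' = 1` as `u z ds + n w dz`. -/
noncomputable def formZ (h : IsCoprime (infPoly n r f) (derivative (infPoly n r f))) :
    Ω[VRing n r f⁄k] :=
  (aeval (VRing.s n f r) h.choose * VRing.z n f r) • KaehlerDifferential.D k _ (VRing.s n f r) +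
    (n * aeval (VRing.s n f r) h.choose_spec.choose) • KaehlerDifferential.D k _ (VRing.z n f r)

/-- The characteristic property of `ds / z ^ (n - 1)`. -/
theorem formZ_spec (hn : 1 ≤ n) (h : IsCoprime (infPoly n r f) (derivative (infPoly n r f))) :
    VRing.z n f r ^ (n - 1) • formZ h = KaehlerDifferential.D k _ (VRing.s n f r) := by
  have hb := congrArg (aeval (VRing.s n f r)) h.choose_spec.choose_spec
  rw [map_add, map_mul, map_mul, map_one] at hb
  have hrel := congrArg (KaehlerDifferential.D k (VRing n r f)) (VRing.rel (n := n) (f := f) r)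
  rw [Derivation.leibniz_pow, Derivation.map_aeval] at hrel
  have hz : VRing.z n f r ^ (n - 1) * VRing.z n f r = aeval (VRing.s n f r) (infPoly n r f) := by
    rw [← pow_succ, Nat.sub_add_cancel hn, VRing.rel]
  set u := aeval (VRing.s n f r) h.choose with hu
  set w := aeval (VRing.s n f r) h.choose_spec.choose with hw
  have e : VRing.z n f r ^ (n - 1) • formZ h =
      (u * (VRing.z n f r ^ (n - 1) * VRing.z n f r)) • KaehlerDifferential.D k _ (VRing.s n f r) +
      w • (n • VRing.z n f r ^ (n - 1) • KaehlerDifferential.D k _ (VRing.z n f r)) := by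
    rw [formZ, smul_add, smul_smul, smul_smul, ← Nat.cast_smul_eq_nsmul (VRing n r f), smul_smul,
      smul_smul]
    congr 2 <;> ring
  rw [e, hrel, hz, smul_smul, ← add_smul, hb, one_smul]

/-- `t ^ i y ^ (-j) dt`, as a form on `y ≠ 0` and, through
`t ^ i y ^ (-j) dt = - s ^ (r j - 2 - i) z ^ (n - 1 - j) (ds / z ^ (n - 1))`, as a form on `V`. -/
noncomputable def omegaForm (h : IsCoprime (infPoly n r f) (derivative (infPoly n r f))) (i j : ℕ) :
    Ω[UBar n f⁄k] × Ω[VRing n r f⁄k] :=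
  ((UBar.t n f ^ i * UBar.yInv n f ^ j) • KaehlerDifferential.D k _ (UBar.t n f),
    -((VRing.s n f r ^ (r * j - 2 - i) * VRing.z n f r ^ (n - 1 - j)) • formZ h))

theorem derivation_of_mul_eq_one {R A M : Type*} [CommRing R] [CommRing A] [Algebra R A]
    [AddCommGroup M] [Module A M] [Module R M] (D : Derivation R A M) {t t' : A}
    (ht : t * t' = 1) : D t' = -(t' ^ 2) • D t := by
  have h3 := congrArg D ht
  rw [Derivation.leibniz, Derivation.map_one_eq_zero] at h3
  have h4 := congrArg (fun x => t' • x) h3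
  simp only [smul_add, smul_smul, smul_zero] at h4
  rw [mul_comm t' t, ht, one_smul] at h4
  rw [eq_neg_of_add_eq_zero_left h4, neg_smul, sq]

theorem omegaForm_aux {A M : Type*} [CommRing A] [AddCommGroup M] [Module A M] {n r i j : ℕ}
    (hj : j + 1 ≤ n) (hi : i + 2 ≤ r * j) {t t' y y' : A} (ht : t * t' = 1) (hy : y * y' = 1)
    {δ δ' η : M} (hD : δ' = -(t' ^ 2) • δ) (h1 : (t' ^ r * y) ^ (n - 1) • η = δ') :
    (t ^ i * y' ^ j) • δ = -((t' ^ (r * j - 2 - i) * (t' ^ r * y) ^ (n - 1 - j)) • η) := by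
  rw [hD] at h1
  have hzz : (t' ^ r * y) * (t ^ r * y') = 1 := by
    rw [mul_mul_mul_comm, hy, ← mul_pow, mul_comm t' t, ht, one_pow, one_mul]
  have h5 : η = (t ^ r * y') ^ (n - 1) • (-(t' ^ 2) • δ) := by
    rw [← h1, smul_smul, ← mul_pow, mul_comm (t ^ r * y'), hzz, one_pow, one_smul]
  rw [h5, smul_smul, smul_smul, ← neg_smul]
  congr 1
  obtain ⟨c, hc⟩ : ∃ c, r * j = i + 2 + c := ⟨_, (Nat.add_sub_of_le hi).symm⟩
  obtain ⟨e, rfl⟩ : ∃ e, n = j + 1 + e := ⟨_, (Nat.add_sub_of_le hj).symm⟩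
  have e1 : r * j - 2 - i = c := by omega
  have e2 : j + 1 + e - 1 - j = e := by omega
  have e3 : j + 1 + e - 1 = e + j := by omega
  rw [e1, e2, e3, pow_add]
  have e4 : t' ^ c * (t' ^ r * y) ^ e * ((t ^ r * y') ^ e * (t ^ r * y') ^ j) * -t' ^ 2 =
      -(((t' ^ r * y) * (t ^ r * y')) ^ e * (t' ^ c * t' ^ 2 * (t ^ r) ^ j * y' ^ j)) := by
    rw [mul_pow _ (t ^ r * y'), mul_pow (t ^ r) y' j]; ring
  rw [e4, hzz, one_pow, one_mul, neg_neg, ← pow_mul, hc]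
  have e5 : t' ^ c * t' ^ 2 * t ^ (i + 2 + c) * y' ^ j = t ^ i * y' ^ j * (t * t') ^ (c + 2) := by
    rw [mul_pow]; ring
  rw [e5, ht, one_pow, mul_one]

theorem omegaForm_mem (hf : f.natDegree ≤ r * n)
    (h : IsCoprime (infPoly n r f) (derivative (infPoly n r f))) {i j : ℕ} (hj : j + 1 ≤ n)
    (hi : i + 2 ≤ r * j) : omegaForm h i j ∈ H0Ω n r f hf := by
  change resΩU n f (omegaForm h i j).1 = resΩV n r f hf (omegaForm h i j).2
  have hn : 1 ≤ n := by omega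
  have hs : resV n f r hf (VRing.s n f r) = UV.tInv n f := Plane.lift_fst ..
  have hz : resV n f r hf (VRing.z n f r) = UV.tInv n f ^ r * UV.y n f := Plane.lift_snd ..
  have h1 := congrArg (resΩV n r f hf) (formZ_spec hn h)
  rw [resΩV, kaehlerMap_smul, kaehlerMap_D, map_pow, hz, hs] at h1
  rw [resΩU, resΩV, omegaForm, map_neg, kaehlerMap_smul_D, kaehlerMap_smul, map_mul, map_mul, map_pow,
    map_pow, map_pow, map_pow, resU_t, resU_yInv, hs, hz]
  exact omegaForm_aux hj hi UV.t_mul_tInv UV.y_mul_yInv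
    (derivation_of_mul_eq_one (KaehlerDifferential.D k (UV n f)) UV.t_mul_tInv) h1

/-- The function `h_{i,j} = y ^ j / t ^ i` on `t y ≠ 0`. -/
noncomputable def hFun (n : ℕ) (f : k[X]) (i j : ℕ) : UV n f := UV.tInv n f ^ i * UV.y n f ^ j

/-- The part of `d h_{i,j}` which is regular on `y ≠ 0`:
`(∑_{m = i + 1}^{l} ((j m - i n) / n) f[m] t ^ (m - (i + 1))) y ^ (j - 1) dt / y ^ (n - 1)`. -/
noncomputable def alphaU (n : ℕ) (f : k[X]) (i j : ℕ) : Ω[UBar n f⁄k] :=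
  ((∑ m ∈ Finset.Icc (i + 1) f.natDegree,
      (((j : k) * m - i * n) / n * f.coeff m) • UBar.t n f ^ (m - (i + 1))) *
    UBar.y n f ^ (j - 1) * UBar.yInv n f ^ (n - 1)) • KaehlerDifferential.D k _ (UBar.t n f)

/-- The part of `d h_{i,j}` which is regular on `V`:
`(∑_{m = 0}^{i} ((i n - j m) / n) f[m] s ^ (i + 1 + a - m)) z ^ (j - 1) ds / z ^ (n - 1)` with
`a = (n - j) r - 2`. -/
noncomputable def alphaV (h : IsCoprime (infPoly n r f) (derivative (infPoly n r f))) (i j : ℕ) :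
    Ω[VRing n r f⁄k] :=
  ((∑ m ∈ Finset.range (i + 1),
      (((i : k) * n - j * m) / n * f.coeff m) •
        VRing.s n f r ^ (i - m + ((n - j) * r - 1))) * VRing.z n f r ^ (j - 1)) • formZ h

/-- `τ` is the section of `H¹_dR → H¹(𝒪)` sending the class of `h_{i,j}` to the class of
`(α^U_{i,j}, - α^V_{i,j}, h_{i,j})` for `1 ≤ j ≤ n - 1`, `1 ≤ i ≤ r j - 1`. -/
def IsHodgeSplitting (hf : f.natDegree ≤ r * n)
    (h : IsCoprime (infPoly n r f) (derivative (infPoly n r f)))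
    (τ : H1O n r f hf →ₗ[k] H1dR n r f hf) : Prop :=
  ∀ i j : ℕ, 1 ≤ j → j + 1 ≤ n → 1 ≤ i → i + 1 ≤ r * j →
    HasClass hf (alphaU n f i j, -alphaV h i j, hFun n f i j)
      (τ (Submodule.Quotient.mk (hFun n f i j)))

end Field

/-! ### Witt vectors of length two and lifts of Frobenius -/

section Witt

variable (p : ℕ) [Fact p.Prime] (k : Type*) [Field k] [CharP k p]

/-- `W₁ = W(k) / p²`. -/
abbrev W1 : Type _ := WittVector p k ⧸ Ideal.span {(p : WittVector p k) ^ 2}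

/-- The reduction `W₁ → k`. -/
noncomputable def W1.red : W1 p k →+* k :=
  Ideal.Quotient.lift _ WittVector.constantCoeff (fun a ha => by
    obtain ⟨b, rfl⟩ := Ideal.mem_span_singleton'.1 ha
    rw [map_mul, map_pow, map_natCast, CharP.cast_eq_zero, zero_pow two_ne_zero, mul_zero])

/-- The Frobenius `σ` of `W₁`, induced by the Frobenius of `W(k)`. -/
noncomputable def W1.sigma : W1 p k →+* W1 p k :=
  Ideal.quotientMap _ WittVector.frobenius (by
    rw [Ideal.span_singleton_le_iff_mem, Ideal.mem_comap, map_pow, map_natCast]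
    exact Ideal.mem_span_singleton_self _)

/-- A coefficientwise lift of a polynomial over `k` to `W₁`, by Teichmüller representatives. -/
noncomputable def teichLift (Q : k[X]) : (W1 p k)[X] :=
  ∑ i ∈ Q.support, monomial i (Ideal.Quotient.mk _ (WittVector.teichmuller p (Q.coeff i)))

/-- For `Q ∈ k[X]`, the polynomial `p Q ∈ W₁[X]`, that is `p` times any lift of `Q`. -/
noncomputable def mulP (Q : k[X]) : (W1 p k)[X] := C (p : W1 p k) * teichLift p k Q

variable {p k}

theorem W1.red_sigma (x : W1 p k) : W1.red p k (W1.sigma p k x) = W1.red p k x ^ p := by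
  obtain ⟨x, rfl⟩ := Ideal.Quotient.mk_surjective x
  exact WittVector.coeff_frobenius_charP p x 0

theorem map_red_sigma (f : (W1 p k)[X]) : (f.map (W1.sigma p k)).map (W1.red p k) =
    (f.map (W1.red p k)).map (frobenius k p) := by
  rw [Polynomial.map_map, Polynomial.map_map]
  congr 1
  ext x
  exact W1.red_sigma (Ideal.Quotient.mk _ x)

theorem W1.p_sq : (p : W1 p k) ^ 2 = 0 := by
  rw [← map_natCast (Ideal.Quotient.mk (Ideal.span {(p : WittVector p k) ^ 2})), ← map_pow]
  exact Ideal.Quotient.eq_zero_iff_mem.2 (Ideal.mem_span_singleton_self _)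

theorem map_teichLift (Q : k[X]) : (teichLift p k Q).map (W1.red p k) = Q := by
  conv_rhs => rw [Q.as_sum_support]
  rw [teichLift, Polynomial.map_sum]
  refine Finset.sum_congr rfl fun i _ => ?_
  rw [map_monomial]
  exact congrArg _ (WittVector.teichmuller_coeff_zero p _)

variable [PerfectRing k p]

theorem W1.exists_of_red {x : W1 p k} (hx : W1.red p k x = 0) : ∃ w, x = p * w := by
  obtain ⟨x, rfl⟩ := Ideal.Quotient.mk_surjective x
  have h : x ∈ RingHom.ker (WittVector.constantCoeff (p := p) (R := k)) := hx
  rw [WittVector.ker_constantCoeff] at h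
  obtain ⟨w, rfl⟩ := Ideal.mem_span_singleton'.1 h
  exact ⟨Ideal.Quotient.mk _ w, by rw [map_mul, map_natCast, mul_comm]⟩

theorem C_p_mul_congr {A B : (W1 p k)[X]} (h : A.map (W1.red p k) = B.map (W1.red p k)) :
    C (p : W1 p k) * A = C (p : W1 p k) * B := by
  ext i
  rw [coeff_C_mul, coeff_C_mul, ← sub_eq_zero, ← mul_sub]
  have hi := congrArg (fun q => coeff q i) h
  simp only [coeff_map] at hi
  obtain ⟨w, hw⟩ := W1.exists_of_red (x := A.coeff i - B.coeff i) (by rw [map_sub, hi, sub_self])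
  rw [hw, ← mul_assoc, ← sq, W1.p_sq, zero_mul]

theorem mulP_eq {A : (W1 p k)[X]} {Q : k[X]} (h : A.map (W1.red p k) = Q) :
    mulP p k Q = C (p : W1 p k) * A :=
  C_p_mul_congr (by rw [map_teichLift, h])

theorem exists_mulP {A : (W1 p k)[X]} (h : A.map (W1.red p k) = 0) : ∃ Q, mulP p k Q = A := by
  have hA : ∀ i, ∃ w, A.coeff i = p * w := fun i => W1.exists_of_red (by
    have := congrArg (fun q => coeff q i) h
    simpa only [coeff_map, coeff_zero] using this)
  choose w hw using hA
  refine ⟨(∑ i ∈ A.support, monomial i (w i)).map (W1.red p k), ?_⟩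
  rw [mulP_eq rfl, Finset.mul_sum]
  conv_rhs => rw [A.as_sum_support]
  refine Finset.sum_congr rfl fun i _ => ?_
  rw [C_mul_monomial, hw]

theorem expand_sub_pow_red (f : (W1 p k)[X]) :
    (expand (W1 p k) p (f.map (W1.sigma p k)) - f ^ p).map (W1.red p k) = 0 := by
  rw [Polynomial.map_sub, map_expand, map_red_sigma, Polynomial.map_pow, ← map_expand,
    map_frobenius_expand, sub_self]

/-- The polynomial `𝒫 = (f^σ(t ^ p) - f(t) ^ p) / p` of `k[t]`. -/
noncomputable def frobQuot (f : (W1 p k)[X]) : k[X] := (exists_mulP (expand_sub_pow_red f)).choose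

theorem mulP_frobQuot (f : (W1 p k)[X]) :
    mulP p k (frobQuot f) = expand (W1 p k) p (f.map (W1.sigma p k)) - f ^ p :=
  (exists_mulP (expand_sub_pow_red f)).choose_spec

theorem aeval_mulP_sq {A : Type*} [CommRing A] [Algebra (W1 p k) A] (x : A) (Q : k[X]) :
    aeval x (mulP p k Q) ^ 2 = 0 := by
  rw [← map_pow, mulP, mul_pow, ← C_pow, W1.p_sq, C_0, zero_mul, map_zero]

theorem one_add_pow_of_sq {A : Type*} [CommRing A] {x : A} (hx : x ^ 2 = 0) (n : ℕ) :
    (1 + x) ^ n = 1 + n * x := by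
  induction n with
  | zero => simp
  | succ n ih => rw [pow_succ, ih]; push_cast; linear_combination (n : A) * hx

variable (n r : ℕ) (f : (W1 p k)[X])

/-- The image of `y` under the lift `F_U`. -/
noncomputable def frobUy : UBar n f :=
  UBar.y n f ^ p + aeval (UBar.t n f) (mulP p k (C (n : k)⁻¹ * frobQuot f)) *
    (UBar.y n f ^ p * UBar.yInv n f ^ (n * p))

variable {n}

theorem frobUy_rel (hn : (n : k) ≠ 0) : frobUy n f ^ n =
    (f.map (W1.sigma p k)).eval₂ (algebraMap (W1 p k) (UBar n f)) (UBar.t n f ^ p) := by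
  have h1 : C (n : W1 p k) * mulP p k (C (n : k)⁻¹ * frobQuot f) = mulP p k (frobQuot f) := by
    rw [mulP, mul_left_comm]
    refine C_p_mul_congr ?_
    rw [Polynomial.map_mul, map_teichLift, map_teichLift, map_C, map_natCast, ← mul_assoc,
      ← C_mul, mul_inv_cancel₀ hn, C_1, one_mul]
  have h2 := congrArg (aeval (UBar.t n f)) h1
  rw [mulP_frobQuot, map_mul, map_sub, expand_aeval, map_pow, aeval_C, map_natCast] at h2
  set u := aeval (UBar.t n f) (mulP p k (C (n : k)⁻¹ * frobQuot f)) with hu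
  have hu2 : (u * UBar.yInv n f ^ (n * p)) ^ 2 = 0 := by
    rw [mul_pow, hu, aeval_mulP_sq, zero_mul]
  have h3 : frobUy n f = UBar.y n f ^ p * (1 + u * UBar.yInv n f ^ (n * p)) := by
    rw [frobUy, ← hu]; ring
  have h4 : (UBar.y n f ^ p) ^ n = aeval (UBar.t n f) f ^ p := by
    rw [← pow_mul, mul_comm, pow_mul, UBar.rel]
  have h5 : (UBar.y n f ^ p) ^ n * UBar.yInv n f ^ (n * p) = 1 := by
    rw [← pow_mul, mul_comm p n, ← mul_pow, UBar.y_mul_yInv, one_pow]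
  rw [h3, mul_pow, one_add_pow_of_sq hu2, ← aeval_def]
  linear_combination h4 + h2 + (n : UBar n f) * u * h5

theorem frobUy_isUnit : IsUnit (frobUy n f) := by
  set u := aeval (UBar.t n f) (mulP p k (C (n : k)⁻¹ * frobQuot f)) with hu
  have h3 : frobUy n f = UBar.y n f ^ p * (1 + u * UBar.yInv n f ^ (n * p)) := by
    rw [frobUy, ← hu]; ring
  rw [h3]
  refine (UBar.isUnit_y.pow p).mul (IsUnit.of_mul_eq_one (1 - u * UBar.yInv n f ^ (n * p)) ?_)
  have hu2 : u ^ 2 = 0 := aeval_mulP_sq _ _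
  linear_combination (-(UBar.yInv n f ^ (n * p)) ^ 2) * hu2

/-- The lift of Frobenius
`F_U : W₁[t, y, y⁻¹] / (y ^ n - f^σ(t)) → W₁[t, y, y⁻¹] / (y ^ n - f(t))`, `t ↦ t ^ p`,
`y ↦ y ^ p + p y ^ p (𝒫(t) / n) y ^ (-n p)`. -/
noncomputable def frobU (hn : (n : k) ≠ 0) : UBar n (f.map (W1.sigma p k)) →+* UBar n f :=
  UBar.lift (algebraMap _ _) (UBar.t n f ^ p) (frobUy n f) (frobUy_rel f hn) (frobUy_isUnit f)

theorem frobU_comp (hn : (n : k) ≠ 0) :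
    (frobU f hn).comp (algebraMap (W1 p k) _) = (algebraMap (W1 p k) _).comp (RingHom.id _) :=
  UBar.lift_comp ..

variable (n) in
/-- The relation `f₂(s) ^ p - f₂^σ(s ^ p) = p (v(s) f₂'(s) ^ p - n b(s) f₂(s) ^ p)` in `W₁[s]`
between the polynomials `v, b ∈ k[s]` defining the lift of Frobenius on `V`. -/
def FrobVRel (v b : k[X]) : Prop :=
  infPoly n r f ^ p - expand (W1 p k) p ((infPoly n r f).map (W1.sigma p k)) =
    mulP p k (v * derivative ((infPoly n r f).map (W1.red p k)) ^ p -
      n * b * (infPoly n r f).map (W1.red p k) ^ p)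

variable {r} {f}

theorem frobV_rel {v b : k[X]} (h : FrobVRel n r f v b) :
    (VRing.z n f r ^ p + aeval (VRing.s n f r) (mulP p k b) * VRing.z n f r ^ p) ^ n =
      (infPoly n r (f.map (W1.sigma p k))).eval₂ (algebraMap (W1 p k) (VRing n r f))
        (VRing.s n f r ^ p + aeval (VRing.s n f r) (mulP p k v)) := by
  rw [infPoly_map r (W1.sigma p k) rfl, ← aeval_def, aeval_add_of_sq_eq_zero _ _ _ (aeval_mulP_sq _ _)]
  set g := infPoly n r f
  have hd : mulP p k v * expand (W1 p k) p (derivative (g.map (W1.sigma p k))) =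
      mulP p k (v * derivative (g.map (W1.red p k)) ^ p) := by
    symm
    rw [mulP, mulP, mul_assoc]
    refine C_p_mul_congr ?_
    rw [Polynomial.map_mul, map_teichLift, map_teichLift, map_expand, ← derivative_map,
      map_red_sigma, derivative_map, derivative_map, ← map_expand, ← derivative_map, map_frobenius_expand]
  have hb : C (n : W1 p k) * mulP p k b * g ^ p =
      mulP p k (n * b * g.map (W1.red p k) ^ p) := by
    symm
    rw [mulP, mulP, mul_left_comm, mul_assoc (C (p : W1 p k))]
    refine C_p_mul_congr ?_
    simp only [Polynomial.map_mul, map_teichLift, Polynomial.map_pow, map_natCast,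
      Polynomial.map_natCast]
  have hs : mulP p k (v * derivative (g.map (W1.red p k)) ^ p -
      n * b * g.map (W1.red p k) ^ p) = mulP p k (v * derivative (g.map (W1.red p k)) ^ p) -
      mulP p k (n * b * g.map (W1.red p k) ^ p) := by
    rw [mulP, mulP, mulP, ← mul_sub]
    refine C_p_mul_congr ?_
    simp only [Polynomial.map_sub, map_teichLift]
  have h' : g ^ p - expand (W1 p k) p (g.map (W1.sigma p k)) = _ := h
  rw [hs, ← hd, ← hb] at h'
  have h2 := congrArg (aeval (VRing.s n f r)) h'
  simp only [map_sub, map_mul, map_pow, expand_aeval, map_natCast] at h2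
  have h3 : VRing.z n f r ^ n = aeval (VRing.s n f r) g := VRing.rel r
  set β := aeval (VRing.s n f r) (mulP p k b) with hβ
  have hβ2 : β ^ 2 = 0 := aeval_mulP_sq _ _
  have h4 : VRing.z n f r ^ p + β * VRing.z n f r ^ p = VRing.z n f r ^ p * (1 + β) := by ring
  have h5 : (VRing.z n f r ^ p) ^ n = aeval (VRing.s n f r) g ^ p := by
    rw [← pow_mul, mul_comm, pow_mul, h3]
  rw [h4, mul_pow, one_add_pow_of_sq hβ2, h5]
  linear_combination h2

/-- The lift of Frobenius `F_V : W₁[s, z] / (z ^ n - f₂^σ(s)) → W₁[s, z] / (z ^ n - f₂(s))`,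
`s ↦ s ^ p + p v(s)`, `z ↦ z ^ p + p z ^ p b(s)`. -/
noncomputable def frobV {v b : k[X]} (h : FrobVRel n r f v b) :
    VRing n r (f.map (W1.sigma p k)) →+* VRing n r f :=
  Plane.lift (algebraMap _ _) (VRing.s n f r ^ p + aeval (VRing.s n f r) (mulP p k v))
    (VRing.z n f r ^ p + aeval (VRing.s n f r) (mulP p k b) * VRing.z n f r ^ p) (frobV_rel h)

theorem frobV_comp {v b : k[X]} (h : FrobVRel n r f v b) :
    (frobV h).comp (algebraMap (W1 p k) _) = (algebraMap (W1 p k) _).comp (RingHom.id _) :=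
  Plane.lift_comp ..

end Witt

/-! ### The Deligne–Illusie morphism -/

section DeligneIllusie

variable {p : ℕ} [Fact p.Prime] {k : Type*} [Field k] [CharP k p]

/-- `φ` is the divided Frobenius on differential forms, `φ = F^* / p`, attached to a lift `F`
over `W₁` of Frobenius: for every form `ω` over `W₁` the form `F^* ω` is of the shape `p η`, and
`φ` sends the reduction of `ω` to the reduction of `η`. Here `ρ'` and `ρ` are the reductions
modulo `p` of the source and of the target of `F`. -/
def IsDividedFrobenius {A' A B' B : Type*} [CommRing A'] [CommRing A] [CommRing B'] [CommRing B]
    [Algebra (W1 p k) A'] [Algebra (W1 p k) A] [Algebra k B'] [Algebra k B] (F : A' →+* A)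
    (hF : F.comp (algebraMap (W1 p k) A') = (algebraMap (W1 p k) A).comp (RingHom.id _))
    (ρ' : A' →+* B')
    (hρ' : ρ'.comp (algebraMap (W1 p k) A') = (algebraMap k B').comp (W1.red p k))
    (ρ : A →+* B) (hρ : ρ.comp (algebraMap (W1 p k) A) = (algebraMap k B).comp (W1.red p k))
    (φ : Ω[B'⁄k] →+ Ω[B⁄k]) : Prop :=
  ∀ ω : Ω[A'⁄W1 p k], ∃ η : Ω[A⁄W1 p k],
    kaehlerMap (RingHom.id _) F hF ω = (p : W1 p k) • η ∧
    φ (kaehlerMap (W1.red p k) ρ' hρ' ω) = kaehlerMap (W1.red p k) ρ hρ η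

/-- `h` is the Frobenius-semilinear map `h(a db) = F(a) (F_U(b) - F_V(b)) / p` attached to two
lifts `F_U`, `F_V` over `W₁` of the same Frobenius; `ρ'` and `ρ` are the reductions modulo `p`. -/
def IsFrobeniusDifference {A' A B' B : Type*} [CommRing A'] [CommRing A] [CommRing B']
    [CommRing B] [Algebra k B'] (FU FV : A' →+* A) (ρ' : A' →+* B') (ρ : A →+* B)
    (h : Ω[B'⁄k] →+ B) : Prop :=
  (∀ (a : A') (ω : Ω[B'⁄k]), h (ρ' a • ω) = ρ (FU a) * h ω) ∧
  ∀ b : A', ∃ e : A, FU b - FV b = (p : A) * e ∧ h (KaehlerDifferential.D k B' (ρ' b)) = ρ e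

variable {n r : ℕ}

theorem natDegree_red_le {f : (W1 p k)[X]} (hf : f.natDegree ≤ r * n) :
    (f.map (W1.red p k)).natDegree ≤ r * n := natDegree_map_le.trans hf

theorem natDegree_sigma_le {f : (W1 p k)[X]} (hf : f.natDegree ≤ r * n) :
    (f.map (W1.sigma p k)).natDegree ≤ r * n := natDegree_map_le.trans hf

theorem natDegree_sigma_red_le {f : (W1 p k)[X]} (hf : f.natDegree ≤ r * n) :
    ((f.map (W1.sigma p k)).map (W1.red p k)).natDegree ≤ r * n :=
  natDegree_red_le (natDegree_sigma_le hf)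

/-- The Frobenius-semilinear map `H⁰(X₀, Ω) → H⁰(X₀', Ω)` of base change by the Frobenius of `k`:
`t ↦ t`, `y ↦ y`, and `c ↦ c ^ p` on constants. -/
noncomputable def prH0 (f : (W1 p k)[X]) (hf : f.natDegree ≤ r * n)
    (ω : H0Ω n r (f.map (W1.red p k)) (natDegree_red_le hf)) :
    H0Ω n r ((f.map (W1.sigma p k)).map (W1.red p k)) (natDegree_sigma_red_le hf) :=
  ⟨(kaehlerMap (frobenius k p) (UBar.map (frobenius k p) (map_red_sigma f))
      (UBar.map_comp _ _) ω.1.1,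
    kaehlerMap (frobenius k p) (VRing.map r (frobenius k p) (map_red_sigma f))
      (VRing.map_comp r _ _) ω.1.2), by
    have h : resΩU n _ ω.1.1 = resΩV n r _ (natDegree_red_le hf) ω.1.2 := ω.2
    have h' := congrArg (kaehlerMap (frobenius k p) (UV.map (n := n) (frobenius k p)
      (map_red_sigma f)) (UV.map_comp _ _)) h
    have e1 := kaehlerMap_comp (RingHom.id k) (resU n (f.map (W1.red p k))) resU_comp
      (frobenius k p) (UV.map (frobenius k p) (map_red_sigma f)) (UV.map_comp _ _)
      (frobenius k p) (UBar.map (frobenius k p) (map_red_sigma f)) (UBar.map_comp _ _)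
      (RingHom.id k) (resU n _) resU_comp (map_resU _ _) ω.1.1
    have e2 := kaehlerMap_comp (RingHom.id k) (resV n (f.map (W1.red p k)) r (natDegree_red_le hf))
      (resV_comp r _)
      (frobenius k p) (UV.map (frobenius k p) (map_red_sigma f)) (UV.map_comp _ _)
      (frobenius k p) (VRing.map r (frobenius k p) (map_red_sigma f)) (VRing.map_comp r _ _)
      (RingHom.id k) (resV n _ r (natDegree_sigma_red_le hf)) (resV_comp r _)
      (map_resV r _ _ _ _) ω.1.2
    exact e1.symm.trans (h'.trans e2)⟩

variable [PerfectRing k p]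

/-- `Φ' : H⁰(X₀', Ω) → H¹_dR(X₀)` is the morphism induced by the Deligne–Illusie morphism in
degree one, `ω ↦ [(φ_U(ω), φ_V(ω), h(ω))]`, where `φ_U = F_U^* / p`, `φ_V = F_V^* / p` and
`h = (F_U - F_V) / p` on the intersection, to which the lifts `F_U`, `F_V` of Frobenius extend
as `G_U`, `G_V`. -/
def IsDeligneIllusie (f : (W1 p k)[X]) (hf : f.natDegree ≤ r * n) (hn : (n : k) ≠ 0)
    {v b : k[X]} (hv : FrobVRel n r f v b)
    (Φ' : H0Ω n r ((f.map (W1.sigma p k)).map (W1.red p k)) (natDegree_sigma_red_le hf) →ₗ[k]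
      H1dR n r (f.map (W1.red p k)) (natDegree_red_le hf)) : Prop :=
  ∃ (φU : Ω[UBar n ((f.map (W1.sigma p k)).map (W1.red p k))⁄k] →+
        Ω[UBar n (f.map (W1.red p k))⁄k])
    (φV : Ω[VRing n r ((f.map (W1.sigma p k)).map (W1.red p k))⁄k] →+
        Ω[VRing n r (f.map (W1.red p k))⁄k])
    (h : Ω[UV n ((f.map (W1.sigma p k)).map (W1.red p k))⁄k] →+ UV n (f.map (W1.red p k)))
    (GU GV : UV n (f.map (W1.sigma p k)) →+* UV n f),
    IsDividedFrobenius (frobU f hn) (frobU_comp f hn) (UBar.map (W1.red p k) rfl)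
      (UBar.map_comp _ _) (UBar.map (W1.red p k) rfl) (UBar.map_comp _ _) φU ∧
    IsDividedFrobenius (frobV hv) (frobV_comp hv) (VRing.map r (W1.red p k) rfl)
      (VRing.map_comp r _ _) (VRing.map r (W1.red p k) rfl) (VRing.map_comp r _ _) φV ∧
    GU.comp (resU n _) = (resU n f).comp (frobU f hn) ∧
    GV.comp (resV n _ r (natDegree_sigma_le hf)) = (resV n f r hf).comp (frobV hv) ∧
    IsFrobeniusDifference (p := p) GU GV (UV.map (W1.red p k) rfl) (UV.map (W1.red p k) rfl) h ∧
    ∀ ω, HasClass (natDegree_red_le hf) (φU ω.1.1, φV ω.1.2, h (resΩU n _ ω.1.1)) (Φ' ω)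

end DeligneIllusie

/-! ### The setting over `W(k)` -/

section Setting

variable {p : ℕ} [Fact p.Prime] {k : Type*} [Field k] [CharP k p]

/-- The class of a polynomial over `W(k)` modulo `p²`. -/
noncomputable def modP2 (F : (WittVector p k)[X]) : (W1 p k)[X] :=
  F.map (Ideal.Quotient.mk (Ideal.span {(p : WittVector p k) ^ 2}))

/-- The class of a polynomial over `W(k)` modulo `p`. -/
noncomputable abbrev modP (F : (WittVector p k)[X]) : k[X] := (modP2 F).map (W1.red p k)

theorem modP_eq (F : (WittVector p k)[X]) : modP F = F.map WittVector.constantCoeff := by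
  rw [modP, modP2, Polynomial.map_map]; rfl

theorem natCast_ne_zero {n : ℕ} (hn : n.Coprime p) : (n : k) ≠ 0 := by
  rw [Ne, CharP.cast_eq_zero_iff k p]
  exact fun h => (Fact.out : p.Prime).ne_one (Nat.eq_one_of_dvd_coprimes hn h dvd_rfl)

theorem natDegree_modP2_le {n r : ℕ} {F : (WittVector p k)[X]} (hl : F.natDegree + 1 = r * n) :
    (modP2 F).natDegree ≤ r * n := natDegree_map_le.trans (by omega)

theorem isCoprime_infPoly_modP {n r : ℕ} {F : (WittVector p k)[X]} (hl : F.natDegree + 1 = r * n)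
    (hu : IsUnit F.leadingCoeff) (hF : IsCoprime F (derivative F)) :
    IsCoprime (infPoly n r (modP F)) (derivative (infPoly n r (modP F))) := by
  have hd : (modP F).natDegree = F.natDegree := by
    rw [modP_eq]
    exact natDegree_map_of_leadingCoeff_ne_zero _ (hu.map _).ne_zero
  refine infPoly_isCoprime (by rw [hd, hl]) ?_
  rw [modP_eq, derivative_map]
  exact hF.map (mapRingHom WittVector.constantCoeff)

/-- The coefficient of index `m` of a polynomial, for an integer `m`; zero if `m < 0`. -/
noncomputable def coeffInt (Q : k[X]) (m : ℤ) : k := if 0 ≤ m then Q.coeff m.toNat else 0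

end Setting

end Superelliptic

open Superelliptic

namespace Superelliptic

-- Forms on `y ≠ 0` and on the overlap are multiples of `dt`, and forms on `V` are multiples of `ds
-- / z ^ (n - 1)`, which restricts to a unit times `dt`. Since `f(0) ≠ 0`, a function on the overlap
-- expands as `∑ c_j(t) y ^ j`, `j < n`, with Laurent series `c_j` (`UV.coord`). Functions on `y ≠
-- 0` give series without polar terms, and functions on `V` give only terms `t ^ m y ^ j` with `m ≤
-- - r j`. Hence global functions are constant, restrictions are injective, and the `h_{i,j}` with
-- `1 ≤ i < r j` form a basis of `H¹(𝒪)`. The forms `α^U` and `α^V` are the polynomial and the polar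
-- part of `d h_{i,j}`, so `τ` exists, is unique, and splits `0 → H⁰(Ω) → H¹_dR → H¹(𝒪) → 0`.
--
-- For Frobenius, `p² = 0` gives `F_V(t) = (s ^ p + p v) ^ (-1) = t ^ p - p v(1/t) t ^ (2 p)`. So
-- `φ_U(dt) = t ^ (p - 1) dt`, `φ_V(ds) = (s ^ (p - 1) + v') ds` and `h(dt) = v(1/t) t ^ (2 p)`. The
-- existence of `φ_V` and the divisibility of `s ^ (p - 1) + v'` by `f₂ ^ a` both come from
-- differentiating the relation that defines `v` and `w` and dividing by `p`
-- (`FrobVRel.derivative_eq`). Uniqueness of the morphism is flatness over `W₁`: what is killed by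
-- `p` reduces to zero (`UV.map_red_eq_zero`).
--
-- For `ω_{i,j}` the `V`-component is `t ^ N Q(1/t) y ^ (-b) dt` with `N = r b - 2 + p (i + 2 - r
-- j)` (`ofLaurent_Q`). The function component is `t ^ (p (i + 2)) v(1/t) f ^ (-(a + 1)) y ^ (n -
-- b)`. Modulo functions on `y ≠ 0` one may replace `1/f` by `I`, which leaves `∑ g_m h_{m, n-b}`
-- with `g_m = ∑ IP[κ] v[p (i + 2) + κ + m]` (`exists_add_sum_hFun`). The terms with `m < r (n - b)`
-- are removed by `τ`. The others are functions on `V`, removed by a coboundary, and this adds `g_m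
-- d h_{m, n-b}` to the `V`-component. What remains is a global form. Its polar coefficients cancel
-- by the cocycle condition, `α^V` contributes nothing to the non-negative ones, and reading these
-- off gives `c_μ + Q[N - μ]` (`laurent_identity`).

local notation "D" => KaehlerDifferential.D

/-! ### Functionals on differential forms from maps to dual numbers -/

section Dual

variable {R A B : Type*} [CommRing R] [CommRing A] [CommRing B] [Algebra R A] [Algebra R B]

/-- A ring map into `B[ε]` is a ring map `φ : A → B` together with a derivation along `φ`, and the
universal property of Kähler differentials turns the latter into `a db ↦ φ(a) δ(b)`. Maps on forms
can thus be defined by images of coordinates, the only check being the equation of the curve over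
the dual numbers. -/
theorem exists_kaehler_functional (Ψ : A →+* DualNumber B)
    (hΨ : Ψ.comp (algebraMap R A) = algebraMap R (DualNumber B)) :
    ∃ Λ : Ω[A⁄R] →ₗ[R] B, ∀ a b : A, Λ (a • KaehlerDifferential.D R A b) =
      (Ψ a).fst * (Ψ b).snd := by
  let φ : A →+* B := (TrivSqZeroExt.fstHom B B B).toRingHom.comp Ψ
  let _ : Module A B := Module.compHom B φ
  have hsm : ∀ (a : A) (b : B), a • b = (Ψ a).fst * b := fun _ _ => rfl
  have hal : ∀ c : R, Ψ (algebraMap R A c) = TrivSqZeroExt.inl (algebraMap R B c) := fun c => by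
    rw [← RingHom.comp_apply, hΨ]; rfl
  have : IsScalarTower R A B := IsScalarTower.of_algebraMap_smul fun c x => by
    rw [hsm, hal, TrivSqZeroExt.fst_inl, Algebra.smul_def]
  let δ : Derivation R A B := Derivation.mk'
    { toFun := fun a => (Ψ a).snd
      map_add' := fun x y => by rw [map_add, TrivSqZeroExt.snd_add]
      map_smul' := fun c x => by
        rw [Algebra.smul_def, map_mul, hal, TrivSqZeroExt.snd_mul]
        simp [Algebra.smul_def] } (fun a b => by
        change (Ψ (a * b)).snd = (Ψ a).fst * (Ψ b).snd + (Ψ b).fst * (Ψ a).snd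
        rw [map_mul, TrivSqZeroExt.snd_mul]; simp [mul_comm])
  refine ⟨δ.liftKaehlerDifferential.restrictScalars R, fun a b => ?_⟩
  rw [LinearMap.restrictScalars_apply, map_smul, Derivation.liftKaehlerDifferential_comp_D, hsm]
  rfl

theorem kaehler_functional_smul {Λ : Ω[A⁄R] →+ B} {φ : A → B} {δ : A → B}
    (hφ : ∀ a b, φ (a * b) = φ a * φ b)
    (h : ∀ a b : A, Λ (a • KaehlerDifferential.D R A b) = φ a * δ b) (a : A) (x : Ω[A⁄R]) :
    Λ (a • x) = φ a * Λ x := by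
  refine kaehler_induction (P := fun x => Λ (a • x) = φ a * Λ x) (by simp)
    (fun x y hx hy => by rw [smul_add, map_add, map_add, hx, hy, mul_add]) (fun c b => ?_) x
  rw [smul_smul, h, h, hφ, mul_assoc]

theorem aeval_inl_add_inr (f : R[X]) (x b : B) :
    aeval (TrivSqZeroExt.inl x + TrivSqZeroExt.inr b : DualNumber B) f =
      TrivSqZeroExt.inl (aeval x f) + TrivSqZeroExt.inr (aeval x (derivative f) * b) := by
  have h : ∀ g : R[X], aeval (TrivSqZeroExt.inl x : DualNumber B) g =
      TrivSqZeroExt.inl (aeval x g) := fun g =>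
    aeval_algHom_apply (TrivSqZeroExt.inlAlgHom R B B) x g
  rw [aeval_add_of_sq_eq_zero _ _ _ (by rw [sq, TrivSqZeroExt.inr_mul_inr]), h, h,
    TrivSqZeroExt.inl_mul_inr, smul_eq_mul]

theorem inl_add_inr_pow (n : ℕ) (x b : B) :
    (TrivSqZeroExt.inl x + TrivSqZeroExt.inr b : DualNumber B) ^ n =
      TrivSqZeroExt.inl (x ^ n) + TrivSqZeroExt.inr (n * x ^ (n - 1) * b) := by
  have := aeval_inl_add_inr (R := B) (X ^ n) x b
  simpa only [map_pow, aeval_X, derivative_X_pow, map_mul, aeval_C, map_natCast] using this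

theorem isUnit_inl_add_inr {x : B} (hx : IsUnit x) (b : B) :
    IsUnit (TrivSqZeroExt.inl x + TrivSqZeroExt.inr b : DualNumber B) := by
  rw [TrivSqZeroExt.isUnit_iff_isUnit_fst]; simpa using hx

end Dual

/-! ### Induction on the coordinate rings -/

section Induction

variable {R : Type*} [CommRing R] {n : ℕ} {f : R[X]}

theorem Plane.induction {P : Plane n f → Prop} (hc : ∀ c : R, P (algebraMap R _ c))
    (ht : P (Plane.fst n f)) (hy : P (Plane.snd n f)) (hadd : ∀ x y, P x → P y → P (x + y))
    (hmul : ∀ x y, P x → P y → P (x * y)) (x : Plane n f) : P x := by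
  have h1 : P 1 := by simpa using hc 1
  have hpow : ∀ x, P x → ∀ m : ℕ, P (x ^ m) := fun x hx m => by
    induction m with
    | zero => simpa using h1
    | succ m ih => rw [pow_succ]; exact hmul _ _ ih hx
  have hpoly : ∀ q : R[X], P (AdjoinRoot.of _ q) := fun q => by
    rw [← Plane.aeval_fst]
    induction q using Polynomial.induction_on' with
    | add p q hp hq => rw [map_add]; exact hadd _ _ hp hq
    | monomial m a => rw [aeval_monomial]; exact hmul _ _ (hc a) (hpow _ ht m)
  induction x using AdjoinRoot.induction_on with
  | _ q =>
    induction q using Polynomial.induction_on' with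
    | add p q hp hq => rw [map_add]; exact hadd _ _ hp hq
    | monomial m a =>
      rw [← C_mul_X_pow_eq_monomial, map_mul, map_pow, AdjoinRoot.mk_C, AdjoinRoot.mk_X]
      exact hmul _ _ (hpoly a) (hpow _ hy m)

theorem UBar.induction {P : UBar n f → Prop} (hc : ∀ c : R, P (algebraMap R _ c))
    (ht : P (UBar.t n f)) (hy : P (UBar.y n f)) (hy' : P (UBar.yInv n f))
    (hadd : ∀ x y, P x → P y → P (x + y))
    (hmul : ∀ x y, P x → P y → P (x * y)) (x : UBar n f) : P x := by
  have h1 : P 1 := by simpa using hc 1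
  have hpow : ∀ x, P x → ∀ m : ℕ, P (x ^ m) := fun x hx m => by
    induction m with
    | zero => simpa using h1
    | succ m ih => rw [pow_succ]; exact hmul _ _ ih hx
  obtain ⟨m, a, h⟩ := IsLocalization.Away.surj (Plane.snd n f) x
  have ha : P (algebraMap _ _ a) := Plane.induction (P := fun a => P (algebraMap _ _ a))
    (fun c => by rw [← IsScalarTower.algebraMap_apply]; exact hc c) ht hy
    (fun x y hx hy => by rw [map_add]; exact hadd _ _ hx hy)
    (fun x y hx hy => by rw [map_mul]; exact hmul _ _ hx hy) a
  have e : x = algebraMap _ _ a * UBar.yInv n f ^ m := by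
    rw [← h, mul_assoc, ← mul_pow]
    change _ = x * (UBar.y n f * _) ^ m
    rw [UBar.y_mul_yInv, one_pow, mul_one]
  rw [e]
  exact hmul _ _ ha (hpow _ hy' m)

theorem UV.induction {P : UV n f → Prop} (hc : ∀ c : R, P (algebraMap R _ c))
    (ht : P (UV.t n f)) (ht' : P (UV.tInv n f)) (hy : P (UV.y n f)) (hy' : P (UV.yInv n f))
    (hadd : ∀ x y, P x → P y → P (x + y))
    (hmul : ∀ x y, P x → P y → P (x * y)) (x : UV n f) : P x := by
  have h1 : P 1 := by simpa using hc 1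
  have hpow : ∀ x, P x → ∀ m : ℕ, P (x ^ m) := fun x hx m => by
    induction m with
    | zero => simpa using h1
    | succ m ih => rw [pow_succ]; exact hmul _ _ ih hx
  obtain ⟨m, a, h⟩ := IsLocalization.Away.surj (Plane.fst n f * Plane.snd n f) x
  have ha : P (algebraMap _ _ a) := Plane.induction (P := fun a => P (algebraMap _ _ a))
    (fun c => by rw [← IsScalarTower.algebraMap_apply]; exact hc c) ht hy
    (fun x y hx hy => by rw [map_add]; exact hadd _ _ hx hy)
    (fun x y hx hy => by rw [map_mul]; exact hmul _ _ hx hy) a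
  have e : x = algebraMap _ _ a * (UV.tInv n f * UV.yInv n f) ^ m := by
    rw [← h, map_mul, mul_assoc, ← mul_pow]
    change _ = x * (UV.t n f * UV.y n f * _) ^ m
    rw [mul_mul_mul_comm, UV.t_mul_tInv, UV.y_mul_yInv, one_mul, one_pow, mul_one]
  rw [e]
  exact hmul _ _ ha (hpow _ (hmul _ _ ht' hy') m)

theorem UV.hom_ext {S : Type*} [CommRing S] {φ ψ : UV n f →+* S}
    (h : φ.comp (algebraMap R _) = ψ.comp (algebraMap R _))
    (ht : φ (UV.t n f) = ψ (UV.t n f)) (hy : φ (UV.y n f) = ψ (UV.y n f)) : φ = ψ := by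
  refine IsLocalization.ringHom_ext (Submonoid.powers (Plane.fst n f * Plane.snd n f))
    (Plane.hom_ext ?_ ht hy)
  rw [RingHom.comp_assoc, RingHom.comp_assoc, ← IsScalarTower.algebraMap_eq, h]

end Induction

/-! ### Generators of the modules of differential forms -/

section Forms

variable {R : Type*} [CommRing R] {n : ℕ} {f : R[X]}

/-- If `d` of every function is a multiple of `δ`, so is every form. -/
theorem kaehler_eq_smul {A : Type*} [CommRing A] [Algebra R A] {δ : Ω[A⁄R]}
    (h : ∀ a : A, ∃ c : A, D R A a = c • δ) (x : Ω[A⁄R]) : ∃ c : A, x = c • δ := by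
  refine kaehler_induction (P := fun x => ∃ c : A, x = c • δ) ⟨0, by simp⟩ ?_ ?_ x
  · rintro _ _ ⟨a, rfl⟩ ⟨b, rfl⟩; exact ⟨a + b, (add_smul ..).symm⟩
  · intro a b
    obtain ⟨c, hc⟩ := h b
    exact ⟨a * c, by rw [hc, smul_smul]⟩

/-- Differentiating the equation gives `n y ^ (n - 1) dy = f'(t) dt`, and `n` and `y` are
invertible. -/
theorem smul_D_of_pow_eq {A : Type*} [CommRing A] [Algebra R A] {t y y' : A}
    (hy : y * y' = 1) (h : y ^ n = aeval t f) {m : R} (hm : m * n = 1) :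
    D R A y = (algebraMap R A m * y' ^ (n - 1) * aeval t (derivative f)) • D R A t := by
  have h1 := congrArg (D R A) h
  rw [Derivation.leibniz_pow, Derivation.map_aeval, ← Nat.cast_smul_eq_nsmul A] at h1
  have h2 := congrArg (fun w => (algebraMap R A m * y' ^ (n - 1)) • w) h1
  simp only [smul_smul] at h2
  rw [← h2]
  have e : algebraMap R A m * y' ^ (n - 1) * (n * y ^ (n - 1)) = 1 := by
    have : algebraMap R A m * n = 1 := by rw [← map_natCast (algebraMap R A), ← map_mul, hm, map_one]
    calc _ = (algebraMap R A m * n) * (y * y') ^ (n - 1) := by rw [mul_pow]; ring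
      _ = 1 := by rw [this, hy, one_pow, one_mul]
  rw [← mul_assoc] at e
  rw [← mul_assoc, e, one_smul]

theorem UBar.exists_eq_smul_D (hn : IsUnit (n : R)) (ω : Ω[UBar n f⁄R]) :
    ∃ c : UBar n f, ω = c • D R _ (UBar.t n f) := by
  obtain ⟨m, hm⟩ := hn.exists_left_inv
  have hy := smul_D_of_pow_eq UBar.y_mul_yInv (UBar.rel (n := n) (f := f)) hm
  have hadd : ∀ x y : UBar n f, (∃ c : UBar n f, D R _ x = c • D R _ (UBar.t n f)) →
      (∃ c : UBar n f, D R _ y = c • D R _ (UBar.t n f)) →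
      ∃ c : UBar n f, D R (UBar n f) (x + y) = c • D R _ (UBar.t n f) := by
    rintro x y ⟨a, ha⟩ ⟨b, hb⟩
    exact ⟨a + b, by rw [map_add, ha, hb, add_smul]⟩
  refine kaehler_eq_smul (UBar.induction (fun c => ⟨0, by simp⟩) ⟨1, by simp⟩ ⟨_, hy⟩ ?_ hadd ?_) ω
  · rw [derivation_of_mul_eq_one _ UBar.y_mul_yInv, hy, smul_smul]
    exact ⟨_, rfl⟩
  · rintro x y ⟨a, ha⟩ ⟨b, hb⟩
    exact ⟨x * b + y * a, by rw [Derivation.leibniz, ha, hb, smul_smul, smul_smul, add_smul]⟩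

theorem UV.exists_eq_smul_D (hn : IsUnit (n : R)) (ω : Ω[UV n f⁄R]) :
    ∃ c : UV n f, ω = c • D R _ (UV.t n f) := by
  obtain ⟨m, hm⟩ := hn.exists_left_inv
  have hy := smul_D_of_pow_eq UV.y_mul_yInv (UV.rel (n := n) (f := f)) hm
  have hadd : ∀ x y : UV n f, (∃ c : UV n f, D R _ x = c • D R _ (UV.t n f)) →
      (∃ c : UV n f, D R _ y = c • D R _ (UV.t n f)) →
      ∃ c : UV n f, D R (UV n f) (x + y) = c • D R _ (UV.t n f) := by
    rintro x y ⟨a, ha⟩ ⟨b, hb⟩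
    exact ⟨a + b, by rw [map_add, ha, hb, add_smul]⟩
  refine kaehler_eq_smul (UV.induction (fun c => ⟨0, by simp⟩) ⟨1, by simp⟩ ?_ ⟨_, hy⟩ ?_ hadd ?_) ω
  · rw [derivation_of_mul_eq_one _ UV.t_mul_tInv]
    exact ⟨_, rfl⟩
  · rw [derivation_of_mul_eq_one _ UV.y_mul_yInv, hy, smul_smul]
    exact ⟨_, rfl⟩
  · rintro x y ⟨a, ha⟩ ⟨b, hb⟩
    exact ⟨x * b + y * a, by rw [Derivation.leibniz, ha, hb, smul_smul, smul_smul, add_smul]⟩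

/-- The point `(t + ε, y + (f' / (n y ^ (n - 1))) ε)` lies on the curve over the dual numbers: this
is the derivation `d/dt`, which reads off the coefficient of `dt`. -/
theorem dual_rel {B : Type*} [CommRing B] [Algebra R B] {t y y' : B} (hy : y * y' = 1)
    (h : y ^ n = aeval t f) {m : R} (hm : m * n = 1) :
    (TrivSqZeroExt.inl y + TrivSqZeroExt.inr (algebraMap R B m * y' ^ (n - 1) *
      aeval t (derivative f)) : DualNumber B) ^ n =
      f.eval₂ (algebraMap R _) (TrivSqZeroExt.inl t + TrivSqZeroExt.inr 1 : DualNumber B) := by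
  rw [← aeval_def, aeval_inl_add_inr, inl_add_inr_pow, h]
  congr 2
  have : algebraMap R B m * n = 1 := by rw [← map_natCast (algebraMap R B), ← map_mul, hm, map_one]
  calc _ = (algebraMap R B m * n) * (y * y') ^ (n - 1) * aeval t (derivative f) := by
        rw [mul_pow]; ring
    _ = _ := by rw [this, hy, one_pow]; ring

theorem fst_comp {A B : Type*} [CommRing A] [CommRing B] (Ψ : A →+* DualNumber B) (φ : A →+* B)
    (h : (TrivSqZeroExt.fstHom B B B).toRingHom.comp Ψ = φ) (a : A) : (Ψ a).fst = φ a :=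
  RingHom.congr_fun h a

/-- The coefficient of `dt` of a form on `y ≠ 0`. -/
theorem UBar.exists_coeff (hn : IsUnit (n : R)) : ∃ Λ : Ω[UBar n f⁄R] →ₗ[R] UBar n f,
    ∀ c : UBar n f, Λ (c • D R _ (UBar.t n f)) = c := by
  obtain ⟨m, hm⟩ := hn.exists_left_inv
  obtain ⟨Λ, h⟩ := exists_kaehler_functional
    (UBar.lift (algebraMap R (DualNumber (UBar n f))) _ _
      (dual_rel UBar.y_mul_yInv (UBar.rel (n := n) (f := f)) hm)
      (isUnit_inl_add_inr UBar.isUnit_y _)) (UBar.lift_comp ..)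
  refine ⟨Λ, fun c => ?_⟩
  rw [h, UBar.lift_t, fst_comp _ (RingHom.id _)]
  · simp
  -- Without its `ε`-part the map to dual numbers is the identity, so the functional sends `c dt` to
  -- `c` itself.
  · refine UBar.hom_ext ?_ ?_ ?_
    · rw [RingHom.comp_assoc, UBar.lift_comp]; rfl
    · rw [RingHom.comp_apply, UBar.lift_t]; simp
    · rw [RingHom.comp_apply, UBar.lift_y]; simp

/-- The coefficient of `dt` of a form on `t y ≠ 0`. -/
theorem UV.exists_coeff (hn : IsUnit (n : R)) : ∃ Λ : Ω[UV n f⁄R] →ₗ[R] UV n f,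
    ∀ c : UV n f, Λ (c • D R _ (UV.t n f)) = c := by
  obtain ⟨m, hm⟩ := hn.exists_left_inv
  obtain ⟨Λ, h⟩ := exists_kaehler_functional
    (UV.lift (algebraMap R (DualNumber (UV n f))) _ _
      (dual_rel UV.y_mul_yInv (UV.rel (n := n) (f := f)) hm)
      (isUnit_inl_add_inr UV.isUnit_t _) (isUnit_inl_add_inr UV.isUnit_y _)) (UV.lift_comp ..)
  refine ⟨Λ, fun c => ?_⟩
  rw [h, UV.lift_t, fst_comp _ (RingHom.id _)]
  · simp
  · refine UV.hom_ext ?_ ?_ ?_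
    · rw [RingHom.comp_assoc, UV.lift_comp]; rfl
    · rw [RingHom.comp_apply, UV.lift_t]; simp
    · rw [RingHom.comp_apply, UV.lift_y]; simp

theorem UV.smul_D_injective (hn : IsUnit (n : R)) {a b : UV n f}
    (h : a • D R _ (UV.t n f) = b • D R _ (UV.t n f)) : a = b := by
  obtain ⟨Λ, hΛ⟩ := UV.exists_coeff (f := f) hn
  rw [← hΛ a, h, hΛ]

end Forms

/-! ### Expansions in powers of the second coordinate -/

section Expansion

variable {R : Type*} [CommRing R] {n : ℕ}

theorem Plane.exists_sum (hn : 1 ≤ n) (g : R[X]) (x : Plane n g) : ∃ P : ℕ → R[X],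
    x = ∑ j ∈ Finset.range n, aeval (Plane.fst n g) (P j) * Plane.snd n g ^ j := by
  rcases subsingleton_or_nontrivial R with _ | _
  · have := RingHom.codomain_trivial (algebraMap R (Plane n g))
    exact ⟨0, Subsingleton.elim _ _⟩
  have hm : ((X : R[X][X]) ^ n - C g).Monic := monic_X_pow_sub_C g (by omega)
  obtain ⟨q, rfl⟩ := AdjoinRoot.mk_surjective x
  refine ⟨fun j => (q %ₘ (X ^ n - C g)).coeff j, ?_⟩
  have h1 : AdjoinRoot.mk (X ^ n - C g) q = AdjoinRoot.mk _ (q %ₘ (X ^ n - C g)) := by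
    conv_lhs => rw [← modByMonic_add_div q (X ^ n - C g)]
    rw [map_add, map_mul, AdjoinRoot.mk_self, zero_mul, add_zero]
  have hd : (q %ₘ (X ^ n - C g)).natDegree < n := by
    have := natDegree_modByMonic_lt q hm (by
      intro h; have := congrArg natDegree h; rw [natDegree_X_pow_sub_C, natDegree_one] at this; omega)
    rwa [natDegree_X_pow_sub_C] at this
  rw [h1, (q %ₘ (X ^ n - C g)).as_sum_range' n hd, map_sum]
  refine Finset.sum_congr rfl fun j hj => ?_
  rw [Plane.aeval_fst, ← C_mul_X_pow_eq_monomial, map_mul, map_pow, AdjoinRoot.mk_C, AdjoinRoot.mk_X,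
    ← (q %ₘ (X ^ n - C g)).as_sum_range' n hd]
  rfl

/-- A combination of powers of the root below `n` is its own remainder modulo the monic polynomial
of degree `n`, so its coefficients are determined. -/
theorem modByMonicHom_sum {K : Type*} [CommRing K] [Nontrivial K] (g : K) (c : ℕ → K) {j : ℕ}
    (hj : j < n) : (AdjoinRoot.modByMonicHom (monic_X_pow_sub_C g (by omega : n ≠ 0))
      (∑ i ∈ Finset.range n, AdjoinRoot.of (X ^ n - C g) (c i) *
      AdjoinRoot.root (X ^ n - C g) ^ i)).coeff j = c j := by
  have h1 : ∑ i ∈ Finset.range n, AdjoinRoot.of (X ^ n - C g) (c i) *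
      AdjoinRoot.root (X ^ n - C g) ^ i =
      AdjoinRoot.mk (X ^ n - C g) (∑ j ∈ Finset.range n, C (c j) * X ^ j) := by
    rw [map_sum]
    refine Finset.sum_congr rfl fun j _ => ?_
    rw [map_mul, map_pow, AdjoinRoot.mk_C, AdjoinRoot.mk_X]
  rw [h1, AdjoinRoot.modByMonicHom_mk, (modByMonic_eq_self_iff
    (monic_X_pow_sub_C g (by omega))).2]
  · simp [hj, coeff_X_pow]
  · rw [degree_X_pow_sub_C (by omega)]
    refine mem_degreeLT.1 (Submodule.sum_mem _ fun i hi => mem_degreeLT.2 ?_)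
    exact (degree_C_mul_X_pow_le _ _).trans_lt (by exact_mod_cast Finset.mem_range.1 hi)

theorem sum_of_mul_root_eq_zero {K : Type*} [CommRing K] (g : K) {c : ℕ → K}
    (h : ∑ j ∈ Finset.range n, AdjoinRoot.of (X ^ n - C g) (c j) *
      AdjoinRoot.root (X ^ n - C g) ^ j = 0) {j : ℕ} (hj : j < n) : c j = 0 := by
  nontriviality K
  rw [← modByMonicHom_sum g c hj, h, map_zero, coeff_zero]

theorem Plane.eq_zero_of_sum_eq_zero (g : R[X]) {P : ℕ → R[X]}
    (h : ∑ j ∈ Finset.range n, aeval (Plane.fst n g) (P j) * Plane.snd n g ^ j = 0) {j : ℕ}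
    (hj : j < n) : P j = 0 :=
  sum_of_mul_root_eq_zero g (by simp only [Plane.aeval_fst] at h; exact h) hj

/-- After multiplication by a power of `f(t)`, a function on `y ≠ 0` is a polynomial. -/
theorem UBar.exists_sum (hn : 1 ≤ n) {f : R[X]} (x : UBar n f) : ∃ (m : ℕ) (P : ℕ → R[X]),
    aeval (UBar.t n f) f ^ m * x =
      ∑ j ∈ Finset.range n, aeval (UBar.t n f) (P j) * UBar.y n f ^ j := by
  obtain ⟨m, a, h⟩ := IsLocalization.Away.surj (Plane.snd n f) x
  -- The denominator of `x` is `y ^ m`; a further factor `y ^ ((n - 1) m)` turns it into `y ^ (n m)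
  -- = f(t) ^ m`.
  obtain ⟨P, hP⟩ := Plane.exists_sum hn f (Plane.snd n f ^ ((n - 1) * m) * a)
  refine ⟨m, P, ?_⟩
  have h2 := congrArg (algebraMap (Plane n f) (UBar n f)) hP
  rw [map_mul, ← h, map_pow, map_sum] at h2
  simp only [map_mul, map_pow, ← aeval_algebraMap_apply] at h2
  rw [UBar.t, UBar.y, ← h2, mul_left_comm, mul_comm x, ← pow_add, ← UBar.t, ← UBar.rel, UBar.y,
    ← pow_mul]
  congr 2
  obtain ⟨n, rfl⟩ : ∃ e, n = e + 1 := ⟨n - 1, by omega⟩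
  rw [Nat.add_sub_cancel]; ring

/-- After multiplication by a power of `t f(t)`, a function on `t y ≠ 0` is a polynomial. -/
theorem UV.exists_sum (hn : 1 ≤ n) {f : R[X]} (x : UV n f) : ∃ (m : ℕ) (P : ℕ → R[X]),
    (UV.t n f * aeval (UV.t n f) f) ^ m * x =
      ∑ j ∈ Finset.range n, aeval (UV.t n f) (P j) * UV.y n f ^ j := by
  obtain ⟨m, a, h⟩ := IsLocalization.Away.surj (Plane.fst n f * Plane.snd n f) x
  obtain ⟨P, hP⟩ := Plane.exists_sum hn f (Plane.snd n f ^ ((n - 1) * m) * a)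
  refine ⟨m, P, ?_⟩
  have h2 := congrArg (algebraMap (Plane n f) (UV n f)) hP
  rw [map_mul, ← h, map_pow, map_sum, map_mul] at h2
  simp only [map_mul, map_pow, ← aeval_algebraMap_apply] at h2
  rw [← UV.rel]
  simp only [UV.t, UV.y]
  rw [← h2]
  obtain ⟨n, rfl⟩ : ∃ e, n = e + 1 := ⟨n - 1, by omega⟩
  rw [Nat.add_sub_cancel, mul_pow, mul_pow]; ring

end Expansion

/-! ### Restriction from `V` in the coordinates `t`, `y`. -/

section V

variable {R : Type*} [CommRing R] {n r : ℕ} {f : R[X]} (hf : f.natDegree ≤ r * n)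

theorem resV_s : resV n f r hf (VRing.s n f r) = UV.tInv n f := Plane.lift_fst ..

theorem resV_z : resV n f r hf (VRing.z n f r) = UV.tInv n f ^ r * UV.y n f := Plane.lift_snd ..

theorem resV_aeval (P : R[X]) : resV n f r hf (aeval (VRing.s n f r) P) = aeval (UV.tInv n f) P := by
  rw [eval₂_comp_algebraMap, resV_comp, resV_s, RingHom.comp_id, aeval_def]

end V

/-! ### Laurent expansions at `t = 0` -/

section Laurent

variable {k : Type*} [Field k]

/-- The variable of the field of Laurent series. -/
noncomputable abbrev laurentT (k : Type*) [Field k] : LaurentSeries k := HahnSeries.single 1 1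

/-- The inverse of the variable of the field of Laurent series. -/
noncomputable abbrev laurentTInv (k : Type*) [Field k] : LaurentSeries k := HahnSeries.single (-1) 1

theorem laurentT_mul_inv : laurentT k * laurentTInv k = 1 := by
  rw [HahnSeries.single_mul_single]; simp

theorem laurent_algebraMap (a : k) : algebraMap k (LaurentSeries k) a = HahnSeries.C a := by
  simp [RingHom.algebraMap_toAlgebra]

theorem aeval_laurentT (P : k[X]) :
    aeval (laurentT k) P = HahnSeries.ofPowerSeries ℤ k (P : PowerSeries k) := by
  induction P using Polynomial.induction_on' with
  | add p q hp hq => rw [map_add, Polynomial.coe_add, map_add, hp, hq]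
  | monomial m a =>
    rw [aeval_monomial, ← C_mul_X_pow_eq_monomial, Polynomial.coe_mul, Polynomial.coe_pow,
      Polynomial.coe_X, Polynomial.coe_C, map_mul, map_pow, HahnSeries.ofPowerSeries_X,
      HahnSeries.ofPowerSeries_C]
    rw [laurent_algebraMap]

theorem coeff_aeval_laurentTInv (P : k[X]) (m : ℤ) :
    (aeval (laurentTInv k) P).coeff m = if m ≤ 0 then P.coeff (-m).toNat else 0 := by
  induction P using Polynomial.induction_on' with
  | add p q hp hq =>
    rw [map_add, HahnSeries.coeff_add, hp, hq, coeff_add]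
    split_ifs <;> simp
  | monomial q a =>
    have : aeval (laurentTInv k) (monomial q a) = HahnSeries.single (-(q : ℤ)) a := by
      rw [aeval_monomial, HahnSeries.single_pow]
      rw [laurent_algebraMap, HahnSeries.C_apply, HahnSeries.single_mul_single]
      simp
    rw [this, HahnSeries.coeff_single, coeff_monomial]
    split_ifs <;> first | rfl | omega

theorem coeff_aeval_laurentTInv_mul (P : k[X]) (e : ℕ) (m : ℤ) :
    (aeval (laurentTInv k) P * laurentTInv k ^ e).coeff m =
      if m + e ≤ 0 then P.coeff (-(m + e)).toNat else 0 := by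
  have h1 : laurentTInv k ^ e = HahnSeries.single (-(e : ℤ)) 1 := by
    rw [HahnSeries.single_pow]; simp
  have h2 : m = (m + e) + (-(e : ℤ)) := by ring
  conv_lhs => rw [h2]
  rw [h1, HahnSeries.coeff_mul_single_add, mul_one, coeff_aeval_laurentTInv]

end Laurent

/-! ### Coordinates in `k((t))[y]` and the pole conditions coming from the two open sets. -/

section Model

variable {k : Type*} [Field k] (n : ℕ) (f : k[X])

/-- `k((t))[y] / (y ^ n - f(t))`. -/
abbrev LaurentModel : Type _ :=
  AdjoinRoot ((X : (LaurentSeries k)[X]) ^ n - C (aeval (laurentT k) f))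

variable {n f}

theorem LaurentModel.root_pow :
    (AdjoinRoot.root _ : LaurentModel n f) ^ n = AdjoinRoot.of _ (aeval (laurentT k) f) := by
  have h := AdjoinRoot.eval₂_root ((X : (LaurentSeries k)[X]) ^ n - C (aeval (laurentT k) f))
  rwa [eval₂_sub, eval₂_X_pow, eval₂_C, sub_eq_zero] at h

theorem LaurentModel.of_aeval (t : LaurentSeries k) (P : k[X]) :
    (AdjoinRoot.of _ (aeval t P) : LaurentModel n f) = aeval (AdjoinRoot.of _ t) P :=
  (aeval_algebraMap_apply (LaurentModel n f) t P).symm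

theorem ne_zero_of_isCoprime_X (ht : IsCoprime X f) : f.coeff 0 ≠ 0 := by
  intro h
  have h1 : X ∣ f := X_dvd_iff.2 h
  exact not_isUnit_X (ht.isUnit_of_dvd' dvd_rfl h1)

theorem aeval_laurentT_ne_zero (ht : IsCoprime X f) : aeval (laurentT k) f ≠ 0 := by
  rw [aeval_laurentT]
  intro h
  rw [map_eq_zero_iff _ HahnSeries.ofPowerSeries_injective, Polynomial.coe_eq_zero_iff] at h
  exact ne_zero_of_isCoprime_X ht (by simp [h])

theorem LaurentModel.isUnit_root (hn : 1 ≤ n) (ht : IsCoprime X f) :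
    IsUnit (AdjoinRoot.root _ : LaurentModel n f) := by
  refine isUnit_of_mul_isUnit_left (y := (AdjoinRoot.root _) ^ (n - 1)) ?_
  rw [← pow_succ', Nat.sub_add_cancel hn, LaurentModel.root_pow]
  exact (IsUnit.mk0 _ (aeval_laurentT_ne_zero ht)).map _

/-- The expansion of functions on `t y ≠ 0` along `t = 0`. -/
noncomputable def UV.toLaurent (hn : 1 ≤ n) (ht : IsCoprime X f) : UV n f →+* LaurentModel n f :=
  UV.lift (algebraMap k _) (AdjoinRoot.of _ (laurentT k)) (AdjoinRoot.root _)
    (by rw [LaurentModel.root_pow, LaurentModel.of_aeval, aeval_def])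
    ((IsUnit.of_mul_eq_one _ laurentT_mul_inv).map _) (LaurentModel.isUnit_root hn ht)

variable (hn : 1 ≤ n) (ht : IsCoprime X f)

theorem UV.toLaurent_t : UV.toLaurent hn ht (UV.t n f) = AdjoinRoot.of _ (laurentT k) :=
  UV.lift_t ..

theorem UV.toLaurent_y : UV.toLaurent hn ht (UV.y n f) = AdjoinRoot.root _ := UV.lift_y ..

theorem UV.toLaurent_tInv :
    UV.toLaurent hn ht (UV.tInv n f) = AdjoinRoot.of _ (laurentTInv k) := by
  have h1 := congrArg (UV.toLaurent hn ht) (UV.t_mul_tInv (n := n) (f := f))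
  have h2 := congrArg (AdjoinRoot.of (X ^ n - C (aeval (laurentT k) f))) (laurentT_mul_inv (k := k))
  rw [map_mul, map_one, UV.toLaurent_t] at h1
  rw [map_mul, map_one, ← h1] at h2
  exact ((IsUnit.of_mul_eq_one _ laurentT_mul_inv).map _).mul_left_cancel h2.symm

theorem UV.toLaurent_aeval (x : UV n f) (P : k[X]) :
    UV.toLaurent hn ht (aeval x P) = aeval (UV.toLaurent hn ht x) P := by
  have h : (UV.toLaurent hn ht).comp (algebraMap k _) = algebraMap k _ := UV.lift_comp ..
  rw [eval₂_comp_algebraMap, h]; rfl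

/-- The coefficient of `y ^ j`, `j < n`, as a Laurent series in `t`. -/
noncomputable def UV.coord (j : ℕ) (x : UV n f) : LaurentSeries k :=
  (AdjoinRoot.modByMonicHom (monic_X_pow_sub_C (aeval (laurentT k) f) (by omega : n ≠ 0))
    (UV.toLaurent hn ht x)).coeff j

theorem UV.coord_add (j : ℕ) (x y : UV n f) :
    UV.coord hn ht j (x + y) = UV.coord hn ht j x + UV.coord hn ht j y := by
  simp only [UV.coord, map_add, coeff_add]

/-- Coordinates are linear over `k((t))`, so a denominator `a` may be cleared before they are read
off. -/
theorem UV.coord_eq_of_toLaurent {x : UV n f} {a : LaurentSeries k} {c : ℕ → LaurentSeries k}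
    (h : AdjoinRoot.of _ a * UV.toLaurent hn ht x =
      ∑ i ∈ Finset.range n, AdjoinRoot.of _ (c i) * AdjoinRoot.root _ ^ i) {j : ℕ} (hj : j < n) :
    a * UV.coord hn ht j x = c j := by
  rw [← modByMonicHom_sum (aeval (laurentT k) f) c hj, ← h, UV.coord]
  change _ = (AdjoinRoot.modByMonicHom _ (algebraMap _ (LaurentModel n f) a * _)).coeff j
  rw [← Algebra.smul_def, map_smul, coeff_smul, smul_eq_mul]

theorem UV.coord_sum (P : ℕ → k[X]) (e : ℕ → ℕ) {x : UV n f}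
    (h : x = ∑ i ∈ Finset.range n, aeval (UV.tInv n f) (P i) *
      UV.tInv n f ^ e i * UV.y n f ^ i) {j : ℕ} (hj : j < n) :
    UV.coord hn ht j x = aeval (laurentTInv k) (P j) * laurentTInv k ^ e j := by
  rw [← one_mul (UV.coord hn ht j x)]
  refine UV.coord_eq_of_toLaurent hn ht
    (c := fun i => aeval (laurentTInv k) (P i) * laurentTInv k ^ e i) ?_ hj
  rw [map_one, one_mul, h, map_sum]
  refine Finset.sum_congr rfl fun i _ => ?_
  rw [map_mul, map_mul, map_pow, map_pow, UV.toLaurent_aeval, UV.toLaurent_y, UV.toLaurent_tInv,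
    map_mul, map_pow, LaurentModel.of_aeval]

theorem UV.coord_hFun (i j' : ℕ) {j : ℕ} (hj : j < n) (hj' : j' < n) :
    UV.coord hn ht j (hFun n f i j') = if j = j' then laurentTInv k ^ i else 0 := by
  rw [UV.coord_sum hn ht (fun l => if l = j' then 1 else 0) (fun _ => i) ?_ hj]
  · split_ifs <;> simp
  · rw [Finset.sum_eq_single j' (fun b _ hb => by simp [hb]) (by simp [hj'])]
    simp [hFun]

theorem isUnit_coe_of_isCoprime_X (ht : IsCoprime X f) : IsUnit (f : PowerSeries k) := by
  rw [PowerSeries.isUnit_iff_constantCoeff, Polynomial.constantCoeff_coe]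
  exact (ne_zero_of_isCoprime_X ht).isUnit

/-- The same polynomials `P` describe the function and, up to `f ^ m`, its Laurent coordinates; this
serves both the absence of poles and injectivity. -/
theorem UV.coord_resU (u : UBar n f) : ∃ (m : ℕ) (P : ℕ → k[X]),
    aeval (UBar.t n f) f ^ m * u =
      ∑ j ∈ Finset.range n, aeval (UBar.t n f) (P j) * UBar.y n f ^ j ∧
    ∀ j < n, aeval (laurentT k) f ^ m * UV.coord hn ht j (resU n f u) = aeval (laurentT k) (P j) := by
  obtain ⟨m, P, h⟩ := UBar.exists_sum hn u
  refine ⟨m, P, h, fun j hj => UV.coord_eq_of_toLaurent hn ht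
    (c := fun i => aeval (laurentT k) (P i)) ?_ hj⟩
  have hr : ∀ q : k[X], resU n f (aeval (UBar.t n f) q) = aeval (UV.t n f) q := fun q => by
    rw [eval₂_comp_algebraMap, resU_comp, resU_t, RingHom.comp_id, aeval_def]
  have h2 := congrArg (fun x => UV.toLaurent hn ht (resU n f x)) h
  simp only [map_mul, map_pow, map_sum, hr, resU_y, UV.toLaurent_aeval, UV.toLaurent_t,
    UV.toLaurent_y] at h2
  rw [map_pow, LaurentModel.of_aeval, h2]
  refine Finset.sum_congr rfl fun i _ => ?_
  rw [LaurentModel.of_aeval]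

/-- Functions on `y ≠ 0` have no pole at `t = 0`. -/
theorem UV.coeff_coord_resU (u : UBar n f) {j : ℕ} (hj : j < n) {m : ℤ} (hm : m < 0) :
    (UV.coord hn ht j (resU n f u)).coeff m = 0 := by
  obtain ⟨N, P, -, h⟩ := UV.coord_resU hn ht u
  -- As `f(0) ≠ 0`, the series `f` is invertible in `k[[t]]`, and the coordinate becomes the power
  -- series `f ^ (-N) P_j`.
  obtain ⟨g, hg⟩ := (isUnit_coe_of_isCoprime_X ht).exists_left_inv
  have h1 : UV.coord hn ht j (resU n f u) = HahnSeries.ofPowerSeries ℤ k (g ^ N * (P j : PowerSeries k)) := by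
    rw [map_mul, ← aeval_laurentT, ← h j hj, aeval_laurentT, ← mul_assoc, ← map_pow, ← map_mul,
      ← mul_pow, hg, one_pow, map_one, one_mul]
  rw [h1]
  exact (PowerSeries.coeff_coe (g ^ N * (P j : PowerSeries k)) m).trans (if_pos hm)

/-- If all coordinates vanish then so do the polynomials `P_j`, hence `f(t) ^ N u = 0`, where `f(t)
= y ^ n` is a unit. -/
theorem resU_injective (hn : 1 ≤ n) (ht : IsCoprime X f) : Function.Injective (resU n f) := by
  rw [injective_iff_map_eq_zero]
  intro u hu
  obtain ⟨N, P, h1, h⟩ := UV.coord_resU hn ht u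
  have hP : ∀ j < n, P j = 0 := fun j hj => by
    have := h j hj
    rw [hu, UV.coord, map_zero, map_zero, coeff_zero, mul_zero, aeval_laurentT, eq_comm,
      map_eq_zero_iff _ HahnSeries.ofPowerSeries_injective, Polynomial.coe_eq_zero_iff] at this
    exact this
  rw [Finset.sum_eq_zero (fun j hj => by rw [hP j (Finset.mem_range.1 hj)]; simp), ← UBar.rel,
    ← pow_mul] at h1
  exact ((UBar.isUnit_y (n := n) (f := f)).pow _).mul_right_eq_zero.1 h1

section V

variable {r : ℕ} (hf : f.natDegree ≤ r * n)

theorem UV.coord_resV {P : ℕ → k[X]} {x : VRing n r f}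
    (h : x = ∑ j ∈ Finset.range n, aeval (VRing.s n f r) (P j) * VRing.z n f r ^ j) {j : ℕ}
    (hj : j < n) : UV.coord hn ht j (resV n f r hf x) =
      aeval (laurentTInv k) (P j) * laurentTInv k ^ (r * j) := by
  refine UV.coord_sum hn ht P (fun j => r * j) ?_ hj
  rw [h, map_sum]
  refine Finset.sum_congr rfl fun i _ => ?_
  rw [map_mul, map_pow, resV_z, resV_aeval, mul_pow, ← pow_mul, mul_assoc]

/-- Functions on `V` have no terms `t ^ m y ^ j` with `m > - r j`. -/
theorem UV.coeff_coord_resV (x : VRing n r f) {j : ℕ} (hj : j < n) {m : ℤ} (hm : 0 < m + r * j) :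
    (UV.coord hn ht j (resV n f r hf x)).coeff m = 0 := by
  obtain ⟨P, h⟩ := Plane.exists_sum hn _ x
  rw [UV.coord_resV hn ht hf h hj, coeff_aeval_laurentTInv_mul, if_neg (by push_cast; omega)]

theorem aeval_laurentTInv_eq_zero {P : k[X]} {e : ℕ}
    (h : aeval (laurentTInv k) P * laurentTInv k ^ e = 0) : P = 0 := by
  ext q
  have := congrArg (fun x => HahnSeries.coeff x (-(q : ℤ) - e)) h
  simp only [coeff_aeval_laurentTInv_mul] at this
  rw [if_pos (by omega)] at this
  have e1 : (-(-(q : ℤ) - e + e)).toNat = q := by omega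
  rwa [e1] at this

theorem resV_injective (hn : 1 ≤ n) (ht : IsCoprime X f) :
    Function.Injective (resV n f r hf) := by
  rw [injective_iff_map_eq_zero]
  intro x hx
  obtain ⟨P, h⟩ := Plane.exists_sum hn _ x
  rw [h]
  refine Finset.sum_eq_zero fun j hj => ?_
  have h1 := UV.coord_resV hn ht hf h (Finset.mem_range.1 hj)
  rw [hx, UV.coord, map_zero, map_zero, coeff_zero] at h1
  rw [aeval_laurentTInv_eq_zero h1.symm, map_zero, zero_mul]

/-- Global functions are constant. -/
theorem exists_const_of_resU_eq_resV (hn : 1 ≤ n) (hr : 1 ≤ r) (ht : IsCoprime X f) {u : UBar n f}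
    {x : VRing n r f} (h : resU n f u = resV n f r hf x) :
    ∃ c : k, u = algebraMap k _ c ∧ x = algebraMap k _ c := by
  obtain ⟨P, hP⟩ := Plane.exists_sum hn _ x
  -- The coefficient of `t ^ (-q - r j) y ^ j` is that of `q` in `P_j` when computed on `V`, and is
  -- zero when computed on `y ≠ 0` because the exponent is negative. Since `r ≥ 1`, only the
  -- constant term survives.
  have key : ∀ j < n, ∀ q : ℕ, 0 < q + r * j → (P j).coeff q = 0 := fun j hj q hq => by
    have h1 := congrArg (fun y => HahnSeries.coeff y (-(q : ℤ) - (r * j : ℕ)))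
      (UV.coord_resV hn ht hf hP hj)
    simp only [coeff_aeval_laurentTInv_mul] at h1
    rw [if_pos (by omega), ← h, UV.coeff_coord_resU hn ht u hj (by omega)] at h1
    have e1 : (-(-(q : ℤ) - (r * j : ℕ) + (r * j : ℕ))).toNat = q := by omega
    rw [e1] at h1
    exact h1.symm
  have hx : x = algebraMap k _ ((P 0).coeff 0) := by
    rw [hP, Finset.sum_eq_single 0]
    · have : P 0 = C ((P 0).coeff 0) := by
        ext q
        rcases q with _ | q
        · simp
        · rw [key 0 (by omega) _ (by omega), coeff_C_succ]
      rw [this]; simp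
    · intro j hj hj0
      have : P j = 0 := by
        ext q
        rw [key j (Finset.mem_range.1 hj) q (by positivity), coeff_zero]
      rw [this]; simp
    · intro h; simp at h; omega
  refine ⟨_, resU_injective hn ht ?_, hx⟩
  rw [h, hx, ← RingHom.comp_apply, ← RingHom.comp_apply, resU_comp, resV_comp]

end V

end Model

section Cohomology

variable {k : Type*} [Field k] {n r : ℕ} {f : k[X]}

/-! ### Restrictions of the basic forms -/

theorem resU_aeval (P : k[X]) : resU n f (aeval (UBar.t n f) P) = aeval (UV.t n f) P := by
  rw [eval₂_comp_algebraMap, resU_comp, resU_t, RingHom.comp_id, aeval_def]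

theorem resΩU_smul_D (c : UBar n f) :
    resΩU n f (c • D k _ (UBar.t n f)) = resU n f c • D k _ (UV.t n f) := by
  rw [resΩU, kaehlerMap_smul_D, resU_t]

variable (hf : f.natDegree ≤ r * n)

theorem resΩV_smul (c : VRing n r f) (ω : Ω[VRing n r f⁄k]) :
    resΩV n r f hf (c • ω) = resV n f r hf c • resΩV n r f hf ω := kaehlerMap_smul ..

theorem resΩV_D (c : VRing n r f) : resΩV n r f hf (D k _ c) = D k _ (resV n f r hf c) :=
  kaehlerMap_D ..

theorem resU_smul (c : k) (u : UBar n f) : resU n f (c • u) = c • resU n f u :=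
  (resULin n f).map_smul c u

theorem resV_smul (c : k) (x : VRing n r f) : resV n f r hf (c • x) = c • resV n f r hf x :=
  (resVLin n r f hf).map_smul c x

theorem D_tInv : D k (UV n f) (UV.tInv n f) = -(UV.tInv n f ^ 2) • D k _ (UV.t n f) :=
  derivation_of_mul_eq_one _ UV.t_mul_tInv

variable (h : IsCoprime (infPoly n r f) (derivative (infPoly n r f)))

/-- On the overlap `1/z = t ^ r / y` and `ds = - t ^ (-2) dt`. The coefficient is a unit there. -/
theorem resΩV_formZ (hn : 1 ≤ n) : resΩV n r f hf (formZ h) =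
    (-(UV.tInv n f ^ 2 * (UV.t n f ^ r * UV.yInv n f) ^ (n - 1))) • D k _ (UV.t n f) := by
  have h1 := congrArg (resΩV n r f hf) (formZ_spec hn h)
  rw [resΩV_smul, resΩV_D, resV_s, map_pow, resV_z, D_tInv] at h1
  have h2 : (UV.t n f ^ r * UV.yInv n f) * (UV.tInv n f ^ r * UV.y n f) = 1 := by
    rw [mul_mul_mul_comm, mul_comm (UV.yInv n f), UV.y_mul_yInv, ← mul_pow, UV.t_mul_tInv, one_pow,
      one_mul]
  have h3 := congrArg (fun x => (UV.t n f ^ r * UV.yInv n f) ^ (n - 1) • x) h1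
  simp only [smul_smul] at h3
  rw [← mul_pow, h2, one_pow, one_smul] at h3
  rw [h3]
  congr 1
  ring

/-- Every form on `V` is a multiple of `ds / z ^ (n - 1)`. -/
theorem smul_D_z (hn : 1 ≤ n) (hnk : (n : k) ≠ 0) :
    D k _ (VRing.z n f r) = (algebraMap k _ (n : k)⁻¹ *
      aeval (VRing.s n f r) (derivative (infPoly n r f))) • formZ h := by
  have hb := congrArg (aeval (VRing.s n f r)) h.choose_spec.choose_spec
  rw [map_add, map_mul, map_mul, map_one] at hb
  have hrel := congrArg (D k (VRing n r f)) (VRing.rel (n := n) (f := f) r)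
  rw [Derivation.leibniz_pow, Derivation.map_aeval, ← Nat.cast_smul_eq_nsmul (VRing n r f)] at hrel
  have hz : VRing.z n f r * VRing.z n f r ^ (n - 1) = aeval (VRing.s n f r) (infPoly n r f) := by
    rw [← pow_succ', Nat.sub_add_cancel hn, VRing.rel]
  rw [smul_smul] at hrel
  have hnn : algebraMap k (VRing n r f) (n : k)⁻¹ * n = 1 := by
    rw [← map_natCast (algebraMap k (VRing n r f)), ← map_mul, inv_mul_cancel₀ hnk, map_one]
  set u := aeval (VRing.s n f r) h.choose with hu
  set w := aeval (VRing.s n f r) h.choose_spec.choose with hw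
  set g' := aeval (VRing.s n f r) (derivative (infPoly n r f))
  -- From `u f₂ + w f₂' = 1`, `f₂ = z ^ n` and `n z ^ (n - 1) dz = f₂' ds` one gets `dz = (u f₂ + w
  -- f₂') dz = (f₂' / n) (u z ds + n w dz)`, and the bracket is `formZ`. No division by `z` occurs.
  have e : (algebraMap k (VRing n r f) (n : k)⁻¹ * g') • formZ h =
      (algebraMap k (VRing n r f) (n : k)⁻¹ * u * VRing.z n f r) • g' • D k _ (VRing.s n f r) +
      ((algebraMap k (VRing n r f) (n : k)⁻¹ * n) * (w * g')) • D k _ (VRing.z n f r) := by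
    rw [formZ, smul_add, smul_smul, smul_smul, smul_smul]
    congr 2 <;> ring
  rw [e, ← hrel, smul_smul, ← add_smul]
  conv_lhs => rw [← one_smul (VRing n r f) (D k _ (VRing.z n f r))]
  congr 1
  linear_combination -hb - (u * aeval (VRing.s n f r) (infPoly n r f) + w * g') * hnn -
    algebraMap k (VRing n r f) (n : k)⁻¹ * n * u * hz

theorem VRing.exists_eq_smul_formZ (hn : 1 ≤ n) (hnk : (n : k) ≠ 0) (ω : Ω[VRing n r f⁄k]) :
    ∃ c : VRing n r f, ω = c • formZ h := by
  refine kaehler_eq_smul (Plane.induction (fun c => ⟨0, by simp⟩) ⟨_, (formZ_spec hn h).symm⟩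
    ⟨_, smul_D_z h hn hnk⟩ ?_ ?_) ω
  · rintro x y ⟨a, ha⟩ ⟨b, hb⟩
    exact ⟨a + b, by rw [map_add, ha, hb, add_smul]⟩
  · rintro x y ⟨a, ha⟩ ⟨b, hb⟩
    exact ⟨x * b + y * a, by rw [Derivation.leibniz, ha, hb, smul_smul, smul_smul, add_smul]⟩

theorem UV.isUnit_tInv : IsUnit (UV.tInv n f) :=
  IsUnit.of_mul_eq_one (UV.t n f) (by rw [mul_comm, UV.t_mul_tInv])

theorem UV.isUnit_yInv : IsUnit (UV.yInv n f) :=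
  IsUnit.of_mul_eq_one (UV.y n f) (by rw [mul_comm, UV.y_mul_yInv])

/-- Every form on `V` is `c • formZ h`, and `formZ h` restricts to a unit times `dt`, so the claim
reduces to injectivity on functions. -/
theorem resΩV_injective (h : IsCoprime (infPoly n r f) (derivative (infPoly n r f))) (hn : 1 ≤ n) (hnk : (n : k) ≠ 0) (ht : IsCoprime X f) :
    Function.Injective (resΩV n r f hf) := by
  rw [injective_iff_map_eq_zero]
  intro ω hω
  obtain ⟨c, rfl⟩ := VRing.exists_eq_smul_formZ h hn hnk ω
  rw [resΩV_smul, resΩV_formZ hf h hn, smul_smul, ← zero_smul (UV n f)] at hω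
  have h1 := UV.smul_D_injective hnk.isUnit hω
  have hu : IsUnit (-(UV.tInv n f ^ 2 * (UV.t n f ^ r * UV.yInv n f) ^ (n - 1))) :=
    ((UV.isUnit_tInv.pow 2).mul (((UV.isUnit_t.pow r).mul UV.isUnit_yInv).pow _)).neg
  rw [hu.mul_left_eq_zero, map_eq_zero_iff _ (resV_injective hf hn ht)] at h1
  rw [h1, zero_smul]

theorem resΩU_injective (hn : 1 ≤ n) (hnk : (n : k) ≠ 0) (ht : IsCoprime X f) :
    Function.Injective (resΩU n f) := by
  rw [injective_iff_map_eq_zero]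
  intro ω hω
  obtain ⟨c, rfl⟩ := UBar.exists_eq_smul_D hnk.isUnit ω
  rw [resΩU_smul_D, ← zero_smul (UV n f)] at hω
  have h1 := UV.smul_D_injective hnk.isUnit hω
  rw [map_eq_zero_iff _ (resU_injective hn ht)] at h1
  rw [h1, zero_smul]

/-! ### The cocycles lifting `h_{i,j}` -/

/-- The splitting of `G(t) / t ^ (i + 1)` into polar and polynomial part; for `G = dhPoly n f i j`
the two parts give `α^V` and `α^U`. -/
theorem aeval_t_mul_tInv_pow (G : k[X]) (i : ℕ) {N : ℕ} (hN : G.natDegree ≤ N) :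
    aeval (UV.t n f) G * UV.tInv n f ^ (i + 1) =
      ∑ m ∈ Finset.range (i + 1), G.coeff m • UV.tInv n f ^ (i + 1 - m) +
      ∑ m ∈ Finset.Icc (i + 1) N, G.coeff m • UV.t n f ^ (m - (i + 1)) := by
  have hI : Finset.Icc (i + 1) N = Finset.Ico (i + 1) (max (i + 1) (N + 1)) := by
    ext; simp; omega
  rw [aeval_eq_sum_range' (n := max (i + 1) (N + 1)) (by omega), hI, Finset.range_eq_Ico,
    Finset.range_eq_Ico, ← Finset.sum_Ico_consecutive _ (Nat.zero_le (i + 1)) (le_max_left _ _), add_mul,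
    Finset.sum_mul, Finset.sum_mul]
  congr 1
  · refine Finset.sum_congr rfl fun m hm => ?_
    rw [Finset.mem_Ico] at hm
    rw [smul_mul_assoc]
    congr 1
    obtain ⟨e, he⟩ : ∃ e, i + 1 = m + e := ⟨i + 1 - m, by omega⟩
    rw [he, Nat.add_sub_cancel_left, pow_add, ← mul_assoc, ← mul_pow, UV.t_mul_tInv, one_pow, one_mul]
  · refine Finset.sum_congr rfl fun m hm => ?_
    rw [Finset.mem_Ico] at hm
    rw [smul_mul_assoc]
    congr 1
    obtain ⟨e, rfl⟩ : ∃ e, m = (i + 1) + e := ⟨m - (i + 1), by omega⟩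
    rw [Nat.add_sub_cancel_left, pow_add, mul_right_comm, ← mul_pow, UV.t_mul_tInv, one_pow, one_mul]

/-- The polynomial `(j / n) t f' - i f`. -/
noncomputable def dhPoly (n : ℕ) (f : k[X]) (i j : ℕ) : k[X] :=
  C ((j : k) / n) * (X * derivative f) - C (i : k) * f

theorem coeff_dhPoly (hnk : (n : k) ≠ 0) (i j m : ℕ) :
    (dhPoly n f i j).coeff m = ((j : k) * m - i * n) / n * f.coeff m := by
  rw [dhPoly, coeff_sub, coeff_C_mul, coeff_C_mul]
  rcases m with _ | m
  · simp; field_simp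
  · rw [coeff_X_mul, coeff_derivative]; push_cast; field_simp

theorem natDegree_dhPoly (i j : ℕ) : (dhPoly n f i j).natDegree ≤ f.natDegree := by
  refine (natDegree_sub_le _ _).trans (max_le ((natDegree_C_mul_le _ _).trans ?_)
    (natDegree_C_mul_le _ _))
  rw [natDegree_le_iff_coeff_eq_zero]
  rintro (_ | m) hm
  · omega
  · rw [coeff_X_mul, coeff_derivative, coeff_eq_zero_of_natDegree_lt hm, zero_mul]

/-- Logarithmic differentiation: `dh / h = j dy / y - i dt / t` with `dy / y = f' dt / (n f)`, and
`f = y ^ n`. -/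
theorem D_hFun (hnk : (n : k) ≠ 0) (i : ℕ) {j : ℕ} (hj : 1 ≤ j) (hn : 1 ≤ n) :
    D k _ (hFun n f i j) = (aeval (UV.t n f) (dhPoly n f i j) * UV.tInv n f ^ (i + 1) *
      UV.y n f ^ (j - 1) * UV.yInv n f ^ (n - 1)) • D k _ (UV.t n f) := by
  have hy := smul_D_of_pow_eq UV.y_mul_yInv (UV.rel (n := n) (f := f)) (inv_mul_cancel₀ hnk)
  have ht : D k (UV n f) (UV.tInv n f ^ i) = (-(i * UV.tInv n f ^ (i + 1))) • D k _ (UV.t n f) := by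
    rw [Derivation.leibniz_pow, D_tInv, ← Nat.cast_smul_eq_nsmul (UV n f), smul_smul, smul_smul]
    congr 1
    rcases i with _ | i
    · simp
    · rw [Nat.add_sub_cancel]; ring
  obtain ⟨j, rfl⟩ : ∃ e, j = e + 1 := ⟨j - 1, by omega⟩
  obtain ⟨e, rfl⟩ : ∃ e, n = e + 1 := ⟨n - 1, by omega⟩
  rw [hFun, Derivation.leibniz, Derivation.leibniz_pow, hy, ht, ← Nat.cast_smul_eq_nsmul (UV (e + 1) f),
    smul_smul, smul_smul, smul_smul, smul_smul, ← add_smul]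
  congr 1
  have hr := UV.rel (n := e + 1) (f := f)
  have h1 := UV.t_mul_tInv (n := e + 1) (f := f)
  have h2 := congrArg (· ^ e) (UV.y_mul_yInv (n := e + 1) (f := f))
  simp only [one_pow, mul_pow] at h2
  simp only [Nat.add_sub_cancel, dhPoly, map_sub, map_mul, aeval_X, aeval_C, ← hr,
    map_natCast, div_eq_mul_inv]
  set t := UV.t (e + 1) f
  set t' := UV.tInv (e + 1) f
  set y := UV.y (e + 1) f
  set y' := UV.yInv (e + 1) f
  set f' := aeval t (derivative f)
  set m := algebraMap k (UV (e + 1) f) ((e + 1 : ℕ) : k)⁻¹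
  linear_combination (-((j + 1 : ℕ) : UV (e + 1) f) * m * f' * t' ^ i * y ^ j * y' ^ e) * h1 +
    (i * t' ^ (i + 1) * y ^ (j + 1)) * h2

theorem resΩU_alphaU (i j : ℕ) : resΩU n f (alphaU n f i j) =
    ((∑ m ∈ Finset.Icc (i + 1) f.natDegree,
      (((j : k) * m - i * n) / n * f.coeff m) • UV.t n f ^ (m - (i + 1))) *
    UV.y n f ^ (j - 1) * UV.yInv n f ^ (n - 1)) • D k _ (UV.t n f) := by
  rw [alphaU, resΩU_smul_D]
  simp only [map_mul, map_pow, resU_y, resU_yInv, map_sum, resU_smul, resU_t]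

/-- The sign in `ds = - t ^ (-2) dt` turns `i n - j m` into `j m - i n`, so the restriction is
exactly the polar part of `d h_{i,j}`. -/
theorem resΩV_alphaV (hn : 1 ≤ n) (hr : 1 ≤ r) (i : ℕ) {j : ℕ} (hj : 1 ≤ j) (hjn : j + 1 ≤ n) :
    resΩV n r f hf (alphaV h i j) =
    ((∑ m ∈ Finset.range (i + 1),
      (((j : k) * m - i * n) / n * f.coeff m) • UV.tInv n f ^ (i + 1 - m)) *
    UV.y n f ^ (j - 1) * UV.yInv n f ^ (n - 1)) • D k _ (UV.t n f) := by
  rw [alphaV, resΩV_smul, resΩV_formZ hf h hn, smul_smul]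
  congr 1
  rw [map_mul, map_sum, map_pow, resV_z, Finset.sum_mul, Finset.sum_mul, Finset.sum_mul,
    Finset.sum_mul]
  refine Finset.sum_congr rfl fun m hm => ?_
  rw [Finset.mem_range] at hm
  have e1 : ∀ c : k, resV n f r hf (c • VRing.s n f r ^ (i - m + ((n - j) * r - 1))) =
      c • UV.tInv n f ^ (i - m + ((n - j) * r - 1)) := fun c => by
    rw [resV_smul, map_pow, resV_s]
  rw [e1]
  have e2 : ((i : k) * n - j * m) / n * f.coeff m = -(((j : k) * m - i * n) / n * f.coeff m) := by
    ring
  rw [e2]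
  simp only [smul_mul_assoc, neg_smul, neg_mul, mul_neg, neg_neg]
  congr 1
  obtain ⟨j, rfl⟩ : ∃ e, j = e + 1 := ⟨j - 1, by omega⟩
  obtain ⟨e, rfl⟩ : ∃ e, n = e + 1 + (j + 1) := ⟨n - (j + 1) - 1, by omega⟩
  obtain ⟨r, rfl⟩ : ∃ e, r = e + 1 := ⟨r - 1, by omega⟩
  have e3 : (e + 1 + (j + 1) - (j + 1)) * (r + 1) - 1 = e * (r + 1) + r := by
    rw [Nat.add_sub_cancel, add_mul]; omega
  have e4 : e + 1 + (j + 1) - 1 = e + 1 + j := by omega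
  have e5 : i + 1 - m = i - m + 1 := by omega
  rw [e3, e4, e5, Nat.add_sub_cancel]
  have h1 := congrArg (· ^ ((r + 1) * (e + 1 + j))) (UV.t_mul_tInv (n := e + 1 + (j + 1)) (f := f))
  simp only [one_pow, mul_pow] at h1
  rw [mul_pow _ (UV.yInv _ _), ← pow_mul, mul_pow, ← pow_mul]
  set t := UV.t (e + 1 + (j + 1)) f
  set t' := UV.tInv (e + 1 + (j + 1)) f
  set y := UV.y (e + 1 + (j + 1)) f
  set y' := UV.yInv (e + 1 + (j + 1)) f
  have e6 : t' ^ (i - m + (e * (r + 1) + r)) * (t' ^ ((r + 1) * j) * y ^ j) *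
      (t' ^ 2 * (t ^ ((r + 1) * (e + 1 + j)) * y' ^ (e + 1 + j))) =
      (t ^ ((r + 1) * (e + 1 + j)) * t' ^ ((r + 1) * (e + 1 + j))) *
        (t' ^ (i - m + 1) * y ^ j * y' ^ (e + 1 + j)) := by ring
  rw [e6, h1, one_mul]

/-- The restrictions of `α^U` and `α^V` add up to `d h_{i,j}`. No upper bound on `i` is needed for
this. -/
theorem alpha_mem_ker (hnk : (n : k) ≠ 0) (hr : 1 ≤ r) (i : ℕ) {j : ℕ} (hj : 1 ≤ j)
    (hjn : j + 1 ≤ n) :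
    (alphaU n f i j, -alphaV h i j, hFun n f i j) ∈ LinearMap.ker (cechD1 n r f hf) := by
  have hn : 1 ≤ n := by omega
  change resΩV n r f hf (-alphaV h i j) - resΩU n f (alphaU n f i j) + D k _ (hFun n f i j) = 0
  rw [map_neg, resΩV_alphaV hf h hn hr i hj hjn, resΩU_alphaU, D_hFun hnk i hj hn,
    aeval_t_mul_tInv_pow _ _ (natDegree_dhPoly i j), ← neg_smul, ← sub_smul, ← add_smul]
  simp only [coeff_dhPoly hnk]
  convert zero_smul (UV n f) _ using 2
  ring

/-! ### A basis of `H¹(𝒪)` -/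

/-- Partial fractions: a Bézout relation `α t ^ m + β f ^ m = 1` splits a function with denominator
`(t f) ^ m` into one with denominator `f ^ m = y ^ (n m)`, regular on `y ≠ 0`, and one with
denominator `t ^ m`. -/
theorem UV.mem_sup_span (hn : 1 ≤ n) (ht : IsCoprime X f) (x : UV n f) :
    x ∈ LinearMap.range (resULin n f) ⊔
      Submodule.span k {y | ∃ i j : ℕ, 1 ≤ i ∧ j < n ∧ y = hFun n f i j} := by
  obtain ⟨m, P, h⟩ := UV.exists_sum hn x
  obtain ⟨α, β, hab⟩ := (ht.pow (m := m) (n := m))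
  have hab' := congrArg (aeval (UV.t n f)) hab
  simp only [map_add, map_mul, map_pow, map_one, aeval_X] at hab'
  have h1 : UV.t n f ^ m * UV.tInv n f ^ m = 1 := by rw [← mul_pow, UV.t_mul_tInv, one_pow]
  have h2 : aeval (UV.t n f) f ^ m * (UV.yInv n f ^ n) ^ m = 1 := by
    rw [← mul_pow, ← UV.rel, ← mul_pow, UV.y_mul_yInv, one_pow, one_pow]
  have hx : x = ∑ j ∈ Finset.range n, (aeval (UV.t n f) (α * P j) * (UV.yInv n f ^ n) ^ m *
      UV.y n f ^ j + aeval (UV.t n f) (β * P j) * UV.tInv n f ^ m * UV.y n f ^ j) := by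
    have : x = (aeval (UV.t n f) α * (UV.yInv n f ^ n) ^ m +
        aeval (UV.t n f) β * UV.tInv n f ^ m) *
        ((UV.t n f * aeval (UV.t n f) f) ^ m * x) := by
      rw [mul_pow]
      linear_combination (-x) * hab' - (aeval (UV.t n f) α * UV.t n f ^ m * x) * h2 -
        (aeval (UV.t n f) β * aeval (UV.t n f) f ^ m * x) * h1
    rw [this, h, Finset.mul_sum]
    refine Finset.sum_congr rfl fun j _ => ?_
    rw [map_mul, map_mul]; ring
  rw [hx]
  refine Submodule.sum_mem _ fun j hj => Submodule.add_mem _ ?_ ?_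
  · refine Submodule.mem_sup_left ⟨aeval (UBar.t n f) (α * P j) * (UBar.yInv n f ^ n) ^ m *
      UBar.y n f ^ j, ?_⟩
    change resU n f _ = _
    rw [map_mul, map_mul, resU_aeval, map_pow, map_pow, map_pow, resU_yInv, resU_y]
  · rw [aeval_eq_sum_range, Finset.sum_mul, Finset.sum_mul]
    refine Submodule.sum_mem _ fun q _ => ?_
    rw [smul_mul_assoc, smul_mul_assoc]
    refine Submodule.smul_mem _ _ ?_
    rcases le_or_gt m q with hq | hq
    · refine Submodule.mem_sup_left ⟨UBar.t n f ^ (q - m) * UBar.y n f ^ j, ?_⟩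
      change resU n f _ = _
      obtain ⟨e, rfl⟩ : ∃ e, q = m + e := ⟨q - m, by omega⟩
      rw [map_mul, map_pow, map_pow, resU_t, resU_y, Nat.add_sub_cancel_left]
      linear_combination (-(UV.t n f ^ e * UV.y n f ^ j)) * h1
    · refine Submodule.mem_sup_right (Submodule.subset_span ⟨m - q, j, by omega,
        Finset.mem_range.1 hj, ?_⟩)
      have h3 : UV.t n f ^ q * UV.tInv n f ^ q = 1 := by rw [← mul_pow, UV.t_mul_tInv, one_pow]
      obtain ⟨e, rfl⟩ : ∃ e, m = q + e := ⟨m - q, by omega⟩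
      rw [Nat.add_sub_cancel_left, hFun]
      linear_combination (UV.tInv n f ^ e * UV.y n f ^ j) * h3

/-- The indices `(i, j)` with `1 ≤ j ≤ n - 1`, `1 ≤ i ≤ r j - 1`. -/
abbrev HIndex (n r : ℕ) : Type :=
  {s : ℕ × ℕ // 1 ≤ s.2 ∧ s.2 + 1 ≤ n ∧ 1 ≤ s.1 ∧ s.1 + 1 ≤ r * s.2}

/-- The class of `h_{i,j}` in `H¹(𝒪)`. -/
noncomputable def hClass (s : HIndex n r) : H1O n r f hf :=
  Submodule.Quotient.mk (hFun n f s.1.1 s.1.2)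

theorem hFun_eq_resV {i j : ℕ} (hij : r * j ≤ i) :
    hFun n f i j = resV n f r hf (VRing.s n f r ^ (i - r * j) * VRing.z n f r ^ j) := by
  obtain ⟨e, rfl⟩ : ∃ e, i = r * j + e := ⟨i - r * j, by omega⟩
  rw [map_mul, map_pow, map_pow, resV_s, resV_z, Nat.add_sub_cancel_left, hFun, mul_pow, ← pow_mul,
    pow_add]
  ring

theorem span_hClass (hn : 1 ≤ n) (ht : IsCoprime X f) :
    ⊤ ≤ Submodule.span k (Set.range (hClass (n := n) (r := r) hf)) := by
  rintro x -
  obtain ⟨x, rfl⟩ := Submodule.Quotient.mk_surjective _ x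
  have h1 := UV.mem_sup_span hn ht x
  have h2 : LinearMap.range (resULin n f) ⊔
      Submodule.span k {y | ∃ i j : ℕ, 1 ≤ i ∧ j < n ∧ y = hFun n f i j} ≤
      (Submodule.span k (Set.range (hClass (n := n) (r := r) hf))).comap (Submodule.mkQ _) := by
    refine sup_le ?_ (Submodule.span_le.2 ?_)
    · intro y hy
      have : Submodule.mkQ (LinearMap.range (resULin n f) ⊔ LinearMap.range (resVLin n r f hf)) y
          = 0 := (Submodule.Quotient.mk_eq_zero _).2 (Submodule.mem_sup_left hy)
      rw [Submodule.mem_comap, this]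
      exact Submodule.zero_mem _
    · rintro _ ⟨i, j, hi, hj, rfl⟩
      rw [SetLike.mem_coe, Submodule.mem_comap]
      -- If `i ≥ r j`, which includes every `i` when `j = 0`, then `h_{i,j}` is regular on `V`.
      by_cases hij : r * j ≤ i
      · have : Submodule.mkQ (LinearMap.range (resULin n f) ⊔ LinearMap.range (resVLin n r f hf))
            (hFun n f i j) = 0 := (Submodule.Quotient.mk_eq_zero _).2
          (Submodule.mem_sup_right ⟨VRing.s n f r ^ (i - r * j) * VRing.z n f r ^ j,
            (hFun_eq_resV hf hij).symm⟩)
        rw [this]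
        exact Submodule.zero_mem _
      · have hj0 : 1 ≤ j := by
          rcases j with _ | j
          · simp at hij
          · omega
        exact Submodule.subset_span ⟨⟨(i, j), hj0, hj, hi, not_le.1 hij⟩, rfl⟩
  exact h2 h1

/-- The coefficient of `t ^ m y ^ j` of a function on `t y ≠ 0`, as a linear functional. -/
noncomputable def UV.coeffLin (hn : 1 ≤ n) (ht : IsCoprime X f) (m : ℤ) (j : ℕ) :
    UV n f →ₗ[k] k where
  toFun x := (UV.coord hn ht j x).coeff m
  map_add' x y := by rw [UV.coord_add, HahnSeries.coeff_add]
  map_smul' c x := by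
    have h0 : (UV.toLaurent hn ht).comp (algebraMap k _) = algebraMap k _ := UV.lift_comp ..
    have h1 : UV.toLaurent hn ht (algebraMap k _ c) =
        algebraMap (LaurentSeries k) _ (algebraMap k _ c) := by
      rw [← RingHom.comp_apply, h0]
      exact IsScalarTower.algebraMap_apply k (LaurentSeries k) (LaurentModel n f) c
    have h2 : UV.coord hn ht j (c • x) = HahnSeries.C c * UV.coord hn ht j x := by
      rw [UV.coord, Algebra.smul_def, map_mul, h1, ← Algebra.smul_def, map_smul, coeff_smul,
        laurent_algebraMap, smul_eq_mul]
      rfl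
    rw [h2, HahnSeries.C_mul_eq_smul, HahnSeries.coeff_smul]
    rfl

/-- The coefficient of `h_{i,j}` of a class in `H¹(𝒪)`. -/
noncomputable def hCoeff (hn : 1 ≤ n) (ht : IsCoprime X f) (s : HIndex n r) :
    H1O n r f hf →ₗ[k] k :=
  Submodule.liftQ _ (UV.coeffLin hn ht (-(s.1.1 : ℤ)) s.1.2) (by
    obtain ⟨⟨i, j⟩, hj, hjn, hi, hij⟩ := s
    -- The exponent `-i` satisfies `- r j < -i < 0`, so the coefficient vanishes both on functions
    -- from `y ≠ 0` and on functions from `V`.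
    refine sup_le ?_ ?_
    · rintro _ ⟨u, rfl⟩
      exact UV.coeff_coord_resU hn ht u hjn (by simp; omega)
    · rintro _ ⟨x, rfl⟩
      refine UV.coeff_coord_resV hn ht hf x hjn ?_
      have : ((i + 1 : ℕ) : ℤ) ≤ ((r * j : ℕ) : ℤ) := by exact_mod_cast hij
      push_cast at this
      dsimp only
      linarith)

theorem coeff_laurentTInv_pow (i : ℕ) (m : ℤ) :
    (laurentTInv k ^ i).coeff m = if m = -i then 1 else 0 := by
  have h1 : laurentTInv k ^ i = HahnSeries.single (-(i : ℤ)) 1 := by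
    rw [HahnSeries.single_pow]; simp
  rw [h1, HahnSeries.coeff_single]
  congr

theorem hCoeff_hClass (hn : 1 ≤ n) (ht : IsCoprime X f) (s s' : HIndex n r) :
    hCoeff hf hn ht s (hClass hf s') = if s = s' then 1 else 0 := by
  obtain ⟨⟨i, j⟩, hj, hjn, hi, hij⟩ := s
  obtain ⟨⟨i', j'⟩, hj', hjn', hi', hij'⟩ := s'
  change (UV.coord hn ht j (hFun n f i' j')).coeff (-(i : ℤ)) = _
  rw [UV.coord_hFun hn ht i' j' hjn hjn']
  simp only [Subtype.mk.injEq, Prod.mk.injEq]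
  by_cases h1 : j = j'
  · rw [if_pos h1, coeff_laurentTInv_pow]
    simp [h1]
  · simp [h1]

theorem linearIndependent_hClass (hn : 1 ≤ n) (ht : IsCoprime X f) :
    LinearIndependent k (hClass (n := n) (r := r) hf) := by
  rw [linearIndependent_iff']
  intro S g hg s hs
  have h1 := congrArg (hCoeff hf hn ht s) hg
  simpa [hCoeff_hClass, hs] using h1

/-! ### The Hodge filtration -/

theorem HasClass.add {x y : CechTriple n r f} {c d : H1dR n r f hf} (hx : HasClass hf x c)
    (hy : HasClass hf y d) : HasClass hf (x + y) (c + d) := by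
  obtain ⟨hx, rfl⟩ := hx
  obtain ⟨hy, rfl⟩ := hy
  exact ⟨Submodule.add_mem _ hx hy, rfl⟩

theorem HasClass.smul {x : CechTriple n r f} {c : H1dR n r f hf} (hx : HasClass hf x c) (a : k) :
    HasClass hf (a • x) (a • c) := by
  obtain ⟨hx, rfl⟩ := hx
  exact ⟨Submodule.smul_mem _ _ hx, rfl⟩

theorem HasClass.zero : HasClass hf 0 (0 : H1dR n r f hf) := ⟨Submodule.zero_mem _, rfl⟩

theorem HasClass.sum {ι : Type*} (S : Finset ι) {x : ι → CechTriple n r f}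
    {c : ι → H1dR n r f hf} (hx : ∀ i ∈ S, HasClass hf (x i) (c i)) :
    HasClass hf (∑ i ∈ S, x i) (∑ i ∈ S, c i) := by
  classical
  induction S using Finset.induction_on with
  | empty => simpa using HasClass.zero hf
  | insert a S ha ih =>
    rw [Finset.sum_insert ha, Finset.sum_insert ha]
    exact (hx a (Finset.mem_insert_self _ _)).add hf
      (ih fun i hi => hx i (Finset.mem_insert_of_mem hi))

theorem HasClass.eq_iff {x y : CechTriple n r f} {c d : H1dR n r f hf} (hx : HasClass hf x c)
    (hy : HasClass hf y d) : c = d ↔ x - y ∈ LinearMap.range (cechD0 n r f hf) := by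
  obtain ⟨hx, rfl⟩ := hx
  obtain ⟨hy, rfl⟩ := hy
  rw [Submodule.Quotient.eq]
  rfl

theorem HasClass.unique {x : CechTriple n r f} {c d : H1dR n r f hf} (hx : HasClass hf x c)
    (hy : HasClass hf x d) : c = d := by
  rw [hx.eq_iff hf hy, sub_self]
  exact Submodule.zero_mem _

theorem hasClass_toH1dR (ω : H0Ω n r f hf) :
    HasClass hf (ω.1.1, ω.1.2, 0) (H0Ω.toH1dR n r f hf ω) := by
  refine ⟨?_, rfl⟩
  have hx : resΩU n f ω.1.1 = resΩV n r f hf ω.1.2 := ω.2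
  simp [cechD1, hx]

theorem exists_hasClass (c : H1dR n r f hf) : ∃ x, HasClass hf x c := by
  obtain ⟨x, rfl⟩ := Submodule.Quotient.mk_surjective _ c
  exact ⟨x.1, x.2, rfl⟩

theorem exists_linearMap_of_span {ι M N : Type*} [AddCommGroup M] [Module k M] [AddCommGroup N]
    [Module k N] {v : ι → M} (hv : LinearIndependent k v) (hs : ⊤ ≤ Submodule.span k (Set.range v))
    (c : ι → N) : ∃ τ : M →ₗ[k] N, (∀ s, τ (v s) = c s) ∧
      ∀ τ' : M →ₗ[k] N, (∀ s, τ' (v s) = c s) → τ' = τ := by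
  let B := Module.Basis.mk hv hs
  have hB : ∀ s, B s = v s := Module.Basis.mk_apply hv hs
  have h1 : ∀ s, B.constr k c (v s) = c s := fun s => by rw [← hB, B.constr_basis]
  exact ⟨B.constr k c, h1, fun τ' h => B.ext fun s => by rw [hB, h, h1]⟩

theorem exists_equiv_of_section {M₀ M₁ M : Type*} [AddCommGroup M₀] [Module k M₀]
    [AddCommGroup M₁] [Module k M₁] [AddCommGroup M] [Module k M] (i : M₀ →ₗ[k] M)
    (π : M →ₗ[k] M₁) (τ : M₁ →ₗ[k] M) (hi : Function.Injective i) (hπi : ∀ ω, π (i ω) = 0)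
    (hex : ∀ c, π c = 0 → ∃ ω, i ω = c) (hτ : ∀ x, π (τ x) = x) :
    ∃ e : (M₀ × M₁) ≃ₗ[k] M, ∀ ω x, e (ω, x) = i ω + τ x := by
  refine ⟨LinearEquiv.ofBijective (i.coprod τ) ⟨?_, ?_⟩, fun ω x => LinearMap.coprod_apply _ _ _⟩
  · rw [injective_iff_map_eq_zero]
    rintro ⟨ω, x⟩ hx
    rw [LinearMap.coprod_apply] at hx
    have h1 := congrArg π hx
    rw [map_add, hπi, hτ, zero_add, map_zero] at h1
    subst h1
    rw [map_zero, add_zero, map_eq_zero_iff _ hi] at hx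
    exact Prod.ext hx rfl
  · intro c
    obtain ⟨ω, hω⟩ := hex (c - τ (π c)) (by rw [map_sub, hτ, sub_self])
    exact ⟨(ω, π c), by rw [LinearMap.coprod_apply, hω, sub_add_cancel]⟩

theorem exists_alphaClass (hnk : (n : k) ≠ 0) (hr : 1 ≤ r) (s : HIndex n r) :
    ∃ c, HasClass hf (alphaU n f s.1.1 s.1.2, -alphaV h s.1.1 s.1.2, hFun n f s.1.1 s.1.2) c :=
  ⟨_, alpha_mem_ker hf h hnk hr s.1.1 s.2.1 s.2.2.1, rfl⟩

theorem isHodgeSplitting_existsUnique (hnk : (n : k) ≠ 0) (hn : 1 ≤ n) (hr : 1 ≤ r)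
    (ht : IsCoprime X f) : ∃! τ, IsHodgeSplitting hf h τ := by
  choose c hc using exists_alphaClass hf h hnk hr
  obtain ⟨τ, h1, h2⟩ := exists_linearMap_of_span (linearIndependent_hClass (r := r) hf hn ht)
    (span_hClass hf hn ht) c
  refine ⟨τ, fun i j hj hjn hi hij => ?_, fun τ' hτ => h2 τ' fun s => ?_⟩
  · have h3 := hc ⟨(i, j), hj, hjn, hi, hij⟩
    rw [← h1] at h3
    exact h3
  · exact (hτ _ _ s.2.1 s.2.2.1 s.2.2.2.1 s.2.2.2.2).unique hf (hc s)

/-- The projection `H¹_dR → H¹(𝒪)`. -/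
noncomputable def H1dR.toH1O : H1dR n r f hf →ₗ[k] H1O n r f hf :=
  Submodule.liftQ _ (Submodule.mkQ _ ∘ₗ LinearMap.snd k _ _ ∘ₗ LinearMap.snd k _ _ ∘ₗ
    Submodule.subtype _) (by
    rintro ⟨x, hx⟩ ⟨⟨a, b⟩, hab⟩
    have h3 : x.2.2 = resU n f a - resV n f r hf b := by
      have : x = _ := hab.symm
      rw [this]; rfl
    refine (Submodule.Quotient.mk_eq_zero _).2 ?_
    change x.2.2 ∈ _
    rw [h3]
    exact Submodule.sub_mem _ (Submodule.mem_sup_left ⟨a, rfl⟩) (Submodule.mem_sup_right ⟨b, rfl⟩))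

theorem HasClass.toH1O {x : CechTriple n r f} {c : H1dR n r f hf} (hx : HasClass hf x c) :
    H1dR.toH1O hf c = Submodule.Quotient.mk x.2.2 := by
  obtain ⟨hx, rfl⟩ := hx
  rfl

theorem IsHodgeSplitting.toH1O {τ : H1O n r f hf →ₗ[k] H1dR n r f hf} {h} (hn : 1 ≤ n)
    (ht : IsCoprime X f) (hτ : IsHodgeSplitting hf h τ) (x : H1O n r f hf) :
    H1dR.toH1O hf (τ x) = x := by
  have h1 : H1dR.toH1O hf ∘ₗ τ = LinearMap.id := by
    refine LinearMap.ext_on (top_le_iff.1 (span_hClass hf hn ht)) ?_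
    rintro _ ⟨s, rfl⟩
    exact (hτ _ _ s.2.1 s.2.2.1 s.2.2.2.1 s.2.2.2.2).toH1O hf
  exact LinearMap.congr_fun h1 x

/-- If `(ω, ω, 0)` is the coboundary of `(a, b)`, then `a` and `b` glue to a global function, which
is constant and has differential zero. -/
theorem toH1dR_injective (hn : 1 ≤ n) (hr : 1 ≤ r) (ht : IsCoprime X f) :
    Function.Injective (H0Ω.toH1dR n r f hf) := by
  rw [injective_iff_map_eq_zero]
  intro ω hω
  have h1 := hasClass_toH1dR hf ω
  rw [hω] at h1
  obtain ⟨⟨a, b⟩, hab⟩ := (h1.eq_iff hf (HasClass.zero hf)).1 rfl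
  rw [sub_zero] at hab
  have e1 : D k _ a = ω.1.1 := congrArg Prod.fst hab
  have e2 : D k _ b = ω.1.2 := congrArg (fun x => x.2.1) hab
  have e3 : resU n f a - resV n f r hf b = 0 := congrArg (fun x => x.2.2) hab
  obtain ⟨c, rfl, rfl⟩ := exists_const_of_resU_eq_resV hf hn hr ht (sub_eq_zero.1 e3)
  rw [Derivation.map_algebraMap] at e1 e2
  exact Subtype.ext (Prod.ext e1.symm e2.symm)

/-- If the function component is `a + b` with `a` from `y ≠ 0` and `b` from `V`, subtracting the
coboundary of `(a, -b)` leaves `(ω_U - da, ω_V + db, 0)`. The cocycle condition says that these two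
forms agree. -/
theorem exists_toH1dR_eq {c : H1dR n r f hf} (hc : H1dR.toH1O hf c = 0) :
    ∃ ω, H0Ω.toH1dR n r f hf ω = c := by
  obtain ⟨x, hx⟩ := exists_hasClass hf c
  rw [hx.toH1O hf] at hc
  obtain ⟨_, ⟨a, rfl⟩, _, ⟨b, rfl⟩, hab⟩ :=
    Submodule.mem_sup.1 ((Submodule.Quotient.mk_eq_zero _).1 hc)
  have hab' : resU n f a + resV n f r hf b = x.2.2 := hab
  have h0 : resΩV n r f hf x.2.1 - resΩU n f x.1 + D k _ x.2.2 = 0 := hx.1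
  have hω : (x.1 - D k _ a, x.2.1 + D k _ b) ∈ H0Ω n r f hf := by
    change resΩU n f (x.1 - D k _ a) = resΩV n r f hf (x.2.1 + D k _ b)
    rw [map_sub, map_add, resΩV_D, resΩU, kaehlerMap_D]
    rw [← hab', map_add, resΩU] at h0
    rw [← sub_eq_zero, ← neg_eq_zero, ← h0]
    abel
  refine ⟨⟨_, hω⟩, ((hasClass_toH1dR hf ⟨_, hω⟩).eq_iff hf hx).2 ⟨(-a, b), ?_⟩⟩
  refine Prod.ext ?_ (Prod.ext ?_ ?_)
  · change D k _ (-a) = x.1 - D k _ a - x.1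
    rw [map_neg]; abel
  · change D k _ b = x.2.1 + D k _ b - x.2.1
    abel
  · change resU n f (-a) - resV n f r hf b = 0 - x.2.2
    rw [← hab', map_neg]; abel

/-- The Hodge decomposition attached to a splitting. -/
theorem IsHodgeSplitting.exists_equiv {τ : H1O n r f hf →ₗ[k] H1dR n r f hf} {h} (hn : 1 ≤ n)
    (hr : 1 ≤ r) (ht : IsCoprime X f) (hτ : IsHodgeSplitting hf h τ) :
    ∃ e : (H0Ω n r f hf × H1O n r f hf) ≃ₗ[k] H1dR n r f hf,
      ∀ ω x, e (ω, x) = H0Ω.toH1dR n r f hf ω + τ x :=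
  exists_equiv_of_section _ (H1dR.toH1O hf) τ (toH1dR_injective hf hn hr ht)
    (fun ω => (hasClass_toH1dR hf ω).toH1O hf) (fun _ hc => exists_toH1dR_eq hf hc)
    (hτ.toH1O hf hn ht)

end Cohomology

/-! ### The relative Frobenius -/

section RelFrob

variable {p : ℕ} [Fact p.Prime] {k : Type*} [Field k] [CharP k p] {n : ℕ} {g g' : k[X]}

theorem aeval_pow_char {A : Type*} [CommRing A] [Algebra k A] (hg : g' = g.map (frobenius k p))
    (t : A) : aeval t g ^ p = g'.eval₂ (algebraMap k A) (t ^ p) := by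
  rw [← aeval_def, ← expand_aeval, hg, ← map_expand, map_frobenius_expand, map_pow]

theorem relFrob_rel {A : Type*} [CommRing A] [Algebra k A] (hg : g' = g.map (frobenius k p))
    {t y : A} (h : y ^ n = aeval t g) : (y ^ p) ^ n = g'.eval₂ (algebraMap k A) (t ^ p) := by
  rw [← aeval_pow_char hg, ← h, ← pow_mul, ← pow_mul, mul_comm]

/-- The relative Frobenius `t ↦ t ^ p`, `y ↦ y ^ p` on functions on `y ≠ 0`. -/
noncomputable def relFrobU (hg : g' = g.map (frobenius k p)) : UBar n g' →+* UBar n g :=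
  UBar.lift (algebraMap k _) (UBar.t n g ^ p) (UBar.y n g ^ p) (relFrob_rel hg UBar.rel)
    (UBar.isUnit_y.pow p)

/-- The relative Frobenius `t ↦ t ^ p`, `y ↦ y ^ p` on functions on `t y ≠ 0`. -/
noncomputable def relFrobUV (hg : g' = g.map (frobenius k p)) : UV n g' →+* UV n g :=
  UV.lift (algebraMap k _) (UV.t n g ^ p) (UV.y n g ^ p) (relFrob_rel hg UV.rel)
    (UV.isUnit_t.pow p) (UV.isUnit_y.pow p)

/-- The relative Frobenius `s ↦ s ^ p`, `z ↦ z ^ p` on functions on `V`. -/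
noncomputable def relFrobV (r : ℕ) (hg : g' = g.map (frobenius k p)) :
    VRing n r g' →+* VRing n r g :=
  Plane.lift (algebraMap k _) (VRing.s n g r ^ p) (VRing.z n g r ^ p)
    (relFrob_rel (infPoly_map r _ hg) (VRing.rel r))

variable (hg : g' = g.map (frobenius k p))

theorem relFrobU_t : relFrobU hg (UBar.t n g') = UBar.t n g ^ p := UBar.lift_t ..

theorem relFrobU_y : relFrobU hg (UBar.y n g') = UBar.y n g ^ p := UBar.lift_y ..

theorem relFrobU_comp : (relFrobU (n := n) hg).comp (algebraMap k _) = algebraMap k _ :=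
  UBar.lift_comp ..

theorem relFrobUV_t : relFrobUV hg (UV.t n g') = UV.t n g ^ p := UV.lift_t ..

theorem relFrobUV_y : relFrobUV hg (UV.y n g') = UV.y n g ^ p := UV.lift_y ..

theorem relFrobUV_comp : (relFrobUV (n := n) hg).comp (algebraMap k _) = algebraMap k _ :=
  UV.lift_comp ..

theorem relFrobV_s (r : ℕ) : relFrobV r hg (VRing.s n g' r) = VRing.s n g r ^ p :=
  Plane.lift_fst ..

theorem relFrobV_z (r : ℕ) : relFrobV r hg (VRing.z n g' r) = VRing.z n g r ^ p :=
  Plane.lift_snd ..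

theorem relFrobV_comp (r : ℕ) : (relFrobV (n := n) r hg).comp (algebraMap k _) = algebraMap k _ :=
  Plane.lift_comp ..

theorem relFrobUV_tInv : relFrobUV hg (UV.tInv n g') = UV.tInv n g ^ p := by
  have h1 := congrArg (relFrobUV hg) (UV.t_mul_tInv (n := n) (f := g'))
  rw [map_mul, map_one, relFrobUV_t] at h1
  refine (UV.isUnit_t.pow p).mul_left_cancel (h1.trans ?_)
  rw [← mul_pow, UV.t_mul_tInv, one_pow]

theorem relFrobUV_yInv : relFrobUV hg (UV.yInv n g') = UV.yInv n g ^ p := by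
  have h1 := congrArg (relFrobUV hg) (UV.y_mul_yInv (n := n) (f := g'))
  rw [map_mul, map_one, relFrobUV_y] at h1
  refine (UV.isUnit_y.pow p).mul_left_cancel (h1.trans ?_)
  rw [← mul_pow, UV.y_mul_yInv, one_pow]

theorem relFrobUV_resU (x : UBar n g') :
    relFrobUV hg (resU n g' x) = resU n g (relFrobU hg x) := by
  refine RingHom.congr_fun (f := (relFrobUV hg).comp (resU n g'))
    (g := (resU n g).comp (relFrobU hg)) (UBar.hom_ext ?_ ?_ ?_) x
  · rw [RingHom.comp_assoc, resU_comp, RingHom.comp_id, relFrobUV_comp, RingHom.comp_assoc,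
      relFrobU_comp, resU_comp, RingHom.comp_id]
  · rw [RingHom.comp_apply, RingHom.comp_apply, resU_t, relFrobUV_t, relFrobU_t, map_pow, resU_t]
  · rw [RingHom.comp_apply, RingHom.comp_apply, resU_y, relFrobUV_y, relFrobU_y, map_pow, resU_y]

theorem relFrobUV_resV {r : ℕ} (hd : g.natDegree ≤ r * n) (hd' : g'.natDegree ≤ r * n)
    (x : VRing n r g') :
    relFrobUV hg (resV n g' r hd' x) = resV n g r hd (relFrobV r hg x) := by
  refine RingHom.congr_fun (f := (relFrobUV hg).comp (resV n g' r hd'))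
    (g := (resV n g r hd).comp (relFrobV r hg)) (Plane.hom_ext ?_ ?_ ?_) x
  · rw [RingHom.comp_assoc, resV_comp, RingHom.comp_id, relFrobUV_comp, RingHom.comp_assoc,
      relFrobV_comp, resV_comp, RingHom.comp_id]
  · change relFrobUV hg (resV n g' r hd' (VRing.s n g' r)) =
      resV n g r hd (relFrobV r hg (VRing.s n g' r))
    rw [resV_s, relFrobUV_tInv, relFrobV_s, map_pow, resV_s]
  · change relFrobUV hg (resV n g' r hd' (VRing.z n g' r)) =
      resV n g r hd (relFrobV r hg (VRing.z n g' r))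
    rw [resV_z, map_mul, map_pow, relFrobUV_tInv, relFrobUV_y, relFrobV_z, map_pow, resV_z]
    ring

theorem D_pow_char {A : Type*} [CommRing A] [Algebra k A] (x : A) : D k A (x ^ p) = 0 := by
  rw [Derivation.leibniz_pow, ← Nat.cast_smul_eq_nsmul k, CharP.cast_eq_zero, zero_smul]

/-- The image is generated over `k` by `p`-th powers of the coordinates and their inverses. -/
theorem D_relFrobUV (x : UV n g') : D k _ (relFrobUV hg x) = 0 := by
  refine UV.induction (P := fun x => D k _ (relFrobUV hg x) = 0) (fun c => ?_) ?_ ?_ ?_ ?_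
    (fun x y hx hy => by rw [map_add, map_add, hx, hy, add_zero])
    (fun x y hx hy => by rw [map_mul, Derivation.leibniz, hx, hy, smul_zero, smul_zero, add_zero]) x
  · rw [← RingHom.comp_apply, relFrobUV_comp, Derivation.map_algebraMap]
  · rw [relFrobUV_t, D_pow_char]
  · rw [relFrobUV_tInv, D_pow_char]
  · rw [relFrobUV_y, D_pow_char]
  · rw [relFrobUV_yInv, D_pow_char]

end RelFrob

/-! ### Reduction modulo `p` -/

section Reduction

variable {p : ℕ} [Fact p.Prime] {k : Type*} [Field k] [CharP k p] {n : ℕ}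

theorem W1.red_surjective : Function.Surjective (W1.red p k) := fun x =>
  ⟨Ideal.Quotient.mk _ (WittVector.teichmuller p x), WittVector.teichmuller_coeff_zero p x⟩

/-- Lifted to `W(k)`, the hypothesis is `p x = a p²`; cancelling `p` in this domain gives `x = a p`.
-/
theorem W1.red_eq_zero [PerfectRing k p] {x : W1 p k} (hx : (p : W1 p k) * x = 0) :
    W1.red p k x = 0 := by
  obtain ⟨x, rfl⟩ := Ideal.Quotient.mk_surjective x
  rw [← map_natCast (Ideal.Quotient.mk _), ← map_mul, Ideal.Quotient.eq_zero_iff_mem,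
    Ideal.mem_span_singleton'] at hx
  obtain ⟨a, ha⟩ := hx
  have h1 : a * (p : WittVector p k) = x := mul_left_cancel₀ (WittVector.p_nonzero p k) (by rw [← ha]; ring)
  rw [← h1]
  change WittVector.constantCoeff (a * (p : WittVector p k)) = 0
  rw [map_mul, map_natCast, CharP.cast_eq_zero, mul_zero]

theorem map_red_eq_zero [PerfectRing k p] {P : (W1 p k)[X]} (hP : C (p : W1 p k) * P = 0) :
    P.map (W1.red p k) = 0 := by
  ext i
  rw [coeff_map, coeff_zero]
  refine W1.red_eq_zero ?_
  rw [← coeff_C_mul, hP, coeff_zero]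

variable {R S : Type*} [CommRing R] [CommRing S] {f : R[X]} {g : S[X]}

theorem UV.map_aeval (φ : R →+* S) (h : g = f.map φ) (P : R[X]) :
    UV.map φ h (aeval (UV.t n f) P) = aeval (UV.t n g) (P.map φ) := by
  rw [eval₂_comp_algebraMap, UV.map_comp, UV.map_t, eval₂_of_map φ rfl]

theorem UV.map_aeval_tInv (φ : R →+* S) (h : g = f.map φ) (P : R[X]) :
    UV.map φ h (aeval (UV.tInv n f) P) = aeval (UV.tInv n g) (P.map φ) := by
  rw [eval₂_comp_algebraMap, UV.map_comp, UV.map_tInv, eval₂_of_map φ rfl]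

theorem VRing.map_s (r : ℕ) (φ : R →+* S) (h : g = f.map φ) :
    VRing.map (n := n) r φ h (VRing.s n f r) = VRing.s n g r := by
  rw [VRing.map, Plane.map, VRing.s, Plane.lift_fst]; rfl

theorem VRing.map_z (r : ℕ) (φ : R →+* S) (h : g = f.map φ) :
    VRing.map (n := n) r φ h (VRing.z n f r) = VRing.z n g r := by
  rw [VRing.map, Plane.map, VRing.z, Plane.lift_snd]; rfl

theorem VRing.map_aeval (r : ℕ) (φ : R →+* S) (h : g = f.map φ) (P : R[X]) :
    VRing.map (n := n) r φ h (aeval (VRing.s n f r) P) = aeval (VRing.s n g r) (P.map φ) := by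
  rw [eval₂_comp_algebraMap, VRing.map_comp, VRing.map_s, eval₂_of_map φ rfl]

theorem UBar.map_yInv (φ : R →+* S) (h : g = f.map φ) :
    UBar.map φ h (UBar.yInv n f) = UBar.yInv n g := by
  have h1 := congrArg (UBar.map φ h) (UBar.y_mul_yInv (n := n) (f := f))
  rw [map_mul, map_one, UBar.map_y, ← UBar.y_mul_yInv] at h1
  exact UBar.isUnit_y.mul_left_cancel h1

theorem UV.map_yInv (φ : R →+* S) (h : g = f.map φ) :
    UV.map φ h (UV.yInv n f) = UV.yInv n g := by
  have h1 := congrArg (UV.map φ h) (UV.y_mul_yInv (n := n) (f := f))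
  rw [map_mul, map_one, UV.map_y, ← UV.y_mul_yInv] at h1
  exact UV.isUnit_y.mul_left_cancel h1

theorem map_surjective_aux {A B : Type*} [CommRing A] [CommRing B] (ρ : A →+* B) :
    (∀ x y, (∃ a, ρ a = x) → (∃ a, ρ a = y) → ∃ a, ρ a = x + y) ∧
    ∀ x y, (∃ a, ρ a = x) → (∃ a, ρ a = y) → ∃ a, ρ a = x * y :=
  ⟨fun _ _ ⟨a, ha⟩ ⟨b, hb⟩ => ⟨a + b, by rw [map_add, ha, hb]⟩,
    fun _ _ ⟨a, ha⟩ ⟨b, hb⟩ => ⟨a * b, by rw [map_mul, ha, hb]⟩⟩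

theorem exists_algebraMap_of_comp {A B : Type*} [CommRing A] [CommRing B] [Algebra R A]
    [Algebra S B] {ρ : A →+* B} {φ : R →+* S} (hφ : Function.Surjective φ)
    (h : ρ.comp (algebraMap R A) = (algebraMap S B).comp φ) (c : S) :
    ∃ a, ρ a = algebraMap S B c := by
  obtain ⟨c, rfl⟩ := hφ c
  exact ⟨_, RingHom.congr_fun h c⟩

theorem UBar.map_surjective {φ : R →+* S} (hφ : Function.Surjective φ) (h : g = f.map φ) :
    Function.Surjective (UBar.map (n := n) φ h) :=
  UBar.induction (exists_algebraMap_of_comp hφ (UBar.map_comp φ h)) ⟨_, UBar.map_t φ h⟩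
    ⟨_, UBar.map_y φ h⟩ ⟨_, UBar.map_yInv φ h⟩ (map_surjective_aux _).1 (map_surjective_aux _).2

theorem UV.map_surjective {φ : R →+* S} (hφ : Function.Surjective φ) (h : g = f.map φ) :
    Function.Surjective (UV.map (n := n) φ h) :=
  UV.induction (exists_algebraMap_of_comp hφ (UV.map_comp φ h)) ⟨_, UV.map_t φ h⟩
    ⟨_, UV.map_tInv φ h⟩ ⟨_, UV.map_y φ h⟩ ⟨_, UV.map_yInv φ h⟩ (map_surjective_aux _).1
    (map_surjective_aux _).2

theorem VRing.map_surjective (r : ℕ) {φ : R →+* S} (hφ : Function.Surjective φ)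
    (h : g = f.map φ) : Function.Surjective (VRing.map (n := n) r φ h) :=
  Plane.induction (exists_algebraMap_of_comp hφ (VRing.map_comp r φ h)) ⟨_, VRing.map_s r φ h⟩
    ⟨_, VRing.map_z r φ h⟩ (map_surjective_aux _).1 (map_surjective_aux _).2

theorem kaehlerMap_surjective {A B : Type*} [CommRing A] [CommRing B] [Algebra R A]
    [Algebra S B] {ρ : A →+* B} {φ : R →+* S} (hρ : Function.Surjective ρ)
    (h : ρ.comp (algebraMap R A) = (algebraMap S B).comp φ) :
    Function.Surjective (kaehlerMap φ ρ h) := by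
  refine fun x => kaehler_induction (P := fun x => ∃ a, kaehlerMap φ ρ h a = x) ⟨0, map_zero _⟩
    (fun x y ⟨a, ha⟩ ⟨b, hb⟩ => ⟨a + b, by rw [map_add, ha, hb]⟩) (fun a b => ?_) x
  obtain ⟨a, rfl⟩ := hρ a
  obtain ⟨b, rfl⟩ := hρ b
  exact ⟨_, kaehlerMap_smul_D φ ρ h a b⟩

/-! ### Flatness over `W₁` -/

variable [PerfectRing k p] {f : (W1 p k)[X]}

/-- A substitute for flatness over `W₁`. After clearing denominators, `e` has polynomial coordinates
`P_j` with `p (t f) ^ N P_j = 0`. Then `(t f) ^ N P_j` vanishes modulo `p`, and since `k[t]` is a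
domain so does `P_j`. -/
theorem UV.map_red_eq_zero (hn : 1 ≤ n) (hf0 : f.map (W1.red p k) ≠ 0) {e : UV n f}
    (he : (p : UV n f) * e = 0) : UV.map (W1.red p k) rfl e = 0 := by
  obtain ⟨m, P, h⟩ := UV.exists_sum hn e
  have hP : ∀ j < n, (P j).map (W1.red p k) = 0 := by
    have h1 : algebraMap (Plane n f) (UV n f) (∑ j ∈ Finset.range n,
        aeval (Plane.fst n f) (C (p : W1 p k) * P j) * Plane.snd n f ^ j) =
        algebraMap (Plane n f) (UV n f) 0 := by
      rw [map_zero, map_sum]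
      simp only [map_mul, map_pow, ← aeval_algebraMap_apply]
      have h2 := congrArg (fun x => (p : UV n f) * x) h
      simp only [mul_left_comm (p : UV n f), he, mul_zero, Finset.mul_sum] at h2
      rw [h2]
      refine Finset.sum_congr rfl fun j _ => ?_
      rw [aeval_C, map_natCast, mul_left_comm, mul_assoc]
      rfl
    obtain ⟨N, hN⟩ := IsLocalization.Away.exists_of_eq (Plane.fst n f * Plane.snd n f) h1
    have h3 : ∑ j ∈ Finset.range n, aeval (Plane.fst n f)
        (C (p : W1 p k) * (X ^ N * f ^ N * P j)) * Plane.snd n f ^ j = 0 := by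
      -- Vanishing in the localization means vanishing after multiplication by `(t y) ^ N`; the
      -- extra `y ^ ((n - 1) N)` turns this factor into `t ^ N f ^ N`.
      have h4 := congrArg (fun x => Plane.snd n f ^ ((n - 1) * N) * x) hN
      simp only [mul_zero] at h4
      rw [← h4, Finset.mul_sum, Finset.mul_sum]
      refine Finset.sum_congr rfl fun j _ => ?_
      simp only [map_mul, map_pow, aeval_X, ← Plane.rel]
      obtain ⟨n, rfl⟩ : ∃ e, n = e + 1 := ⟨n - 1, by omega⟩
      rw [Nat.add_sub_cancel]
      ring
    intro j hj
    have h5 := Superelliptic.map_red_eq_zero (Plane.eq_zero_of_sum_eq_zero f h3 hj)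
    rw [Polynomial.map_mul, Polynomial.map_mul, Polynomial.map_pow, Polynomial.map_pow, map_X,
      mul_eq_zero] at h5
    exact h5.resolve_left (mul_ne_zero (pow_ne_zero _ X_ne_zero) (pow_ne_zero _ hf0))
  have h6 := congrArg (UV.map (W1.red p k) rfl) h
  rw [map_sum, Finset.sum_eq_zero (fun j hj => by
    rw [map_mul, UV.map_aeval, hP j (Finset.mem_range.1 hj), map_zero, zero_mul]), map_mul, map_pow,
    map_mul, UV.map_aeval, UV.map_t, ← UV.rel] at h6
  exact ((UV.isUnit_t.mul (UV.isUnit_y.pow n)).pow m).mul_right_eq_zero.1 h6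

theorem UV.kaehlerMap_red_eq_zero (hn : 1 ≤ n) (hnk : IsUnit (n : W1 p k))
    (hf0 : f.map (W1.red p k) ≠ 0)
    {η : Ω[UV n f⁄W1 p k]} (hη : (p : W1 p k) • η = 0) :
    kaehlerMap (W1.red p k) (UV.map (n := n) (W1.red p k) rfl) (UV.map_comp _ _) η = 0 := by
  obtain ⟨c, rfl⟩ := UV.exists_eq_smul_D hnk η
  have h1 : (p : UV n f) * c = 0 := by
    refine UV.smul_D_injective hnk (f := f) ?_
    rw [zero_smul, ← hη, ← algebraMap_smul (UV n f) (p : W1 p k), map_natCast, smul_smul]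
  rw [kaehlerMap_smul_D, UV.map_red_eq_zero hn hf0 h1, zero_smul]

/-- A lift `c` of `n⁻¹` satisfies `n c = 1 + p w`, and `1 - p w` inverts `1 + p w`. -/
theorem W1.isUnit_natCast (hnk : (n : k) ≠ 0) : IsUnit (n : W1 p k) := by
  obtain ⟨c, hc⟩ := W1.red_surjective (p := p) (n : k)⁻¹
  obtain ⟨w, hw⟩ := W1.exists_of_red (p := p) (k := k) (x := n * c - 1) (by
    rw [map_sub, map_mul, map_natCast, hc, mul_inv_cancel₀ hnk, map_one, sub_self])
  refine IsUnit.of_mul_eq_one (c * (1 - p * w)) ?_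
  have h2 := W1.p_sq (p := p) (k := k)
  linear_combination (1 - p * w) * hw - w ^ 2 * h2

/-- Restriction of forms over `k` to the overlap is injective, so the claim descends from the
overlap, where forms are multiples of `dt`. -/
theorem UBar.kaehlerMap_red_eq_zero (hn : 1 ≤ n) (hnk : (n : k) ≠ 0)
    (ht : IsCoprime X (f.map (W1.red p k)))
    {η : Ω[UBar n f⁄W1 p k]} (hη : (p : W1 p k) • η = 0) :
    kaehlerMap (W1.red p k) (UBar.map (n := n) (W1.red p k) rfl) (UBar.map_comp _ _) η = 0 := by
  refine (injective_iff_map_eq_zero _).1 (resΩU_injective hn hnk ht) _ ?_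
  have h1 : (p : W1 p k) • resΩU n f η = 0 := by rw [← map_smul, hη, map_zero]
  rw [← UV.kaehlerMap_red_eq_zero hn (W1.isUnit_natCast hnk)
    (fun h => ne_zero_of_isCoprime_X ht (by rw [h, coeff_zero])) h1]
  exact (kaehlerMap_comp _ _ _ _ _ _ _ _ _ _ _ _ (map_resU _ _) η).symm

theorem VRing.kaehlerMap_red_eq_zero {r : ℕ} (hf : f.natDegree ≤ r * n) (hn : 1 ≤ n)
    (hnk : (n : k) ≠ 0) (ht : IsCoprime X (f.map (W1.red p k)))
    (h : IsCoprime (infPoly n r (f.map (W1.red p k)))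
      (derivative (infPoly n r (f.map (W1.red p k)))))
    {η : Ω[VRing n r f⁄W1 p k]} (hη : (p : W1 p k) • η = 0) :
    kaehlerMap (W1.red p k) (VRing.map (n := n) r (W1.red p k) rfl) (VRing.map_comp r _ _) η =
      0 := by
  refine (injective_iff_map_eq_zero _).1 (resΩV_injective (natDegree_red_le hf) h hn hnk ht) _ ?_
  have h1 : (p : W1 p k) • resΩV n r f hf η = 0 := by rw [← map_smul, hη, map_zero]
  rw [← UV.kaehlerMap_red_eq_zero hn (W1.isUnit_natCast hnk)
    (fun h => ne_zero_of_isCoprime_X ht (by rw [h, coeff_zero])) h1]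
  exact (kaehlerMap_comp _ _ _ _ _ _ _ _ _ _ _ _ (map_resV r _ _ _ _) η).symm

end Reduction

section General

variable {p : ℕ} [Fact p.Prime] {k : Type*} [Field k] [CharP k p]

theorem natCast_char_eq_zero (k : Type*) [Field k] [CharP k p] (A : Type*) [CommRing A]
    [Algebra k A] : (p : A) = 0 := by
  rw [← map_natCast (algebraMap k A), CharP.cast_eq_zero, map_zero]

theorem natCast_sq_eq_zero (A : Type*) [CommRing A] [Algebra (W1 p k) A] : (p : A) ^ 2 = 0 := by
  rw [← map_natCast (algebraMap (W1 p k) A), ← map_pow, W1.p_sq, map_zero]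

theorem aeval_mulP {A : Type*} [CommRing A] [Algebra (W1 p k) A] (x : A) (Q : k[X]) :
    aeval x (mulP p k Q) = p * aeval x (teichLift p k Q) := by
  rw [mulP, map_mul, aeval_C, map_natCast]

/-! ### Divided Frobenius: uniqueness and construction -/

variable {A' A B' B : Type*} [CommRing A'] [CommRing A] [CommRing B'] [CommRing B]
  [Algebra (W1 p k) A'] [Algebra (W1 p k) A] [Algebra k B'] [Algebra k B] {F : A' →+* A}
  {hF : F.comp (algebraMap (W1 p k) A') = (algebraMap (W1 p k) A).comp (RingHom.id _)}
  {ρ' : A' →+* B'}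
  {hρ' : ρ'.comp (algebraMap (W1 p k) A') = (algebraMap k B').comp (W1.red p k)}
  {ρ : A →+* B} {hρ : ρ.comp (algebraMap (W1 p k) A) = (algebraMap k B).comp (W1.red p k)}

/-- Every form lifts to `W₁`, and the quotient of `F^* ω` by `p` is unique up to elements killed by
`p`, which reduce to zero. -/
theorem IsDividedFrobenius.unique {φ₁ φ₂ : Ω[B'⁄k] →+ Ω[B⁄k]} (hs : Function.Surjective ρ')
    (hflat : ∀ η : Ω[A⁄W1 p k], (p : W1 p k) • η = 0 → kaehlerMap (W1.red p k) ρ hρ η = 0)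
    (h₁ : IsDividedFrobenius F hF ρ' hρ' ρ hρ φ₁) (h₂ : IsDividedFrobenius F hF ρ' hρ' ρ hρ φ₂) :
    φ₁ = φ₂ := by
  ext x
  obtain ⟨ω, rfl⟩ := kaehlerMap_surjective hs hρ' x
  obtain ⟨η₁, e₁, e₁'⟩ := h₁ ω
  obtain ⟨η₂, e₂, e₂'⟩ := h₂ ω
  rw [e₁', e₂', ← sub_eq_zero, ← map_sub]
  exact hflat _ (by rw [smul_sub, ← e₁, ← e₂, sub_self])

theorem IsFrobeniusDifference.unique {FU FV : A' →+* A} {h₁ h₂ : Ω[B'⁄k] →+ B}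
    (hs : Function.Surjective ρ') (hflat : ∀ e : A, (p : A) * e = 0 → ρ e = 0)
    (H₁ : IsFrobeniusDifference (p := p) FU FV ρ' ρ h₁)
    (H₂ : IsFrobeniusDifference (p := p) FU FV ρ' ρ h₂) : h₁ = h₂ := by
  ext x
  refine kaehler_induction (P := fun x => h₁ x = h₂ x) (by simp)
    (fun x y hx hy => by rw [map_add, map_add, hx, hy]) (fun a b => ?_) x
  obtain ⟨a, rfl⟩ := hs a
  obtain ⟨b, rfl⟩ := hs b
  obtain ⟨e₁, h1, h1'⟩ := H₁.2 b
  obtain ⟨e₂, h2, h2'⟩ := H₂.2 b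
  rw [H₁.1, H₂.1, h1', h2']
  congr 1
  rw [← sub_eq_zero, ← map_sub]
  exact hflat _ (by rw [mul_sub, ← h1, ← h2, sub_self])

variable (F hF ρ' hρ' ρ hρ) in
/-- The condition of a divided Frobenius for the form `db`. -/
def DividesFrobeniusAt (φ : Ω[B'⁄k] →+ Ω[B⁄k]) (b : A') : Prop :=
  ∃ η : Ω[A⁄W1 p k], D (W1 p k) A (F b) = (p : W1 p k) • η ∧
    φ (D k B' (ρ' b)) = kaehlerMap (W1.red p k) ρ hρ η

theorem isDividedFrobenius_of_D {φ : Ω[B'⁄k] →+ Ω[B⁄k]}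
    (hφ : ∀ a ω, φ (ρ' a • ω) = ρ (F a) • φ ω) (h : ∀ b, DividesFrobeniusAt F ρ' ρ hρ φ b) :
    IsDividedFrobenius F hF ρ' hρ' ρ hρ φ := by
  intro ω
  refine kaehler_induction (P := fun ω => ∃ η, kaehlerMap (RingHom.id _) F hF ω =
    (p : W1 p k) • η ∧ φ (kaehlerMap (W1.red p k) ρ' hρ' ω) = kaehlerMap (W1.red p k) ρ hρ η)
    ⟨0, by simp⟩ ?_ ?_ ω
  · rintro x y ⟨η₁, h1, h1'⟩ ⟨η₂, h2, h2'⟩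
    exact ⟨η₁ + η₂, by rw [map_add, h1, h2, smul_add], by rw [map_add, map_add, h1', h2', map_add]⟩
  · intro a b
    obtain ⟨η, h1, h2⟩ := h b
    exact ⟨F a • η, by rw [kaehlerMap_smul_D, h1, smul_comm],
      by rw [kaehlerMap_smul_D, hφ, h2, kaehlerMap_smul]⟩

theorem DividesFrobeniusAt.add {φ : Ω[B'⁄k] →+ Ω[B⁄k]} {x y : A'}
    (hx : DividesFrobeniusAt F ρ' ρ hρ φ x) (hy : DividesFrobeniusAt F ρ' ρ hρ φ y) :
    DividesFrobeniusAt F ρ' ρ hρ φ (x + y) := by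
  obtain ⟨η₁, h1, h1'⟩ := hx
  obtain ⟨η₂, h2, h2'⟩ := hy
  exact ⟨η₁ + η₂, by rw [map_add, map_add, h1, h2, smul_add],
    by rw [map_add, map_add, map_add, h1', h2', map_add]⟩

theorem DividesFrobeniusAt.mul {φ : Ω[B'⁄k] →+ Ω[B⁄k]}
    (hφ : ∀ a ω, φ (ρ' a • ω) = ρ (F a) • φ ω) {x y : A'}
    (hx : DividesFrobeniusAt F ρ' ρ hρ φ x) (hy : DividesFrobeniusAt F ρ' ρ hρ φ y) :
    DividesFrobeniusAt F ρ' ρ hρ φ (x * y) := by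
  obtain ⟨η₁, h1, h1'⟩ := hx
  obtain ⟨η₂, h2, h2'⟩ := hy
  refine ⟨F x • η₂ + F y • η₁, ?_, ?_⟩
  · rw [map_mul, Derivation.leibniz, h1, h2, smul_add, smul_comm, smul_comm (F y)]
  · rw [map_mul, Derivation.leibniz, map_add, hφ, hφ, h1', h2', map_add, kaehlerMap_smul,
      kaehlerMap_smul]

theorem DividesFrobeniusAt.const
    (hF : F.comp (algebraMap (W1 p k) A') = (algebraMap (W1 p k) A).comp (RingHom.id _))
    (hρ' : ρ'.comp (algebraMap (W1 p k) A') = (algebraMap k B').comp (W1.red p k))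
    (φ : Ω[B'⁄k] →+ Ω[B⁄k]) (c : W1 p k) :
    DividesFrobeniusAt F ρ' ρ hρ φ (algebraMap (W1 p k) A' c) := by
  have h1 : F (algebraMap (W1 p k) A' c) = algebraMap (W1 p k) A c := RingHom.congr_fun hF c
  have h2 : ρ' (algebraMap (W1 p k) A' c) = algebraMap k B' (W1.red p k c) :=
    RingHom.congr_fun hρ' c
  exact ⟨0, by rw [h1, Derivation.map_algebraMap, smul_zero],
    by rw [h2, Derivation.map_algebraMap, map_zero, map_zero]⟩

end General

/-! ### The divided Frobenius on `V` -/

section PhiV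

variable {p : ℕ} [Fact p.Prime] {k : Type*} [Field k] [CharP k p] {n r : ℕ}

theorem derivative_pow_char (q : k[X]) : derivative (q ^ p) = 0 := by
  rw [derivative_pow, CharP.cast_eq_zero, C_0, zero_mul, zero_mul]

/-- In the derivative of the defining relation of `v` and `w` both sides carry a factor `p`, since
`f₂ ^ p` and `f₂^σ(s ^ p)` each produce one. Dividing by it gives an identity over `k`, where `p`-th
powers have derivative zero. -/
theorem FrobVRel.derivative_eq [PerfectRing k p] {f : (W1 p k)[X]} {v w : k[X]}
    (h : FrobVRel n r f v w) : derivative (infPoly n r (f.map (W1.red p k))) ^ p *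
      (X ^ (p - 1) + derivative v) =
      infPoly n r (f.map (W1.red p k)) ^ (p - 1) * derivative (infPoly n r (f.map (W1.red p k))) +
        (n : k[X]) * derivative w * infPoly n r (f.map (W1.red p k)) ^ p := by
  rw [infPoly_map r (W1.red p k) rfl]
  rw [FrobVRel, mulP] at h
  set G := infPoly n r f
  set T := v * derivative (G.map (W1.red p k)) ^ p - n * w * G.map (W1.red p k) ^ p with hT
  have h1 := congrArg derivative h
  rw [derivative_sub, derivative_pow, derivative_expand, derivative_C_mul, C_eq_natCast] at h1
  have h2 := map_red_eq_zero (P := G ^ (p - 1) * derivative G -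
    expand (W1 p k) p (derivative (G.map (W1.sigma p k))) * X ^ (p - 1) -
      derivative (teichLift p k T)) (by
    rw [C_eq_natCast]
    linear_combination h1)
  have hd : derivative T = derivative v * derivative (G.map (W1.red p k)) ^ p -
      n * derivative w * G.map (W1.red p k) ^ p := by
    rw [hT, derivative_sub, derivative_mul, derivative_mul, derivative_mul, derivative_pow_char,
      derivative_pow_char, derivative_natCast]
    ring
  have hsig : (derivative (G.map (W1.sigma p k))).map (W1.red p k) =
      (derivative (G.map (W1.red p k))).map (frobenius k p) := by
    rw [← derivative_map, map_red_sigma, derivative_map]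
  rw [Polynomial.map_sub, Polynomial.map_sub, Polynomial.map_mul, Polynomial.map_mul, map_expand,
    hsig, ← map_expand, map_frobenius_expand, ← derivative_map, ← derivative_map, map_teichLift, hd,
    Polynomial.map_pow, Polynomial.map_pow, map_X] at h2
  linear_combination -h2

variable {g g' : k[X]} (hg : g' = g.map (frobenius k p))

/-- The divided Frobenius on forms on `V`. -/
theorem exists_phiV (hn : 1 ≤ n) (hnk : (n : k) ≠ 0)
    (hc : IsCoprime (infPoly n r g) (derivative (infPoly n r g))) {v w : k[X]}
    (hv : derivative (infPoly n r g) ^ p * (X ^ (p - 1) + derivative v) =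
      infPoly n r g ^ (p - 1) * derivative (infPoly n r g) + (n : k[X]) * derivative w * infPoly n r g ^ p) :
    ∃ φ : Ω[VRing n r g'⁄k] →ₗ[k] Ω[VRing n r g⁄k],
      (∀ (a : VRing n r g') ω, φ (a • ω) = relFrobV r hg a • φ ω) ∧
      φ (D k _ (VRing.s n g' r)) = aeval (VRing.s n g r) (X ^ (p - 1) + derivative v) •
        D k _ (VRing.s n g r) ∧
      φ (D k _ (VRing.z n g' r)) = VRing.z n g r ^ (p - 1) • D k _ (VRing.z n g r) +
        (VRing.z n g r ^ p * aeval (VRing.s n g r) (derivative w)) • D k _ (VRing.s n g r) := by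
  have hp : 1 ≤ p := (Fact.out : p.Prime).one_lt.le
  set s := VRing.s n g r
  set z := VRing.z n g r
  have hz : z ^ n = aeval s (infPoly n r g) := VRing.rel r
  -- The intended values of `φ(ds)` and `φ(dz)`, written in the generator `formZ hc`: `ds` is `z ^
  -- (n - 1)` times it, and `dz` is `f₂' / n` times it.
  let δs := aeval s (X ^ (p - 1) + derivative v) * z ^ (n - 1)
  let δz := z ^ (p - 1) * (algebraMap k (VRing n r g) (n : k)⁻¹ *
    aeval s (derivative (infPoly n r g))) + z ^ p * aeval s (derivative w) * z ^ (n - 1)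
  have hm : (n : VRing n r g) * algebraMap k (VRing n r g) (n : k)⁻¹ = 1 := by
    rw [← map_natCast (algebraMap k (VRing n r g)), ← map_mul, mul_inv_cancel₀ hnk, map_one]
  have hg2 := infPoly_map (n := n) r _ hg
  -- The `ε`-part of the equation of the twist is the relation `hv` multiplied by `z ^ (n - 1)`.
  have hrel : (TrivSqZeroExt.inl (z ^ p) + TrivSqZeroExt.inr δz : DualNumber (VRing n r g)) ^ n =
      (infPoly n r g').eval₂ (algebraMap k _)
        (TrivSqZeroExt.inl (s ^ p) + TrivSqZeroExt.inr δs : DualNumber (VRing n r g)) := by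
    rw [← aeval_def, aeval_inl_add_inr, inl_add_inr_pow, relFrob_rel hg2 (VRing.rel r), ← aeval_def]
    congr 2
    have h1 : aeval (s ^ p) (derivative (infPoly n r g')) =
        aeval s (derivative (infPoly n r g)) ^ p := by
      have : derivative (infPoly n r g') =
          (derivative (infPoly n r g)).map (frobenius k p) := by rw [hg2, derivative_map]
      rw [aeval_pow_char this, aeval_def]
    have h2 := congrArg (aeval s) hv
    simp only [map_mul, map_add, map_pow, map_natCast, ← hz] at h2
    rw [h1]
    simp only [δs, δz, map_add, map_pow]
    obtain ⟨e, he⟩ : ∃ e, p = e + 1 := ⟨p - 1, by omega⟩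
    obtain ⟨c, rfl⟩ : ∃ c, n = c + 1 := ⟨n - 1, by omega⟩
    rw [he] at h2 ⊢
    simp only [Nat.add_sub_cancel] at h2 ⊢
    linear_combination (z ^ ((e + 1) * c + e) * aeval s (derivative (infPoly (c + 1) r g))) * hm -
      z ^ c * h2
  obtain ⟨Λ, hΛ⟩ := exists_kaehler_functional (R := k)
    (Plane.lift (algebraMap k (DualNumber (VRing n r g))) _ _ hrel) (Plane.lift_comp ..)
  have hfst : ∀ a : VRing n r g', (Plane.lift (algebraMap k (DualNumber (VRing n r g))) _ _ hrel a).fst =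
      relFrobV r hg a := fst_comp _ (relFrobV r hg) (by
    refine Plane.hom_ext ?_ ?_ ?_
    · rw [RingHom.comp_assoc, Plane.lift_comp, relFrobV_comp]; rfl
    · rw [RingHom.comp_apply, Plane.lift_fst]
      refine Eq.trans ?_ (relFrobV_s hg r).symm
      simp [s]
    · rw [RingHom.comp_apply, Plane.lift_snd]
      refine Eq.trans ?_ (relFrobV_z hg r).symm
      simp [z])
  have hsm : ∀ (a : VRing n r g') ω, Λ (a • ω) = relFrobV r hg a * Λ ω :=
    kaehler_functional_smul (Λ := Λ.toAddMonoidHom) (fun a b => map_mul _ a b)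
      (fun a b => by rw [← hfst]; exact hΛ a b)
  -- The functional `Λ` is the coefficient of `formZ hc` in the divided Frobenius.
  refine ⟨((LinearMap.toSpanSingleton (VRing n r g) _ (formZ hc)).restrictScalars k) ∘ₗ Λ,
    fun a ω => ?_, ?_, ?_⟩
  · change Λ (a • ω) • formZ hc = relFrobV r hg a • Λ ω • formZ hc
    rw [hsm, mul_smul]
  · change Λ (D k _ (VRing.s n g' r)) • formZ hc = _
    have h1 : Λ (D k _ (VRing.s n g' r)) = δs := by
      have := hΛ 1 (VRing.s n g' r)
      rw [one_smul, map_one, VRing.s, Plane.lift_fst] at this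
      rw [VRing.s, this]
      simp
    rw [h1, ← formZ_spec hn hc, smul_smul]
  · change Λ (D k _ (VRing.z n g' r)) • formZ hc = _
    have h1 : Λ (D k _ (VRing.z n g' r)) = δz := by
      have := hΛ 1 (VRing.z n g' r)
      rw [one_smul, map_one, VRing.z, Plane.lift_snd] at this
      rw [VRing.z, this]
      simp
    rw [h1, ← formZ_spec hn hc, smul_D_z hc hn hnk, smul_smul, smul_smul, ← add_smul]

/-- The divided Frobenius on forms on `y ≠ 0`. -/
theorem exists_phiU (hnk : (n : k) ≠ 0) :
    ∃ φ : Ω[UBar n g'⁄k] →ₗ[k] Ω[UBar n g⁄k], ∀ c : UBar n g', φ (c • D k _ (UBar.t n g')) =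
      relFrobU hg c • UBar.t n g ^ (p - 1) • D k _ (UBar.t n g) := by
  obtain ⟨Λ, hΛ⟩ := UBar.exists_coeff (f := g') (n := n) hnk.isUnit
  let R : UBar n g' →ₐ[k] UBar n g :=
    { relFrobU hg with commutes' := fun c => RingHom.congr_fun (relFrobU_comp hg) c }
  refine ⟨((LinearMap.toSpanSingleton (UBar n g) _
    (UBar.t n g ^ (p - 1) • D k _ (UBar.t n g))).restrictScalars k) ∘ₗ R.toLinearMap ∘ₗ Λ,
    fun c => ?_⟩
  change relFrobU hg (Λ (c • D k _ (UBar.t n g'))) • UBar.t n g ^ (p - 1) • D k _ (UBar.t n g) = _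
  rw [hΛ]

/-- The semilinear map `α dβ ↦ α ^ p (F_U(β) - F_V(β)) / p`, given by its value on `dt`. -/
theorem exists_frobDiff (hnk : (n : k) ≠ 0) (x : UV n g) :
    ∃ φ : Ω[UV n g'⁄k] →ₗ[k] UV n g, ∀ c : UV n g', φ (c • D k _ (UV.t n g')) =
      relFrobUV hg c * x := by
  obtain ⟨Λ, hΛ⟩ := UV.exists_coeff (f := g') (n := n) hnk.isUnit
  let R : UV n g' →ₐ[k] UV n g :=
    { relFrobUV hg with commutes' := fun c => RingHom.congr_fun (relFrobUV_comp hg) c }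
  refine ⟨LinearMap.mulRight k x ∘ₗ R.toLinearMap ∘ₗ Λ, fun c => ?_⟩
  change relFrobUV hg (Λ (c • D k _ (UV.t n g'))) * x = _
  rw [hΛ]

end PhiV

/-! ### Ring maps out of the overlap are determined by their restriction to either open set. -/

section HomExt

variable {R S : Type*} [CommRing R] [CommRing S] {n r : ℕ} {f : R[X]}

theorem UV.hom_ext_resU {φ ψ : UV n f →+* S} (h : φ.comp (resU n f) = ψ.comp (resU n f)) :
    φ = ψ := by
  refine UV.hom_ext ?_ ?_ ?_
  · have := congrArg (fun χ : UBar n f →+* S => χ.comp (algebraMap R _)) h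
    simpa only [RingHom.comp_assoc, resU_comp, RingHom.comp_id] using this
  · rw [← resU_t]; exact RingHom.congr_fun h _
  · rw [← resU_y]; exact RingHom.congr_fun h _

theorem UV.hom_ext_resV (hf : f.natDegree ≤ r * n) {φ ψ : UV n f →+* S}
    (h : φ.comp (resV n f r hf) = ψ.comp (resV n f r hf)) : φ = ψ := by
  have h1 : φ (UV.tInv n f) = ψ (UV.tInv n f) := by
    have := RingHom.congr_fun h (VRing.s n f r)
    rwa [RingHom.comp_apply, RingHom.comp_apply, VRing.s, resV, Plane.lift_fst] at this
  have h2 : φ (UV.tInv n f) ^ r * φ (UV.y n f) = ψ (UV.tInv n f) ^ r * ψ (UV.y n f) := by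
    have := RingHom.congr_fun h (VRing.z n f r)
    rwa [RingHom.comp_apply, RingHom.comp_apply, VRing.z, resV, Plane.lift_snd, map_mul, map_mul,
      map_pow, map_pow] at this
  have hu : IsUnit (φ (UV.tInv n f)) :=
    (IsUnit.of_mul_eq_one (UV.t n f) (by rw [mul_comm, UV.t_mul_tInv])).map φ
  refine UV.hom_ext ?_ ?_ ?_
  · have := congrArg (fun χ : VRing n r f →+* S => χ.comp (algebraMap R _)) h
    simpa only [RingHom.comp_assoc, resV_comp, RingHom.comp_id] using this
  · refine hu.mul_left_cancel ?_
    have h3 : UV.tInv n f * UV.t n f = 1 := (mul_comm _ _).trans UV.t_mul_tInv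
    rw [← map_mul, h3, h1, ← map_mul, h3, map_one, map_one]
  · refine (hu.pow r).mul_left_cancel ?_
    rw [h2, h1]

end HomExt

/-! ### Extension of the two lifts of Frobenius to the overlap, and their divided maps and
difference. -/

section Frob

variable {p : ℕ} [Fact p.Prime] {k : Type*} [Field k] [CharP k p] {n r : ℕ} {f : (W1 p k)[X]}

/-- A lift of Frobenius over `W₁` on functions on `t y ≠ 0`. -/
structure IsFrobeniusLift (G : UV n (f.map (W1.sigma p k)) →+* UV n f) : Prop where
  comp : G.comp (algebraMap (W1 p k) _) = algebraMap (W1 p k) _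
  dvd_t : (p : UV n f) ∣ G (UV.t n _) - UV.t n f ^ p
  dvd_y : (p : UV n f) ∣ G (UV.y n _) - UV.y n f ^ p

theorem map_red_eq_of_dvd {x y : UV n f} (h : (p : UV n f) ∣ x - y) :
    UV.map (W1.red p k) rfl x = UV.map (W1.red p k) rfl y := by
  obtain ⟨e, he⟩ := h
  rw [← sub_eq_zero, ← map_sub, he, map_mul, map_natCast,
    natCast_char_eq_zero k (UV n (f.map (W1.red p k))), zero_mul]

theorem IsFrobeniusLift.red {G : UV n (f.map (W1.sigma p k)) →+* UV n f} (hG : IsFrobeniusLift G)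
    (x) : UV.map (W1.red p k) rfl (G x) =
      relFrobUV (map_red_sigma f) (UV.map (W1.red p k) rfl x) := by
  refine RingHom.congr_fun (f := (UV.map (n := n) (W1.red p k) rfl).comp G)
    (g := (relFrobUV (map_red_sigma f)).comp (UV.map (n := n) (W1.red p k) rfl))
    (UV.hom_ext ?_ ?_ ?_) x
  · rw [RingHom.comp_assoc, hG.comp, UV.map_comp, RingHom.comp_assoc, UV.map_comp,
      ← RingHom.comp_assoc, relFrobUV_comp]
  · rw [RingHom.comp_apply, RingHom.comp_apply, map_red_eq_of_dvd hG.dvd_t, map_pow, UV.map_t,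
      UV.map_t, relFrobUV_t]
  · rw [RingHom.comp_apply, RingHom.comp_apply, map_red_eq_of_dvd hG.dvd_y, map_pow, UV.map_y,
      UV.map_y, relFrobUV_y]

theorem one_add_mul_isUnit {A : Type*} [CommRing A] [Algebra (W1 p k) A] (a : A) :
    IsUnit (1 + p * a) := by
  refine IsUnit.of_mul_eq_one (1 - p * a) ?_
  linear_combination (-a ^ 2) * natCast_sq_eq_zero (p := p) (k := k) A

/-- The image of `t` under the lift of Frobenius on `V`. -/
noncomputable def frobVt (n : ℕ) (f : (W1 p k)[X]) (v : k[X]) : UV n f :=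
  UV.t n f ^ p - p * (aeval (UV.tInv n f) (teichLift p k v) * UV.t n f ^ (2 * p))

/-- Since `p² = 0`, the inverse of `s ^ p (1 + p v t ^ p)` is `t ^ p (1 - p v t ^ p)`. -/
theorem frobVt_mul (v : k[X]) : frobVt n f v *
    (UV.tInv n f ^ p + p * aeval (UV.tInv n f) (teichLift p k v)) = 1 := by
  have h1 : UV.t n f ^ p * UV.tInv n f ^ p = 1 := by rw [← mul_pow, UV.t_mul_tInv, one_pow]
  have h2 := natCast_sq_eq_zero (p := p) (k := k) (UV n f)
  rw [frobVt]
  set A := aeval (UV.tInv n f) (teichLift p k v)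
  linear_combination (1 - p * A * UV.t n f ^ p) * h1 - A ^ 2 * UV.t n f ^ (2 * p) * h2

variable [PerfectRing k p]

theorem frobU_t (hn : (n : k) ≠ 0) : frobU f hn (UBar.t n _) = UBar.t n f ^ p := UBar.lift_t ..

theorem frobU_y (hn : (n : k) ≠ 0) : frobU f hn (UBar.y n _) = frobUy n f := UBar.lift_y ..

theorem frobV_s {v w : k[X]} (hv : FrobVRel n r f v w) : frobV hv (VRing.s n _ r) =
    VRing.s n f r ^ p + p * aeval (VRing.s n f r) (teichLift p k v) :=
  (Plane.lift_fst ..).trans (by rw [aeval_mulP])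

theorem frobV_z {v w : k[X]} (hv : FrobVRel n r f v w) : frobV hv (VRing.z n _ r) =
    VRing.z n f r ^ p + p * aeval (VRing.s n f r) (teichLift p k w) * VRing.z n f r ^ p :=
  (Plane.lift_snd ..).trans (by rw [aeval_mulP])

theorem exists_extU (hn : (n : k) ≠ 0) : ∃ G : UV n (f.map (W1.sigma p k)) →+* UV n f,
    G.comp (resU n _) = (resU n f).comp (frobU f hn) ∧ IsFrobeniusLift G ∧
    G (UV.t n _) = UV.t n f ^ p := by
  have hrel : resU n f (frobUy n f) ^ n =
      (f.map (W1.sigma p k)).eval₂ (algebraMap (W1 p k) (UV n f)) (UV.t n f ^ p) := by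
    have h1 := congrArg (resU n f) (frobUy_rel f hn)
    rw [map_pow, ← aeval_def, eval₂_comp_algebraMap, resU_comp, map_pow, resU_t,
      RingHom.comp_id] at h1
    exact h1
  let G := UV.lift (algebraMap (W1 p k) (UV n f)) _ _ hrel (UV.isUnit_t.pow p)
    ((frobUy_isUnit f).map _)
  have hc : G.comp (algebraMap (W1 p k) _) = algebraMap (W1 p k) _ := UV.lift_comp ..
  have ht : G (UV.t n _) = UV.t n f ^ p := UV.lift_t ..
  have hy : G (UV.y n _) = resU n f (frobUy n f) := UV.lift_y ..
  refine ⟨G, UBar.hom_ext ?_ ?_ ?_, ⟨hc, ?_, ?_⟩, ht⟩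
  · rw [RingHom.comp_assoc, resU_comp, RingHom.comp_id, hc, RingHom.comp_assoc, frobU_comp,
      RingHom.comp_id, resU_comp, RingHom.comp_id]
  · rw [RingHom.comp_apply, RingHom.comp_apply, resU_t, ht, frobU_t, map_pow, resU_t]
  · rw [RingHom.comp_apply, RingHom.comp_apply, resU_y, hy, frobU_y]
  · rw [ht, sub_self]; exact dvd_zero _
  · rw [hy, frobUy, map_add, map_pow, resU_y, add_sub_cancel_left, aeval_mulP, map_mul, map_mul,
      map_natCast, mul_assoc]
    exact dvd_mul_right _ _

theorem dvd_mul_sub_of_eq {A : Type*} [CommRing A] {T t t' y W e P : A} {m : ℕ}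
    (he : T - t = P * e) (h : t * t' ^ m = 1) :
    P ∣ T * ((t' * y) ^ m * (1 + P * W)) - y ^ m := by
  refine ⟨e * ((t' * y) ^ m * (1 + P * W)) + y ^ m * W, ?_⟩
  rw [mul_pow]
  linear_combination (t' ^ m * y ^ m * (1 + P * W)) * he + (y ^ m * (1 + P * W)) * h

theorem pow_mul_pow_eq_of_infPoly {R A : Type*} [CommRing R] [CommRing A] {φ : R →+* A} {g : R[X]}
    (hg : g.natDegree ≤ r * n) {T S Z : A} (hTS : T * S = 1)
    (h : Z ^ n = (infPoly n r g).eval₂ φ S) : (T ^ r * Z) ^ n = g.eval₂ φ T := by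
  let _ : Invertible T := ⟨S, (mul_comm _ _).trans hTS, hTS⟩
  have h1 := eval₂_reflect_mul_pow φ T (r * n) g hg
  have h2 : ⅟T = S := rfl
  rw [h2] at h1
  rw [← h1, mul_pow, h, ← pow_mul, infPoly, mul_comm]

theorem resV_frobV_s (hf : f.natDegree ≤ r * n) {v w : k[X]} (hv : FrobVRel n r f v w) :
    resV n f r hf (frobV hv (VRing.s n _ r)) =
      UV.tInv n f ^ p + p * aeval (UV.tInv n f) (teichLift p k v) := by
  rw [frobV_s, map_add, map_pow, map_mul, map_natCast, eval₂_comp_algebraMap, resV_comp,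
    RingHom.comp_id, resV_s, aeval_def]

theorem resV_frobV_z (hf : f.natDegree ≤ r * n) {v w : k[X]} (hv : FrobVRel n r f v w) :
    resV n f r hf (frobV hv (VRing.z n _ r)) = (UV.tInv n f ^ r * UV.y n f) ^ p *
      (1 + p * aeval (UV.tInv n f) (teichLift p k w)) := by
  rw [frobV_z, map_add, map_mul, map_pow, map_mul, map_natCast, eval₂_comp_algebraMap, resV_comp,
    RingHom.comp_id, resV_s, resV_z, aeval_def]
  ring

theorem UV.tInv_mul_t {R : Type*} [CommRing R] {f : R[X]} : UV.tInv n f * UV.t n f = 1 :=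
  (mul_comm _ _).trans UV.t_mul_tInv

theorem resV_frobV_rel (hf : f.natDegree ≤ r * n) {v w : k[X]} (hv : FrobVRel n r f v w) :
    resV n f r hf (frobV hv (VRing.z n _ r)) ^ n = (infPoly n r (f.map (W1.sigma p k))).eval₂
      (algebraMap (W1 p k) (UV n f)) (resV n f r hf (frobV hv (VRing.s n _ r))) := by
  have h1 := congrArg (fun x => resV n f r hf (frobV hv x))
    (VRing.rel (n := n) (f := f.map (W1.sigma p k)) r)
  simp only [map_pow] at h1
  rw [h1, eval₂_comp_algebraMap, frobV_comp, RingHom.comp_id, ← aeval_def, eval₂_comp_algebraMap,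
    resV_comp, RingHom.comp_id]

/-- The extension is forced by `t = 1/s` and `y = t ^ r z`: with `T` the inverse of `F_V(s)`, it
sends `t` to `T` and `y` to `T ^ r F_V(z)`. -/
theorem exists_extV (hf : f.natDegree ≤ r * n) {v w : k[X]} (hv : FrobVRel n r f v w) :
    ∃ G : UV n (f.map (W1.sigma p k)) →+* UV n f,
    G.comp (resV n _ r (natDegree_sigma_le hf)) = (resV n f r hf).comp (frobV hv) ∧
    IsFrobeniusLift G ∧ G (UV.t n _) = frobVt n f v := by
  have hs := resV_frobV_s hf hv
  have hz := resV_frobV_z hf hv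
  have hmul : frobVt n f v * resV n f r hf (frobV hv (VRing.s n _ r)) = 1 := by
    rw [hs]; exact frobVt_mul v
  have hrel := pow_mul_pow_eq_of_infPoly (natDegree_sigma_le hf) hmul (resV_frobV_rel hf hv)
  have hZu : IsUnit (resV n f r hf (frobV hv (VRing.z n _ r))) := by
    rw [hz]
    exact IsUnit.mul (IsUnit.pow _ (IsUnit.mul (IsUnit.pow _
      (IsUnit.of_mul_eq_one _ UV.tInv_mul_t)) UV.isUnit_y)) (one_add_mul_isUnit (k := k) _)
  have hTu : IsUnit (frobVt n f v) := IsUnit.of_mul_eq_one _ hmul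
  have hty : (p : UV n f) ∣ frobVt n f v - UV.t n f ^ p := by
    rw [frobVt, sub_sub_cancel_left]
    exact (dvd_mul_right _ _).neg_right
  let G := UV.lift (algebraMap (W1 p k) (UV n f)) _ _ hrel hTu ((hTu.pow r).mul hZu)
  have hc : G.comp (algebraMap (W1 p k) _) = algebraMap (W1 p k) _ := UV.lift_comp ..
  have ht : G (UV.t n _) = frobVt n f v := UV.lift_t ..
  have hy : G (UV.y n _) = frobVt n f v ^ r * resV n f r hf (frobV hv (VRing.z n _ r)) :=
    UV.lift_y ..
  have ht' : G (UV.tInv n _) = resV n f r hf (frobV hv (VRing.s n _ r)) := by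
    have h1 := congrArg G (UV.t_mul_tInv (n := n) (f := f.map (W1.sigma p k)))
    rw [map_mul, map_one, ht, ← hmul] at h1
    exact hTu.mul_left_cancel h1
  refine ⟨G, Plane.hom_ext ?_ ?_ ?_, ⟨hc, ?_, ?_⟩, ht⟩
  · rw [RingHom.comp_assoc, resV_comp, RingHom.comp_id, hc, RingHom.comp_assoc, frobV_comp,
      RingHom.comp_id, resV_comp, RingHom.comp_id]
  · change G (resV n _ r _ (VRing.s n _ r)) = resV n f r hf (frobV hv (VRing.s n _ r))
    rw [resV_s, ht']
  · change G (resV n _ r _ (VRing.z n _ r)) = resV n f r hf (frobV hv (VRing.z n _ r))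
    rw [resV_z, map_mul, map_pow, ht', hy, ← mul_assoc, ← mul_pow,
      (mul_comm _ (frobVt n f v)).trans hmul, one_pow, one_mul]
  · rw [ht]; exact hty
  -- Modulo `p` the image of `y` is `t ^ (p r) (t ^ (-r) y) ^ p = y ^ p`.
  · obtain ⟨e, he⟩ := hty.trans (sub_dvd_pow_sub_pow _ _ r)
    have h2 : (UV.t n f ^ p) ^ r * (UV.tInv n f ^ r) ^ p = 1 := by
      rw [← pow_mul, ← pow_mul, mul_comm r p, ← mul_pow, UV.t_mul_tInv, one_pow]
    rw [hy, hz]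
    exact dvd_mul_sub_of_eq he h2

theorem frobU_red (hn : (n : k) ≠ 0) (x) : UBar.map (W1.red p k) rfl (frobU f hn x) =
    relFrobU (map_red_sigma f) (UBar.map (W1.red p k) rfl x) := by
  refine RingHom.congr_fun (f := (UBar.map (n := n) (W1.red p k) rfl).comp (frobU f hn))
    (g := (relFrobU (map_red_sigma f)).comp (UBar.map (n := n) (W1.red p k) rfl))
    (UBar.hom_ext ?_ ?_ ?_) x
  · rw [RingHom.comp_assoc, frobU_comp, RingHom.comp_id, UBar.map_comp, RingHom.comp_assoc,
      UBar.map_comp, ← RingHom.comp_assoc, relFrobU_comp]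
  · rw [RingHom.comp_apply, RingHom.comp_apply, frobU_t, map_pow, UBar.map_t,
      UBar.map_t, relFrobU_t]
  · rw [RingHom.comp_apply, RingHom.comp_apply, frobU_y, frobUy, map_add, map_pow,
      aeval_mulP, map_mul, map_mul, map_natCast, natCast_char_eq_zero k (UBar n (f.map (W1.red p k))),
      zero_mul, zero_mul, add_zero, UBar.map_y, UBar.map_y, relFrobU_y]

theorem frobV_red {v w : k[X]} (hv : FrobVRel n r f v w) (x) :
    VRing.map r (W1.red p k) rfl (frobV hv x) =
      relFrobV r (map_red_sigma f) (VRing.map r (W1.red p k) rfl x) := by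
  refine RingHom.congr_fun (f := (VRing.map (n := n) r (W1.red p k) rfl).comp (frobV hv))
    (g := (relFrobV r (map_red_sigma f)).comp (VRing.map (n := n) r (W1.red p k) rfl))
    (Plane.hom_ext ?_ ?_ ?_) x
  · rw [RingHom.comp_assoc, frobV_comp, RingHom.comp_id, VRing.map_comp, RingHom.comp_assoc,
      VRing.map_comp, ← RingHom.comp_assoc, relFrobV_comp]
  · change VRing.map r (W1.red p k) rfl (frobV hv (VRing.s n _ r)) =
      relFrobV r (map_red_sigma f) (VRing.map r (W1.red p k) rfl (VRing.s n _ r))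
    rw [frobV_s, map_add, map_pow, map_mul, map_natCast,
      natCast_char_eq_zero k (VRing n r (f.map (W1.red p k))), zero_mul, add_zero, VRing.map_s,
      VRing.map_s, relFrobV_s]
  · change VRing.map r (W1.red p k) rfl (frobV hv (VRing.z n _ r)) =
      relFrobV r (map_red_sigma f) (VRing.map r (W1.red p k) rfl (VRing.z n _ r))
    rw [frobV_z, map_add, map_pow, map_mul, map_mul, map_natCast,
      natCast_char_eq_zero k (VRing n r (f.map (W1.red p k))), zero_mul, zero_mul, add_zero,
      VRing.map_z, VRing.map_z, relFrobV_z]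

theorem D_natCast_mul {A : Type*} [CommRing A] [Algebra (W1 p k) A] (x : A) :
    D (W1 p k) A (p * x) = (p : W1 p k) • D (W1 p k) A x := by
  rw [← Derivation.map_smul, Algebra.smul_def, map_natCast]

theorem D_pow_natCast_char {A : Type*} [CommRing A] [Algebra (W1 p k) A] (x : A) :
    D (W1 p k) A (x ^ p) = (p : W1 p k) • x ^ (p - 1) • D (W1 p k) A x := by
  rw [Derivation.leibniz_pow, Nat.cast_smul_eq_nsmul (W1 p k)]

section Abstract

variable {A' A B' B : Type*} [CommRing A'] [CommRing A] [CommRing B'] [CommRing B]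
  [Algebra (W1 p k) A'] [Algebra (W1 p k) A] [Algebra k B'] [Algebra k B] {F : A' →+* A}
  {hF : F.comp (algebraMap (W1 p k) A') = (algebraMap (W1 p k) A).comp (RingHom.id _)}
  {ρ' : A' →+* B'}
  {hρ' : ρ'.comp (algebraMap (W1 p k) A') = (algebraMap k B').comp (W1.red p k)}
  {ρ : A →+* B} {hρ : ρ.comp (algebraMap (W1 p k) A) = (algebraMap k B).comp (W1.red p k)}

/-- From `F(b) = x ^ p + p e` follows `d F(b) = p (x ^ (p - 1) dx + de)`, the bracket being the
divided value. -/
theorem DividesFrobeniusAt.of_eq {φ : Ω[B'⁄k] →+ Ω[B⁄k]} {b : A'} {x e : A}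
    (hb : F b = x ^ p + p * e)
    (hφ : φ (D k B' (ρ' b)) = ρ x ^ (p - 1) • D k B (ρ x) + D k B (ρ e)) :
    DividesFrobeniusAt F ρ' ρ hρ φ b :=
  ⟨x ^ (p - 1) • D _ _ x + D _ _ e,
    by rw [hb, map_add, D_natCast_mul, D_pow_natCast_char, smul_add],
    by rw [hφ, map_add, kaehlerMap_smul, kaehlerMap_D, kaehlerMap_D, map_pow]⟩

theorem isDividedFrobenius_of_smul_D {φ : Ω[B'⁄k] →+ Ω[B⁄k]} {b : A'} {x : A}
    (hgen : ∀ ω : Ω[A'⁄W1 p k], ∃ c : A', ω = c • D (W1 p k) A' b) (hb : F b = x ^ p)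
    (hφ : ∀ c, φ (ρ' c • D k B' (ρ' b)) = ρ (F c) • ρ x ^ (p - 1) • D k B (ρ x)) :
    IsDividedFrobenius F hF ρ' hρ' ρ hρ φ := by
  intro ω
  obtain ⟨c, rfl⟩ := hgen ω
  refine ⟨F c • x ^ (p - 1) • D _ _ x, ?_, ?_⟩
  · rw [kaehlerMap_smul_D, hb, D_pow_natCast_char, smul_comm]
  · rw [kaehlerMap_smul_D, hφ, kaehlerMap_smul, kaehlerMap_smul_D, map_pow]

end Abstract

theorem isDividedFrobenius_U (hn : (n : k) ≠ 0)
    {φ : Ω[UBar n ((f.map (W1.sigma p k)).map (W1.red p k))⁄k] →+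
      Ω[UBar n (f.map (W1.red p k))⁄k]}
    (hφ : ∀ c : UBar n ((f.map (W1.sigma p k)).map (W1.red p k)), φ (c • D k _ (UBar.t n _)) =
      relFrobU (map_red_sigma f) c • UBar.t n (f.map (W1.red p k)) ^ (p - 1) •
        D k _ (UBar.t n _)) :
    IsDividedFrobenius (frobU f hn) (frobU_comp f hn) (UBar.map (W1.red p k) rfl)
      (UBar.map_comp _ _) (UBar.map (W1.red p k) rfl) (UBar.map_comp _ _) φ := by
  refine isDividedFrobenius_of_smul_D (UBar.exists_eq_smul_D (W1.isUnit_natCast hn))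
    (frobU_t hn) fun c => ?_
  rw [UBar.map_t, UBar.map_t, hφ, frobU_red]

theorem isDividedFrobenius_V {v w : k[X]} (hv : FrobVRel n r f v w)
    {φ : Ω[VRing n r ((f.map (W1.sigma p k)).map (W1.red p k))⁄k] →+
      Ω[VRing n r (f.map (W1.red p k))⁄k]}
    (hφ : ∀ (a : VRing n r ((f.map (W1.sigma p k)).map (W1.red p k))) ω,
      φ (a • ω) = relFrobV r (map_red_sigma f) a • φ ω)
    (hs : φ (D k _ (VRing.s n _ r)) = aeval (VRing.s n (f.map (W1.red p k)) r)
      (X ^ (p - 1) + derivative v) • D k _ (VRing.s n _ r))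
    (hz : φ (D k _ (VRing.z n _ r)) = VRing.z n (f.map (W1.red p k)) r ^ (p - 1) •
      D k _ (VRing.z n _ r) + (VRing.z n (f.map (W1.red p k)) r ^ p *
        aeval (VRing.s n (f.map (W1.red p k)) r) (derivative w)) • D k _ (VRing.s n _ r)) :
    IsDividedFrobenius (frobV hv) (frobV_comp hv) (VRing.map r (W1.red p k) rfl)
      (VRing.map_comp r _ _) (VRing.map r (W1.red p k) rfl) (VRing.map_comp r _ _) φ := by
  have hsm : ∀ a ω, φ (VRing.map r (W1.red p k) rfl a • ω) =
      VRing.map r (W1.red p k) rfl (frobV hv a) • φ ω := fun a ω => by rw [hφ, frobV_red]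
  refine isDividedFrobenius_of_D hsm (Plane.induction
    (DividesFrobeniusAt.const (frobV_comp hv) (VRing.map_comp r _ _) φ) ?_ ?_
    (fun x y hx hy => hx.add hy) (fun x y hx hy => DividesFrobeniusAt.mul hsm hx hy))
  · refine DividesFrobeniusAt.of_eq (frobV_s hv) ?_
    change φ (D k _ (VRing.map r (W1.red p k) rfl (VRing.s n _ r))) = _
    rw [VRing.map_s, hs, VRing.map_s, VRing.map_aeval, map_teichLift, Derivation.map_aeval,
      ← add_smul, map_add, map_pow (aeval _), aeval_X]
  · refine DividesFrobeniusAt.of_eq (e := aeval (VRing.s n f r) (teichLift p k w) * VRing.z n f r ^ p)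
      ((frobV_z hv).trans (by rw [mul_assoc])) ?_
    change φ (D k _ (VRing.map r (W1.red p k) rfl (VRing.z n _ r))) = _
    rw [VRing.map_z, hz, VRing.map_z, map_mul, map_pow, VRing.map_z, VRing.map_aeval, map_teichLift,
      Derivation.leibniz, D_pow_char, Derivation.map_aeval, smul_zero, zero_add, smul_smul]

/-- The condition of a Frobenius difference at the function `b`. -/
def FrobDiffAt (p : ℕ) {k A' A B' B : Type*} [Field k] [CommRing A'] [CommRing A] [CommRing B']
    [CommRing B] [Algebra k B'] (GU GV : A' →+* A) (ρ' : A' →+* B') (ρ : A →+* B)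
    (h : Ω[B'⁄k] →+ B) (b : A') : Prop :=
  ∃ e : A, GU b - GV b = (p : A) * e ∧ h (D k B' (ρ' b)) = ρ e

section FrobDiff

variable {A' A B' B : Type*} [CommRing A'] [CommRing A] [CommRing B'] [CommRing B]
  [Algebra k B'] {GU GV : A' →+* A} {ρ' : A' →+* B'} {ρ : A →+* B} {h : Ω[B'⁄k] →+ B}

omit [CharP k p] [PerfectRing k p] [Fact p.Prime]

theorem FrobDiffAt.add {x y : A'} (hx : FrobDiffAt p GU GV ρ' ρ h x)
    (hy : FrobDiffAt p GU GV ρ' ρ h y) : FrobDiffAt p GU GV ρ' ρ h (x + y) := by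
  obtain ⟨e, h1, h2⟩ := hx
  obtain ⟨e', h1', h2'⟩ := hy
  exact ⟨e + e', by rw [map_add, map_add]; linear_combination h1 + h1',
    by rw [map_add, map_add, map_add, map_add, h2, h2']⟩

theorem FrobDiffAt.of_eq_zero {x : A'} (hx : GU x = GV x) (h0 : D k B' (ρ' x) = 0) :
    FrobDiffAt p GU GV ρ' ρ h x :=
  ⟨0, by rw [hx, sub_self, mul_zero], by rw [h0, map_zero, map_zero]⟩

variable (hsm : ∀ a ω, h (ρ' a • ω) = ρ (GU a) * h ω) (hUV : ∀ x, ρ (GU x) = ρ (GV x))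
include hsm hUV

/-- `F_U(x y) - F_V(x y)` equals `F_U(x) (F_U(y) - F_V(y)) + (F_U(x) - F_V(x)) F_V(y)`. As `F_U` and
`F_V` agree modulo `p`, the quotient by `p` obeys the Leibniz rule twisted by Frobenius. -/
theorem FrobDiffAt.mul {x y : A'} (hx : FrobDiffAt p GU GV ρ' ρ h x)
    (hy : FrobDiffAt p GU GV ρ' ρ h y) : FrobDiffAt p GU GV ρ' ρ h (x * y) := by
  obtain ⟨e, h1, h2⟩ := hx
  obtain ⟨e', h1', h2'⟩ := hy
  refine ⟨GU x * e' + e * GV y,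
    by rw [map_mul, map_mul]; linear_combination GU x * h1' + GV y * h1, ?_⟩
  rw [map_mul ρ', Derivation.leibniz, map_add, hsm, hsm, h2, h2', map_add, map_mul, map_mul, hUV y]
  ring

theorem FrobDiffAt.of_mul_eq_one {x y : A'} (hxy : x * y = 1)
    (hx : FrobDiffAt p GU GV ρ' ρ h x) : FrobDiffAt p GU GV ρ' ρ h y := by
  obtain ⟨e, h1, h2⟩ := hx
  have hUx : GU x * GU y = 1 := by rw [← map_mul, hxy, map_one]
  have hVx : GV x * GV y = 1 := by rw [← map_mul, hxy, map_one]
  refine ⟨-(GU y * GV y * e),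
    by linear_combination GV y * hUx - GU y * hVx - GU y * GV y * h1, ?_⟩
  rw [derivation_of_mul_eq_one (t := ρ' x) (t' := ρ' y) _ (by rw [← map_mul, hxy, map_one]),
    ← map_pow, ← map_neg, hsm, h2]
  simp only [map_neg, map_pow, map_mul, ← hUV y]
  ring

theorem FrobDiffAt.pow {x : A'} (hx : FrobDiffAt p GU GV ρ' ρ h x) (m : ℕ) :
    FrobDiffAt p GU GV ρ' ρ h (x ^ m) := by
  induction m with
  | zero => rw [pow_zero]; exact .of_eq_zero (by rw [map_one, map_one]) (by rw [map_one, Derivation.map_one_eq_zero])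
  | succ m ih => rw [pow_succ]; exact ih.mul hsm hUV hx

theorem FrobDiffAt.aeval {R : Type*} [CommRing R] [Algebra R A'] {x : A'}
    (hc : ∀ c, FrobDiffAt p GU GV ρ' ρ h (algebraMap R A' c))
    (hx : FrobDiffAt p GU GV ρ' ρ h x) (q : R[X]) :
    FrobDiffAt p GU GV ρ' ρ h (aeval x q) := by
  induction q using Polynomial.induction_on' with
  | add p q hp hq => rw [map_add]; exact hp.add hq
  | monomial m a => rw [aeval_monomial]; exact (hc a).mul hsm hUV (hx.pow hsm hUV m)

/-- If `F_U(x) = F_V(x) + p a`, then `F_U(x ^ n) - F_V(x ^ n) = p n F_V(x) ^ (n - 1) a`. Comparison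
with the value of `h` at `d(x ^ n)` determines `h(dx)`, because `n` and the image of `x` are
invertible. For `x = y` this avoids computing the difference of the lifts at `y`. -/
theorem FrobDiffAt.of_pow {x : A'} {n : ℕ} {m : B} (hn : 1 ≤ n) (hm : (n : B) * m = 1)
    (hp2 : (p : A) ^ 2 = 0) (hflat : ∀ e : A, (p : A) * e = 0 → ρ e = 0) (hu : IsUnit (GU x))
    {a : A} (ha : GU x - GV x = p * a) (hx : FrobDiffAt p GU GV ρ' ρ h (x ^ n)) :
    FrobDiffAt p GU GV ρ' ρ h x := by
  refine ⟨a, ha, ?_⟩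
  obtain ⟨e, h2, h3⟩ := hx
  have h1 : GU x = GV x + p * a := by linear_combination ha
  have h4 : (GV x + p * a) ^ n = GV x ^ n + n * GV x ^ (n - 1) * (p * a) := by
    have h6 := aeval_add_of_sq_eq_zero (R := ℤ) (X ^ n) (GV x) ((p : A) * a)
      (by rw [mul_pow, hp2, zero_mul])
    simpa only [map_pow, aeval_X, derivative_X_pow, map_mul, aeval_C, map_natCast] using h6
  have h5 : (p : A) * (e - n * GV x ^ (n - 1) * a) = 0 := by
    rw [map_pow, map_pow, h1] at h2
    linear_combination h4 - h2
  have h7 := hflat _ h5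
  rw [map_sub, sub_eq_zero] at h7
  rw [map_pow, Derivation.leibniz_pow, map_nsmul, ← map_pow, hsm, h7, map_mul, map_mul, map_natCast,
    map_pow, map_pow, map_pow, ← hUV, nsmul_eq_mul] at h3
  have h8 : (n : B) * ρ (GU x) ^ (n - 1) * (h (D k B' (ρ' x)) - ρ a) = 0 := by
    linear_combination h3
  have hun : IsUnit ((n : B) * ρ (GU x) ^ (n - 1)) :=
    (IsUnit.of_mul_eq_one m hm).mul ((hu.map ρ).pow _)
  exact sub_eq_zero.1 (hun.mul_right_eq_zero.1 h8)

end FrobDiff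

/-- The property passes to sums, products and inverses, so constants, `t` and `y` suffice. It holds
at `t` by the choice of `h`, hence at `f(t) = y ^ n`, hence at `y`. -/
theorem isFrobeniusDifference_of_lifts (hn : 1 ≤ n) (hnk : (n : k) ≠ 0)
    (hf0 : f.map (W1.red p k) ≠ 0)
    {GU GV : UV n (f.map (W1.sigma p k)) →+* UV n f}
    (hU : IsFrobeniusLift GU) (hV : IsFrobeniusLift GV) {e₀ : UV n f}
    (he : GU (UV.t n _) - GV (UV.t n _) = p * e₀)
    {h : Ω[UV n ((f.map (W1.sigma p k)).map (W1.red p k))⁄k] →+ UV n (f.map (W1.red p k))}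
    (hh : ∀ c : UV n ((f.map (W1.sigma p k)).map (W1.red p k)), h (c • D k _ (UV.t n _)) =
      relFrobUV (map_red_sigma f) c * UV.map (W1.red p k) rfl e₀) :
    IsFrobeniusDifference (p := p) GU GV (UV.map (W1.red p k) rfl) (UV.map (W1.red p k) rfl) h := by
  have hUV : ∀ x, UV.map (W1.red p k) rfl (GU x) = UV.map (W1.red p k) rfl (GV x) := fun x => by
    rw [hU.red, hV.red]
  have hsm : ∀ a ω, h (UV.map (W1.red p k) rfl a • ω) =
      UV.map (W1.red p k) rfl (GU a) * h ω := fun a ω => by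
    obtain ⟨c, rfl⟩ := UV.exists_eq_smul_D hnk.isUnit ω
    rw [smul_smul, hh, hh, map_mul, mul_assoc, hU.red]
  have hconst : ∀ c : W1 p k, FrobDiffAt p GU GV (UV.map (W1.red p k) rfl)
      (UV.map (W1.red p k) rfl) h (algebraMap _ _ c) := fun c => by
    refine .of_eq_zero ((RingHom.congr_fun hU.comp c).trans (RingHom.congr_fun hV.comp c).symm) ?_
    have h1 : UV.map (n := n) (f := f.map (W1.sigma p k)) (W1.red p k) rfl (algebraMap _ _ c) =
      algebraMap k _ (W1.red p k c) := RingHom.congr_fun (UV.map_comp _ rfl) c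
    rw [h1, Derivation.map_algebraMap]
  have ht : FrobDiffAt p GU GV (UV.map (W1.red p k) rfl)
      (UV.map (W1.red p k) rfl) h (UV.t n _) := by
    refine ⟨e₀, he, ?_⟩
    have := hh 1
    rwa [one_smul, map_one, one_mul, ← UV.map_t (W1.red p k) rfl] at this
  have hy : FrobDiffAt p GU GV (UV.map (W1.red p k) rfl)
      (UV.map (W1.red p k) rfl) h (UV.y n _) := by
    obtain ⟨a, ha⟩ := hU.dvd_y
    obtain ⟨b, hb⟩ := hV.dvd_y
    have hm : (n : UV n (f.map (W1.red p k))) * algebraMap k _ (n : k)⁻¹ = 1 := by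
      rw [← map_natCast (algebraMap k (UV n (f.map (W1.red p k)))), ← map_mul, mul_inv_cancel₀ hnk,
        map_one]
    refine .of_pow hsm hUV hn hm (natCast_sq_eq_zero (k := k) _)
      (fun e => UV.map_red_eq_zero hn hf0) (UV.isUnit_y.map GU) (a := a - b)
      (by linear_combination ha - hb) ?_
    rw [UV.rel]
    exact ht.aeval hsm hUV hconst _
  exact ⟨hsm, UV.induction hconst ht (ht.of_mul_eq_one hsm hUV UV.t_mul_tInv) hy
    (hy.of_mul_eq_one hsm hUV UV.y_mul_yInv) (fun _ _ hx hy => FrobDiffAt.add hx hy)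
    (fun _ _ hx hy => FrobDiffAt.mul hsm hUV hx hy)⟩

end Frob

/-! ### The Deligne–Illusie morphism -/

section Cocycle

variable {p : ℕ} [Fact p.Prime] {k : Type*} [Field k] [CharP k p] {n r : ℕ} {g g' : k[X]}
  (hg : g' = g.map (frobenius k p))

/-- From `dt = - t ² ds` one finds `φ_V(dt) = - t ^ (2 p) (s ^ (p - 1) + v') ds = (t ^ (p - 1) + t ^
(2 p - 2) v'(1/t)) dt` on the overlap. -/
theorem resΩV_phiV (hd : g.natDegree ≤ r * n) (hd' : g'.natDegree ≤ r * n) (hn : 1 ≤ n)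
    (hnk : (n : k) ≠ 0) (hc' : IsCoprime (infPoly n r g') (derivative (infPoly n r g'))) {v : k[X]}
    {φV : Ω[VRing n r g'⁄k] →ₗ[k] Ω[VRing n r g⁄k]}
    (hsm : ∀ (a : VRing n r g') ω, φV (a • ω) = relFrobV r hg a • φV ω)
    (hs : φV (D k _ (VRing.s n g' r)) = aeval (VRing.s n g r) (X ^ (p - 1) + derivative v) •
      D k _ (VRing.s n g r)) {ω : Ω[VRing n r g'⁄k]} {C : UV n g'}
    (hω : resΩV n r g' hd' ω = C • D k _ (UV.t n g')) :
    resΩV n r g hd (φV ω) = (relFrobUV hg C * (UV.t n g ^ (p - 1) + UV.t n g ^ (2 * p) *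
      UV.tInv n g ^ 2 * aeval (UV.tInv n g) (derivative v))) • D k _ (UV.t n g) := by
  have hp : 1 ≤ p := (Fact.out : p.Prime).one_lt.le
  obtain ⟨b, rfl⟩ := VRing.exists_eq_smul_formZ hc' hn hnk ω
  rw [resΩV_smul, resΩV_formZ hd' hc' hn, smul_smul] at hω
  have hC := UV.smul_D_injective hnk.isUnit hω
  obtain ⟨ψ, hψ⟩ := UV.exists_eq_smul_D hnk.isUnit (resΩV n r g hd (φV (formZ hc')))
  -- Only `φ_V(ds)` is given. Applying `φ_V` to `z ^ (n - 1) • formZ hc' = ds` and cancelling the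
  -- unit `z ^ (p (n - 1))` on the overlap yields its value at the generator.
  have h1 := congrArg (fun x => resΩV n r g hd (φV x)) (formZ_spec hn hc')
  simp only [hsm, hs, resΩV_smul, resΩV_D, hψ, map_pow, relFrobV_z, resV_z, resV_s, resV_aeval,
    D_tInv, smul_smul] at h1
  have h2 := UV.smul_D_injective hnk.isUnit h1
  rw [hsm, resΩV_smul, ← relFrobUV_resV hg hd hd', hψ, smul_smul, ← hC]
  congr 1
  simp only [map_mul, map_neg, map_pow, relFrobUV_t, relFrobUV_tInv, relFrobUV_yInv, map_add,
    aeval_X] at h2 ⊢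
  have h3 := congrArg (· ^ ((n - 1) * (p * r) + p)) (UV.t_mul_tInv (n := n) (f := g))
  have h4 := congrArg (· ^ (p * (n - 1))) (UV.y_mul_yInv (n := n) (f := g))
  have h5 := congrArg (· ^ (p * r * (n - 1))) (UV.t_mul_tInv (n := n) (f := g))
  have h6 := congrArg (· ^ (p - 1)) (UV.t_mul_tInv (n := n) (f := g))
  have h7 := congrArg (· ^ (2 * p)) (UV.t_mul_tInv (n := n) (f := g))
  have h8 := UV.t_mul_tInv (n := n) (f := g)
  simp only [one_pow, mul_pow] at h3 h4 h5 h6 h7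
  set t := UV.t n g
  set t' := UV.tInv n g
  set y := UV.y n g
  set y' := UV.yInv n g
  set B := relFrobUV hg (resV n g' r hd' b)
  set A := aeval t' (derivative v)
  have hZ : ((t' ^ r * y) ^ p) ^ (n - 1) * ((t ^ p) ^ r * y' ^ p) ^ (n - 1) = 1 := by
    have : ((t' ^ r * y) ^ p) ^ (n - 1) * ((t ^ p) ^ r * y' ^ p) ^ (n - 1) =
      (t ^ (p * r * (n - 1)) * t' ^ (p * r * (n - 1))) * (y ^ (p * (n - 1)) * y' ^ (p * (n - 1))) := by
      ring
    rw [this, h5, h4, one_mul]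
  have hψ' : ψ = -(((t ^ p) ^ r * y' ^ p) ^ (n - 1) * (t' ^ (p - 1) + A) * t' ^ 2) := by
    linear_combination ((t ^ p) ^ r * y' ^ p) ^ (n - 1) * h2 - ψ * hZ
  have h9 : (t' ^ p) ^ 2 * t ^ (p - 1) = t' ^ (p - 1) * t' ^ 2 := by
    obtain ⟨e, rfl⟩ : ∃ e, p = e + 1 := ⟨p - 1, by omega⟩
    rw [Nat.add_sub_cancel] at h6 ⊢
    linear_combination (t' ^ e * t' ^ 2) * h6
  rw [hψ']
  linear_combination B * ((t ^ p) ^ r * y' ^ p) ^ (n - 1) * h9 +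
    B * ((t ^ p) ^ r * y' ^ p) ^ (n - 1) * A * t' ^ 2 * h7

variable (n r) in
/-- Explicit formulas for the divided Frobenius on the two open sets and for the difference. -/
structure IsFrobeniusData (v w : k[X]) (φU : Ω[UBar n g'⁄k] →ₗ[k] Ω[UBar n g⁄k])
    (φV : Ω[VRing n r g'⁄k] →ₗ[k] Ω[VRing n r g⁄k]) (h : Ω[UV n g'⁄k] →ₗ[k] UV n g) : Prop where
  apply_U : ∀ c : UBar n g', φU (c • D k _ (UBar.t n g')) =
    relFrobU hg c • UBar.t n g ^ (p - 1) • D k _ (UBar.t n g)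
  smul_V : ∀ (a : VRing n r g') ω, φV (a • ω) = relFrobV r hg a • φV ω
  D_s : φV (D k _ (VRing.s n g' r)) = aeval (VRing.s n g r) (X ^ (p - 1) + derivative v) •
    D k _ (VRing.s n g r)
  D_z : φV (D k _ (VRing.z n g' r)) = VRing.z n g r ^ (p - 1) • D k _ (VRing.z n g r) +
    (VRing.z n g r ^ p * aeval (VRing.s n g r) (derivative w)) • D k _ (VRing.s n g r)
  apply_UV : ∀ c : UV n g', h (c • D k _ (UV.t n g')) =
    relFrobUV hg c * (aeval (UV.tInv n g) v * UV.t n g ^ (2 * p))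

theorem exists_isFrobeniusData (hn : 1 ≤ n) (hnk : (n : k) ≠ 0)
    (hc : IsCoprime (infPoly n r g) (derivative (infPoly n r g))) {v w : k[X]}
    (hv : derivative (infPoly n r g) ^ p * (X ^ (p - 1) + derivative v) =
      infPoly n r g ^ (p - 1) * derivative (infPoly n r g) +
        (n : k[X]) * derivative w * infPoly n r g ^ p) :
    ∃ φU φV h, IsFrobeniusData n r hg v w φU φV h := by
  obtain ⟨φU, hU⟩ := exists_phiU (n := n) hg hnk
  obtain ⟨φV, hsm, hs, hz⟩ := exists_phiV hg hn hnk hc hv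
  obtain ⟨h, hh⟩ := exists_frobDiff (n := n) hg hnk (aeval (UV.tInv n g) v * UV.t n g ^ (2 * p))
  exact ⟨φU, φV, h, hU, hsm, hs, hz, hh⟩

theorem resΩU_phiU {φU : Ω[UBar n g'⁄k] →ₗ[k] Ω[UBar n g⁄k]}
    (hU : ∀ c : UBar n g', φU (c • D k _ (UBar.t n g')) =
      relFrobU hg c • UBar.t n g ^ (p - 1) • D k _ (UBar.t n g)) (c : UBar n g') :
    resΩU n g (φU (c • D k _ (UBar.t n g'))) =
      (relFrobUV hg (resU n g' c) * UV.t n g ^ (p - 1)) • D k _ (UV.t n g) := by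
  rw [hU, smul_smul, resΩU_smul_D, map_mul, map_pow, resU_t, ← relFrobUV_resU]

theorem D_relFrobUV_mul (c : UV n g') (v : k[X]) :
    D k _ (relFrobUV hg c * (aeval (UV.tInv n g) v * UV.t n g ^ (2 * p))) =
      -(relFrobUV hg c * (UV.t n g ^ (2 * p) * UV.tInv n g ^ 2 *
        aeval (UV.tInv n g) (derivative v))) • D k _ (UV.t n g) := by
  have h1 : D k _ (UV.t n g ^ (2 * p)) = 0 := by rw [pow_mul, D_pow_char]
  rw [Derivation.leibniz, D_relFrobUV, smul_zero, add_zero, Derivation.leibniz, h1,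
    Derivation.map_aeval, smul_zero, zero_add, D_tInv, smul_smul, smul_smul, smul_smul]
  congr 1
  ring

/-- On the overlap `φ_V - φ_U` is multiplication of `dt` by `t ^ (2 p - 2) v'(1/t)` times a
Frobenius image. The differential of the function component is its negative, because only `v(1/t)`
contributes. -/
theorem IsFrobeniusData.mem_ker (hd : g.natDegree ≤ r * n) (hd' : g'.natDegree ≤ r * n) (hn : 1 ≤ n)
    (hnk : (n : k) ≠ 0) (hc' : IsCoprime (infPoly n r g') (derivative (infPoly n r g'))) {v w : k[X]}
    {φU φV h} (H : IsFrobeniusData n r hg v w φU φV h)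
    {ω : Ω[UBar n g'⁄k] × Ω[VRing n r g'⁄k]} (hω : ω ∈ H0Ω n r g' hd') :
    (φU ω.1, φV ω.2, h (resΩU n _ ω.1)) ∈ LinearMap.ker (cechD1 n r g hd) := by
  obtain ⟨ω₁, ω₂⟩ := ω
  have hω' : resΩU n g' ω₁ = resΩV n r g' hd' ω₂ := hω
  change resΩV n r g hd (φV ω₂) - resΩU n g (φU ω₁) + D k _ (h (resΩU n g' ω₁)) = 0
  obtain ⟨c, rfl⟩ := UBar.exists_eq_smul_D hnk.isUnit ω₁
  rw [resΩU_smul_D] at hω'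
  have h1 := resΩV_phiV hg hd hd' hn hnk hc' H.smul_V H.D_s hω'.symm
  have h2 : D k _ (h (resΩU n g' (c • D k _ (UBar.t n g')))) = _ :=
    (congrArg _ ((congrArg h (resΩU_smul_D c)).trans (H.apply_UV _))).trans
      (D_relFrobUV_mul hg (resU n g' c) v)
  rw [h1, resΩU_phiU hg H.apply_U, h2, ← sub_smul, ← add_smul]
  convert zero_smul (UV n g) _ using 2
  ring

end Cocycle

/-! ### Existence and uniqueness of the Deligne–Illusie morphism. -/

section Existence

theorem exists_linearMap_hasClass {k : Type*} [Field k] {n r : ℕ} {M : Type*} [AddCommGroup M]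
    [Module k M] {g : k[X]} (hd : g.natDegree ≤ r * n) (ψ : M →ₗ[k] CechTriple n r g)
    (hψ : ∀ x, ψ x ∈ LinearMap.ker (cechD1 n r g hd)) :
    ∃ Φ : M →ₗ[k] H1dR n r g hd, ∀ x, HasClass hd (ψ x) (Φ x) :=
  ⟨Submodule.mkQ _ ∘ₗ LinearMap.codRestrict _ ψ hψ, fun x => ⟨hψ x, rfl⟩⟩

variable {p : ℕ} [Fact p.Prime] {k : Type*} [Field k] [CharP k p] {n r : ℕ}

theorem IsFrobeniusData.exists_hasClass {g g' : k[X]} {hg : g' = g.map (frobenius k p)}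
    (hd : g.natDegree ≤ r * n) (hd' : g'.natDegree ≤ r * n) (hn : 1 ≤ n)
    (hnk : (n : k) ≠ 0) (hc' : IsCoprime (infPoly n r g') (derivative (infPoly n r g'))) {v w : k[X]}
    {φU φV h} (H : IsFrobeniusData n r hg v w φU φV h) :
    ∃ Φ' : H0Ω n r g' hd' →ₗ[k] H1dR n r g hd,
      ∀ ω, HasClass hd (φU ω.1.1, φV ω.1.2, h (resΩU n _ ω.1.1)) (Φ' ω) :=
  exists_linearMap_hasClass hd
    ((φU ∘ₗ LinearMap.fst k _ _ ∘ₗ (H0Ω n r g' hd').subtype).prod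
      ((φV ∘ₗ LinearMap.snd k _ _ ∘ₗ Submodule.subtype _).prod
        (h ∘ₗ resΩU n _ ∘ₗ LinearMap.fst k _ _ ∘ₗ Submodule.subtype _)))
    (fun ω => H.mem_ker hg hd hd' hn hnk hc' ω.2)

variable [PerfectRing k p] {f : (W1 p k)[X]}

theorem isCoprime_infPoly_sigma
    (hc : IsCoprime (infPoly n r (f.map (W1.red p k))) (derivative (infPoly n r (f.map (W1.red p k))))) :
    IsCoprime (infPoly n r ((f.map (W1.sigma p k)).map (W1.red p k)))
      (derivative (infPoly n r ((f.map (W1.sigma p k)).map (W1.red p k)))) := by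
  rw [infPoly_map r _ (map_red_sigma f), derivative_map]
  exact hc.map (mapRingHom (frobenius k p))

theorem IsFrobeniusData.isFrobeniusDifference (hn : 1 ≤ n) (hnk : (n : k) ≠ 0)
    (hf0 : f.map (W1.red p k) ≠ 0) {v w : k[X]} {φU φV h}
    (H : IsFrobeniusData n r (map_red_sigma f) v w φU φV h)
    {GU GV : UV n (f.map (W1.sigma p k)) →+* UV n f}
    (hU : IsFrobeniusLift GU) (hV : IsFrobeniusLift GV) (hUt : GU (UV.t n _) = UV.t n f ^ p)
    (hVt : GV (UV.t n _) = frobVt n f v) :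
    IsFrobeniusDifference (p := p) GU GV (UV.map (W1.red p k) rfl) (UV.map (W1.red p k) rfl)
      h.toAddMonoidHom := by
  refine isFrobeniusDifference_of_lifts hn hnk hf0 hU hV
    (e₀ := aeval (UV.tInv n f) (teichLift p k v) * UV.t n f ^ (2 * p)) ?_ fun c => ?_
  · rw [hUt, hVt, frobVt, sub_sub_cancel]
  · refine (H.apply_UV c).trans ?_
    rw [map_mul, UV.map_aeval_tInv, map_teichLift, map_pow, UV.map_t]

theorem IsFrobeniusData.isDeligneIllusie (hf : f.natDegree ≤ r * n) (hn : 1 ≤ n) (hnk : (n : k) ≠ 0)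
    (hf0 : f.map (W1.red p k) ≠ 0) {v w : k[X]} (hv : FrobVRel n r f v w) {φU φV h}
    (H : IsFrobeniusData n r (map_red_sigma f) v w φU φV h) {Φ'}
    (hΦ : ∀ ω, HasClass (natDegree_red_le hf) (φU ω.1.1, φV ω.1.2, h (resΩU n _ ω.1.1)) (Φ' ω)) :
    IsDeligneIllusie f hf hnk hv Φ' := by
  obtain ⟨GU, hGU, hGU', hGUt⟩ := exists_extU (f := f) hnk
  obtain ⟨GV, hGV, hGV', hGVt⟩ := exists_extV hf hv
  exact ⟨φU.toAddMonoidHom, φV.toAddMonoidHom, h.toAddMonoidHom, GU, GV,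
    isDividedFrobenius_U hnk H.apply_U, isDividedFrobenius_V hv H.smul_V H.D_s H.D_z, hGU, hGV,
    H.isFrobeniusDifference hn hnk hf0 hGU' hGV' hGUt hGVt, hΦ⟩

-- All auxiliary data are determined: the extensions of the lifts by their restrictions, and the
-- maps on forms by surjectivity of reduction together with flatness. Hence so is the class attached
-- to each form.
set_option maxHeartbeats 800000 in
theorem IsDeligneIllusie.unique (hf : f.natDegree ≤ r * n) (hn : 1 ≤ n) (hnk : (n : k) ≠ 0)
    (ht : IsCoprime X (f.map (W1.red p k)))
    (hc : IsCoprime (infPoly n r (f.map (W1.red p k))) (derivative (infPoly n r (f.map (W1.red p k)))))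
    {v w : k[X]} {hv : FrobVRel n r f v w} {Φ₁ Φ₂}
    (h₁ : IsDeligneIllusie f hf hnk hv Φ₁) (h₂ : IsDeligneIllusie f hf hnk hv Φ₂) : Φ₁ = Φ₂ := by
  have hf0 : f.map (W1.red p k) ≠ 0 := fun h => ne_zero_of_isCoprime_X ht (by rw [h, coeff_zero])
  obtain ⟨φU, φV, h, GU, GV, hU, hV, hGU, hGV, hh, H⟩ := h₁
  obtain ⟨φU₂, φV₂, h₂, GU₂, GV₂, hU₂, hV₂, hGU₂, hGV₂, hh₂, H₂⟩ := h₂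
  obtain rfl : GU₂ = GU := UV.hom_ext_resU (hGU₂.trans hGU.symm)
  obtain rfl : GV₂ = GV := UV.hom_ext_resV (natDegree_sigma_le hf) (hGV₂.trans hGV.symm)
  obtain rfl := hU₂.unique (UBar.map_surjective W1.red_surjective rfl)
    (fun η => UBar.kaehlerMap_red_eq_zero hn hnk ht) hU
  obtain rfl := hV₂.unique (VRing.map_surjective r W1.red_surjective rfl)
    (fun η => VRing.kaehlerMap_red_eq_zero hf hn hnk ht hc) hV
  obtain rfl := hh₂.unique (UV.map_surjective W1.red_surjective rfl)
    (fun e => UV.map_red_eq_zero hn hf0) hh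
  exact LinearMap.ext fun ω => (H ω).unique _ (H₂ ω)

end Existence

/-! ### Laurent polynomials as functions on `t y ≠ 0` -/

section LaurentPoly

open scoped LaurentPolynomial

variable {k : Type*} [Field k]

theorem coeff_mul_T (L : k[T;T⁻¹]) (a q : ℤ) :
    (L * LaurentPolynomial.T a).coeff q = L.coeff (q - a) := by
  refine (AddMonoidAlgebra.coeff_mul_single_eq_coeff_mul (m₁ := q) (q - a) fun m' _ => ?_).trans
    (mul_one _)
  omega

theorem coeff_C_mul_T (c : k) (a q : ℤ) :
    (LaurentPolynomial.C c * LaurentPolynomial.T a).coeff q = if q = a then c else 0 := by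
  rw [coeff_mul_T, LaurentPolynomial.C_apply]
  simp only [sub_eq_zero]

theorem coeff_toLaurent_int (P : k[X]) (q : ℤ) :
    (toLaurent P).coeff q = if 0 ≤ q then P.coeff q.toNat else 0 := by
  induction P using Polynomial.induction_on' with
  | add A B hA hB =>
    rw [map_add, AddMonoidAlgebra.coeff_add, Finsupp.add_apply, hA, hB, coeff_add]
    split_ifs <;> simp
  | monomial m c =>
    rw [← C_mul_X_pow_eq_monomial, toLaurent_C_mul_X_pow, coeff_C_mul_T, coeff_C_mul_X_pow]
    split_ifs <;> first | rfl | omega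

/-- The source of the factors `IP[κ] v[p (i + 2) + κ + m]`, with `N = p (i + 2)` and `P = IP`. -/
theorem coeff_shift_invert_mul (N m : ℕ) (v P : k[X]) :
    (LaurentPolynomial.T N * LaurentPolynomial.invert (toLaurent v) * toLaurent P).coeff (-m) =
      ∑ κ ∈ Finset.range (P.natDegree + 1), P.coeff κ * v.coeff (N + κ + m) := by
  conv_lhs => rw [P.as_sum_range_C_mul_X_pow]
  rw [map_sum, Finset.mul_sum, AddMonoidAlgebra.coeff_sum, Finsupp.finsetSum_apply]
  refine Finset.sum_congr rfl fun κ _ => ?_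
  have h : LaurentPolynomial.T (N : ℤ) * LaurentPolynomial.invert (toLaurent v) *
      toLaurent (C (P.coeff κ) * X ^ κ) = P.coeff κ •
        (LaurentPolynomial.invert (toLaurent v) * LaurentPolynomial.T ((N + κ : ℕ) : ℤ)) := by
    rw [toLaurent_C_mul_X_pow, LaurentPolynomial.smul_eq_C_mul, Nat.cast_add, LaurentPolynomial.T_add]
    ring
  rw [h, AddMonoidAlgebra.coeff_smul, Finsupp.smul_apply, smul_eq_mul, coeff_mul_T,
    LaurentPolynomial.invert_apply, coeff_toLaurent_int, if_pos (by omega)]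
  congr 2
  omega

/-- The cutoff of the polar part may be any large number, so that it can later be taken beyond `r (n
- b)` and the degree of `v`. -/
theorem exists_eq_toLaurent_add (L : k[T;T⁻¹]) : ∃ (P : k[X]) (M : ℕ), ∀ M' ≥ M,
    L = toLaurent P + ∑ m ∈ Finset.Icc 1 M',
      LaurentPolynomial.C (L.coeff (-m)) * LaurentPolynomial.T (-(m : ℤ)) := by
  induction L using LaurentPolynomial.induction_on' with
  | add A B hA hB =>
    obtain ⟨P, M, h⟩ := hA
    obtain ⟨P', M', h'⟩ := hB
    refine ⟨P + P', max M M', fun N hN => ?_⟩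
    conv_lhs => rw [h N (le_trans (le_max_left _ _) hN), h' N (le_trans (le_max_right _ _) hN)]
    simp only [AddMonoidAlgebra.coeff_add, Finsupp.add_apply, map_add, add_mul,
      Finset.sum_add_distrib]
    ring
  | C_mul_T q c =>
    rcases le_or_gt 0 q with hq | hq
    · lift q to ℕ using hq
      refine ⟨C c * X ^ q, 0, fun N _ => ?_⟩
      rw [toLaurent_C_mul_X_pow, Finset.sum_eq_zero, add_zero]
      intro m hm
      rw [Finset.mem_Icc] at hm
      rw [coeff_C_mul_T, if_neg (by omega), map_zero, zero_mul]
    · obtain ⟨e, rfl⟩ : ∃ e : ℕ, q = -e := ⟨q.natAbs, by omega⟩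
      refine ⟨0, e, fun N hN => ?_⟩
      rw [map_zero, zero_add, Finset.sum_eq_single e]
      · rw [coeff_C_mul_T, if_pos rfl]
      · intro m _ hm
        rw [coeff_C_mul_T, if_neg (by omega), map_zero, zero_mul]
      · intro h
        rw [Finset.mem_Icc] at h
        omega

variable (n : ℕ) (f : k[X])

/-- Laurent polynomials in `t`, as functions on `t y ≠ 0`. -/
noncomputable def UV.ofLaurent : k[T;T⁻¹] →+* UV n f :=
  LaurentPolynomial.eval₂ (algebraMap k _) ⟨UV.t n f, UV.tInv n f, UV.t_mul_tInv, UV.tInv_mul_t⟩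

variable {n f}

theorem UV.ofLaurent_C (c : k) : UV.ofLaurent n f (LaurentPolynomial.C c) = algebraMap k _ c :=
  LaurentPolynomial.eval₂_C ..

theorem UV.ofLaurent_T (m : ℕ) : UV.ofLaurent n f (LaurentPolynomial.T m) = UV.t n f ^ m :=
  LaurentPolynomial.eval₂_T_n ..

theorem UV.ofLaurent_T_neg (m : ℕ) :
    UV.ofLaurent n f (LaurentPolynomial.T (-(m : ℤ))) = UV.tInv n f ^ m :=
  LaurentPolynomial.eval₂_T_neg_n ..

theorem UV.ofLaurent_toLaurent (P : k[X]) :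
    UV.ofLaurent n f (Polynomial.toLaurent P) = aeval (UV.t n f) P :=
  LaurentPolynomial.eval₂_toLaurent ..

theorem UV.ofLaurent_invert (P : k[X]) :
    UV.ofLaurent n f (LaurentPolynomial.invert (Polynomial.toLaurent P)) = aeval (UV.tInv n f) P := by
  induction P using Polynomial.induction_on' with
  | add A B hA hB => rw [map_add, map_add, map_add, map_add, hA, hB]
  | monomial m c =>
    rw [← C_mul_X_pow_eq_monomial, toLaurent_C_mul_X_pow, map_mul, LaurentPolynomial.invert_C,
      LaurentPolynomial.invert_T, map_mul, map_mul, UV.ofLaurent_C, UV.ofLaurent_T_neg, aeval_C,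
      map_pow, aeval_X]

theorem coeff_eval₂_laurentT (L : k[T;T⁻¹]) (q : ℤ) :
    (LaurentPolynomial.eval₂ (algebraMap k (LaurentSeries k)) ⟨laurentT k, laurentTInv k,
      laurentT_mul_inv, (mul_comm _ _).trans laurentT_mul_inv⟩ L).coeff q = L.coeff q := by
  induction L using LaurentPolynomial.induction_on' with
  | add A B hA hB =>
    rw [map_add, HahnSeries.coeff_add, hA, hB, AddMonoidAlgebra.coeff_add, Finsupp.add_apply]
  | C_mul_T m c =>
    rw [coeff_C_mul_T]
    rcases le_or_gt 0 m with hm | hm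
    · lift m to ℕ using hm
      rw [LaurentPolynomial.eval₂_C_mul_T_n, laurent_algebraMap, HahnSeries.C_apply]
      change (HahnSeries.single (0 : ℤ) c * HahnSeries.single (1 : ℤ) (1 : k) ^ m).coeff q = _
      rw [HahnSeries.single_pow, HahnSeries.single_mul_single, HahnSeries.coeff_single]
      simp
    · obtain ⟨m, rfl⟩ : ∃ e : ℕ, m = -e := ⟨m.natAbs, by omega⟩
      rw [LaurentPolynomial.eval₂_C_mul_T_neg_n, laurent_algebraMap, HahnSeries.C_apply]
      change (HahnSeries.single (0 : ℤ) c * HahnSeries.single (-1 : ℤ) (1 : k) ^ m).coeff q = _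
      rw [HahnSeries.single_pow, HahnSeries.single_mul_single, HahnSeries.coeff_single]
      simp

theorem UV.coeff_coord_ofLaurent (hn : 1 ≤ n) (ht : IsCoprime X f) (L : k[T;T⁻¹]) {j : ℕ}
    (hj : j < n) (q : ℤ) :
    (UV.coord hn ht j (UV.ofLaurent n f L * UV.y n f ^ j)).coeff q = L.coeff q := by
  set E := LaurentPolynomial.eval₂ (algebraMap k (LaurentSeries k)) ⟨laurentT k, laurentTInv k,
      laurentT_mul_inv, (mul_comm _ _).trans laurentT_mul_inv⟩ with hE
  have h1 : UV.toLaurent hn ht (UV.ofLaurent n f L) = AdjoinRoot.of _ (E L) := by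
    induction L using LaurentPolynomial.induction_on' with
    | add A B hA hB => simp only [map_add, hA, hB]
    | C_mul_T m c =>
      have hc : UV.toLaurent hn ht (algebraMap k _ c) =
          AdjoinRoot.of _ (algebraMap k (LaurentSeries k) c) :=
        RingHom.congr_fun (f := (UV.toLaurent hn ht).comp (algebraMap k (UV n f)))
          (g := algebraMap k (LaurentModel n f)) (UV.lift_comp ..) c
      rw [map_mul, map_mul, map_mul, map_mul, UV.ofLaurent_C, hc, hE, LaurentPolynomial.eval₂_C]
      congr 1
      rcases le_or_gt 0 m with hm | hm
      · lift m to ℕ using hm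
        rw [UV.ofLaurent_T, LaurentPolynomial.eval₂_T_n, map_pow, map_pow, UV.toLaurent_t]
      · obtain ⟨m, rfl⟩ : ∃ e : ℕ, m = -e := ⟨m.natAbs, by omega⟩
        rw [UV.ofLaurent_T_neg, LaurentPolynomial.eval₂_T_neg_n, map_pow, map_pow, UV.toLaurent_tInv]
        rfl
  have h2 := UV.coord_eq_of_toLaurent hn ht (a := 1) (c := fun i => if i = j then E L else 0)
    (x := UV.ofLaurent n f L * UV.y n f ^ j) (by
      rw [map_one, one_mul, map_mul, map_pow, h1, UV.toLaurent_y, Finset.sum_eq_single j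
        (fun b _ hb => by rw [if_neg hb, map_zero, zero_mul]) (by simp [hj]), if_pos rfl]) hj
  rw [one_mul, if_pos rfl] at h2
  rw [h2, coeff_eval₂_laurentT]

/-- A function `L(t) y ^ (-b)` which is regular on `y ≠ 0` has no polar terms at `t = 0`. -/
theorem UV.coeff_eq_zero_of_resU (hn : 1 ≤ n) (ht : IsCoprime X f) {L : k[T;T⁻¹]} {b : ℕ}
    (hb : 1 ≤ b) (hbn : b ≤ n) {u : UBar n f}
    (h : UV.ofLaurent n f L * UV.yInv n f ^ b = resU n f u) {q : ℤ} (hq : q < 0) :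
    L.coeff q = 0 := by
  rw [← UV.coeff_coord_ofLaurent hn ht L (j := n - b) (by omega)]
  -- Multiplication by `y ^ n` moves `y ^ (-b)` into the range of exponents where coordinates are
  -- read, and keeps the function regular on `y ≠ 0`.
  have h1 : UV.ofLaurent n f L * UV.y n f ^ (n - b) = resU n f (u * UBar.y n f ^ n) := by
    have h2 := congrArg (· ^ b) (UV.y_mul_yInv (n := n) (f := f))
    simp only [mul_pow, one_pow] at h2
    obtain ⟨e, rfl⟩ : ∃ e, n = b + e := ⟨n - b, by omega⟩
    rw [map_mul, ← h, map_pow, resU_y, Nat.add_sub_cancel_left]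
    linear_combination (-(UV.ofLaurent (b + e) f L * UV.y (b + e) f ^ e)) * h2
  rw [h1]
  exact UV.coeff_coord_resU hn ht _ (by omega) hq

end LaurentPoly

/-! ### The function component and the forms `d h_{i,j}`, `α^V` as Laurent polynomials in `t`. -/

section Expansions

open scoped LaurentPolynomial

variable {k : Type*} [Field k] {n r : ℕ} {f : k[X]}

/-- The Laurent polynomial `t ^ N v(1/t) P(t)`. -/
noncomputable def shiftL (N : ℕ) (v P : k[X]) : k[T;T⁻¹] :=
  LaurentPolynomial.T N * LaurentPolynomial.invert (toLaurent v) * toLaurent P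

theorem t_pow_mul_aeval_tInv (v : k[X]) {E : ℕ} (hE : v.natDegree ≤ E) :
    UV.t n f ^ E * aeval (UV.tInv n f) v = aeval (UV.t n f) (reflect E v) := by
  let _ : Invertible (UV.tInv n f) := ⟨UV.t n f, UV.t_mul_tInv, UV.tInv_mul_t⟩
  have h := eval₂_reflect_mul_pow (algebraMap k (UV n f)) (UV.tInv n f) E v hE
  have h2 : ⅟(UV.tInv n f) = UV.t n f := rfl
  have h3 := congrArg (· ^ E) (UV.t_mul_tInv (n := n) (f := f))
  simp only [mul_pow, one_pow] at h3
  rw [h2, ← aeval_def, ← aeval_def] at h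
  rw [← h]
  linear_combination aeval (UV.t n f) (reflect E v) * h3

/-- Here `y ^ (-M) = f ^ (-(a + 1)) y ^ j`. Replacing `f ^ (-(a + 1))` by `I ^ (a + 1)` costs a
multiple of `t ^ (d + 1)`, `d` being the truncated difference `deg v - 2 p`. As `N ≥ 2 p`, the pole
of `t ^ N v(1/t)` at `t = 0` has order at most `d`, so the error is regular on `y ≠ 0`. -/
theorem exists_add_sum_hFun {p N M a j : ℕ} {v I : k[X]}
    (hI : X ^ (v.natDegree - 2 * p + 1) ∣ f * I - 1) (hN : 2 * p ≤ N) (hM : M + j = (a + 1) * n) :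
    ∃ (A : UBar n f) (B : ℕ), ∀ B' ≥ B, UV.t n f ^ N * aeval (UV.tInv n f) v * UV.yInv n f ^ M =
      resU n f A + ∑ m ∈ Finset.Icc 1 B', (shiftL N v (I ^ (a + 1))).coeff (-m) • hFun n f m j := by
  obtain ⟨P, B, hP⟩ := exists_eq_toLaurent_add (shiftL N v (I ^ (a + 1)))
  obtain ⟨c, hc⟩ : X ^ (v.natDegree - 2 * p + 1) ∣ (f * I) ^ (a + 1) - 1 ^ (a + 1) :=
    hI.trans (sub_dvd_pow_sub_pow _ _ _)
  -- With this exponent `E ≥ deg v`, so `t ^ E v(1/t)` is the polynomial `reflect E v`.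
  set E := N + (v.natDegree - 2 * p + 1) with hE
  -- The polynomial part of the expansion, minus the error `t ^ E v(1/t) c f ^ (-(a + 1)) y ^ j`,
  -- where `(f I) ^ (a + 1) - 1 = t ^ (d + 1) c`.
  refine ⟨aeval (UBar.t n f) P * UBar.y n f ^ j - aeval (UBar.t n f) (reflect E v * c) *
    UBar.yInv n f ^ ((a + 1) * n) * UBar.y n f ^ j, B, fun B' hB => ?_⟩
  have h1 := congrArg (UV.ofLaurent n f) (hP B' hB)
  rw [map_add, map_sum, UV.ofLaurent_toLaurent, shiftL, map_mul, map_mul, UV.ofLaurent_T,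
    UV.ofLaurent_invert, UV.ofLaurent_toLaurent] at h1
  have h2 : ∑ m ∈ Finset.Icc 1 B', (shiftL N v (I ^ (a + 1))).coeff (-m) • hFun n f m j =
      (∑ m ∈ Finset.Icc 1 B', UV.ofLaurent n f (LaurentPolynomial.C
        ((shiftL N v (I ^ (a + 1))).coeff (-m)) * LaurentPolynomial.T (-(m : ℤ)))) * UV.y n f ^ j := by
    rw [Finset.sum_mul]
    refine Finset.sum_congr rfl fun m _ => ?_
    rw [map_mul, UV.ofLaurent_C, UV.ofLaurent_T_neg, hFun, Algebra.smul_def, mul_assoc]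
  rw [← shiftL] at h1
  rw [h2, map_sub, map_mul, map_mul, map_mul, map_pow, map_pow, resU_aeval, resU_aeval, resU_y,
    resU_yInv, map_mul, ← t_pow_mul_aeval_tInv v (E := E) (by omega)]
  have h3 := congrArg (aeval (UV.t n f)) hc
  rw [one_pow, map_sub, map_one, map_mul, mul_pow, map_mul, map_pow, ← UV.rel, map_pow, map_pow, aeval_X] at h3
  rw [map_pow] at h1
  have h4 : (UV.y n f ^ n) ^ (a + 1) * UV.yInv n f ^ ((a + 1) * n) = 1 := by
    rw [← pow_mul, mul_comm n, ← mul_pow, UV.y_mul_yInv, one_pow]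
  have h5 : UV.yInv n f ^ M = UV.yInv n f ^ ((a + 1) * n) * UV.y n f ^ j := by
    have h6 := congrArg (· ^ j) (UV.y_mul_yInv (n := n) (f := f))
    simp only [mul_pow, one_pow] at h6
    rw [← hM, pow_add]
    linear_combination (-(UV.yInv n f ^ M)) * h6
  rw [h5, hE, pow_add]
  generalize (∑ m ∈ Finset.Icc 1 B', UV.ofLaurent n f (LaurentPolynomial.C
        ((shiftL N v (I ^ (a + 1))).coeff (-m)) * LaurentPolynomial.T (-(m : ℤ)))) = S at h1 ⊢
  generalize UV.yInv n f ^ ((a + 1) * n) = Y at *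
  generalize aeval (UV.tInv n f) v = V at *
  linear_combination (UV.y n f ^ j) * h1 - (UV.t n f ^ N * V * Y * UV.y n f ^ j) * h3 +
    (UV.t n f ^ N * V * UV.y n f ^ j * aeval (UV.t n f) I ^ (a + 1)) * h4

/-- `d h_{i,j}` without its factor `y ^ (j - n) dt`. -/
noncomputable def dhL (n : ℕ) (f : k[X]) (i j : ℕ) : k[T;T⁻¹] :=
  toLaurent (dhPoly n f i j) * LaurentPolynomial.T (-((i + 1 : ℕ) : ℤ))

/-- The polar part of `dhL`. -/
noncomputable def alphaL (n : ℕ) (f : k[X]) (i j : ℕ) : k[T;T⁻¹] :=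
  ∑ m ∈ Finset.range (i + 1), LaurentPolynomial.C ((dhPoly n f i j).coeff m) *
    LaurentPolynomial.T (-((i + 1 - m : ℕ) : ℤ))

theorem coeff_dhL (i j : ℕ) (q : ℤ) : (dhL n f i j).coeff q =
    if 0 ≤ q + (i + 1) then (dhPoly n f i j).coeff (q + (i + 1)).toNat else 0 := by
  rw [dhL, coeff_mul_T, coeff_toLaurent_int, sub_neg_eq_add, Nat.cast_add, Nat.cast_one]

theorem coeff_alphaL (i j : ℕ) (q : ℤ) : (alphaL n f i j).coeff q =
    if q < 0 then (dhL n f i j).coeff q else 0 := by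
  rw [alphaL, AddMonoidAlgebra.coeff_sum, Finsupp.finsetSum_apply, coeff_dhL]
  simp only [coeff_C_mul_T]
  by_cases h : q < 0 ∧ 0 ≤ q + (i + 1)
  · rw [if_pos h.1, if_pos h.2, Finset.sum_eq_single (q + (i + 1)).toNat]
    · rw [if_pos (by omega)]
    · intro m hm hne
      rw [Finset.mem_range] at hm
      rw [if_neg (by omega)]
    · intro hm
      rw [Finset.mem_range] at hm
      omega
  · rw [Finset.sum_eq_zero]
    · split_ifs <;> first | rfl | omega
    · intro m hm
      rw [Finset.mem_range] at hm
      rw [if_neg (by omega)]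

theorem D_hFun_eq (hnk : (n : k) ≠ 0) (i : ℕ) {b : ℕ} (hb : 1 ≤ b) (hbn : b + 1 ≤ n) :
    D k _ (hFun n f i (n - b)) =
      (UV.ofLaurent n f (dhL n f i (n - b)) * UV.yInv n f ^ b) • D k _ (UV.t n f) := by
  rw [D_hFun hnk i (by omega) (by omega), dhL, map_mul, UV.ofLaurent_toLaurent, UV.ofLaurent_T_neg]
  congr 1
  obtain ⟨e, rfl⟩ : ∃ e, n = b + e + 1 := ⟨n - b - 1, by omega⟩
  have e1 : b + e + 1 - b - 1 = e := by omega
  have h6 := congrArg (· ^ e) (UV.y_mul_yInv (n := b + e + 1) (f := f))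
  simp only [mul_pow, one_pow] at h6
  rw [e1, Nat.add_sub_cancel, pow_add _ b e]
  linear_combination (aeval (UV.t (b + e + 1) f) (dhPoly (b + e + 1) f i (b + e + 1 - b)) *
    UV.tInv (b + e + 1) f ^ (i + 1) * UV.yInv (b + e + 1) f ^ b) * h6

theorem resΩV_alphaV_eq (hf : f.natDegree ≤ r * n)
    (h : IsCoprime (infPoly n r f) (derivative (infPoly n r f))) (hnk : (n : k) ≠ 0) (hr : 1 ≤ r)
    (i : ℕ) {b : ℕ} (hb : 1 ≤ b) (hbn : b + 1 ≤ n) :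
    resΩV n r f hf (alphaV h i (n - b)) =
      (UV.ofLaurent n f (alphaL n f i (n - b)) * UV.yInv n f ^ b) • D k _ (UV.t n f) := by
  rw [resΩV_alphaV hf h (by omega) hr i (by omega) (by omega), alphaL, map_sum]
  simp only [map_mul, UV.ofLaurent_C, UV.ofLaurent_T_neg, coeff_dhPoly hnk, Algebra.smul_def]
  congr 1
  obtain ⟨e, rfl⟩ : ∃ e, n = b + e + 1 := ⟨n - b - 1, by omega⟩
  have e1 : b + e + 1 - b - 1 = e := by omega
  have h6 := congrArg (· ^ e) (UV.y_mul_yInv (n := b + e + 1) (f := f))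
  simp only [mul_pow, one_pow] at h6
  rw [e1, Nat.add_sub_cancel, pow_add _ b e, mul_assoc]
  congr 1
  linear_combination (UV.yInv (b + e + 1) f ^ b) * h6

theorem resΩV_omegaForm (hf : f.natDegree ≤ r * n)
    (h : IsCoprime (infPoly n r f) (derivative (infPoly n r f))) {i j : ℕ} (hj : j + 1 ≤ n)
    (hi : i + 2 ≤ r * j) : resΩV n r f hf (omegaForm h i j).2 =
      (UV.ofLaurent n f (LaurentPolynomial.T i) * UV.yInv n f ^ j) • D k _ (UV.t n f) := by
  have h1 : resΩU n f (omegaForm h i j).1 = resΩV n r f hf (omegaForm h i j).2 :=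
    omegaForm_mem hf h hj hi
  rw [← h1, omegaForm, resΩU_smul_D, map_mul, map_pow, map_pow, resU_t, resU_yInv, UV.ofLaurent_T]

end Expansions

/-! ### Comparison of coefficients. -/

section Identity

open scoped LaurentPolynomial

variable {k : Type*} [Field k] {n r : ℕ} {f : k[X]}

theorem coeff_T_mul_invert (N q : ℤ) (Q : k[X]) :
    (LaurentPolynomial.T N * LaurentPolynomial.invert (toLaurent Q)).coeff q = coeffInt Q (N - q) := by
  rw [mul_comm, coeff_mul_T, LaurentPolynomial.invert_apply, coeff_toLaurent_int, neg_sub, coeffInt]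

theorem coeff_sum_smul {ι : Type*} (S : Finset ι) (g : ι → k) (L : ι → k[T;T⁻¹]) (q : ℤ) :
    (∑ m ∈ S, g m • L m).coeff q = ∑ m ∈ S, g m * (L m).coeff q := by
  rw [AddMonoidAlgebra.coeff_sum, Finsupp.finsetSum_apply]
  rfl

theorem coeff_dhL_nat (hnk : (n : k) ≠ 0) {b : ℕ} (hbn : b ≤ n) (m μ : ℕ) :
    (dhL n f m (n - b)).coeff μ =
      ((n : k) * (μ + 1) - b * (μ + m + 1)) / n * f.coeff (μ + m + 1) := by
  rw [coeff_dhL, if_pos (by positivity), coeff_dhPoly hnk]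
  have e : ((μ : ℤ) + (m + 1)).toNat = μ + m + 1 := by omega
  rw [e, Nat.cast_sub hbn]
  congr 2
  push_cast
  ring

/-- In negative degrees `alphaL` and `dhL` agree, so the left side is the expression of `hneg` and
vanishes. In non-negative degrees `alphaL` vanishes, leaving `Q` and the `dhL` with `m ≥ r (n - b)`.
-/
theorem laurent_identity (hnk : (n : k) ≠ 0) (hl : f.natDegree < r * n) {b : ℕ} (hbn : b ≤ n)
    {N : ℤ} (hN : N + 2 ≤ r * b) (Q : k[X]) (g : ℕ → k) {E : ℕ} (hJ : 1 ≤ r * (n - b))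
    (hE : r * (n - b) ≤ E)
    (hneg : ∀ q < 0, (LaurentPolynomial.T N * LaurentPolynomial.invert (toLaurent Q) +
      ∑ m ∈ Finset.Ico 1 E, g m • dhL n f m (n - b)).coeff q = 0) :
    LaurentPolynomial.T N * LaurentPolynomial.invert (toLaurent Q) +
      ∑ m ∈ Finset.Ico 1 (r * (n - b)), g m • alphaL n f m (n - b) +
      ∑ m ∈ Finset.Ico (r * (n - b)) E, g m • dhL n f m (n - b) =
    ∑ μ ∈ Finset.range (r * b - 1), (∑ m ∈ Finset.Ico (r * (n - b)) E,
      g m * (((n : k) * (μ + 1) - b * (μ + m + 1)) / n * f.coeff (μ + m + 1)) +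
        coeffInt Q (N - μ)) • LaurentPolynomial.T (μ : ℤ) := by
  refine LaurentPolynomial.ext fun q => ?_
  simp only [AddMonoidAlgebra.coeff_add, Finsupp.add_apply, coeff_sum_smul, coeff_T_mul_invert,
    coeff_alphaL, LaurentPolynomial.T_apply] at hneg ⊢
  rcases lt_or_ge q 0 with hq | hq
  · have h1 := hneg q hq
    rw [← Finset.sum_Ico_consecutive _ hJ hE, ← add_assoc] at h1
    simp only [if_pos hq]
    rw [h1, Finset.sum_eq_zero]
    intro μ _
    rw [if_neg (by omega), mul_zero]
  · lift q to ℕ using hq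
    simp only [if_neg (not_lt.2 (Int.natCast_nonneg q)), mul_zero, Finset.sum_const_zero, add_zero,
      coeff_dhL_nat hnk hbn]
    by_cases hq' : q < r * b - 1
    · refine ((Finset.sum_eq_single_of_mem q (Finset.mem_range.2 hq') fun μ _ hμ => ?_).trans
        ?_).symm
      · rw [if_neg (by omega), mul_zero]
      · rw [if_pos rfl, mul_one, add_comm]
    -- No terms remain in degree `q ≥ r b - 1`: there `N - q` is negative, and `q + m + 1 ≥ r b + r
    -- (n - b) = r n` exceeds the degree of `f`.
    · have hrb : r * b + r * (n - b) = r * n := by rw [← mul_add]; congr 1; omega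
      rw [coeffInt, if_neg (by omega), zero_add, Finset.sum_eq_zero,
        Finset.sum_eq_zero]
      · intro μ hμ
        rw [Finset.mem_range] at hμ
        rw [if_neg (by omega), mul_zero]
      · intro m hm
        rw [Finset.mem_Ico] at hm
        rw [coeff_eq_zero_of_natDegree_lt (by omega), mul_zero, mul_zero]

/-- Terms beyond the upper bound vanish because the index of `v` exceeds its degree. When the
subtraction truncates to zero the inner sum must be empty, and it is because `J ≥ 1`. -/
theorem sum_shiftL_mul {p i J E : ℕ} {v P : k[X]} (hJ : 1 ≤ J) (hE : v.natDegree < E) (x : ℕ → k) :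
    ∑ m ∈ Finset.Ico J E, (shiftL (p * (i + 2)) v P).coeff (-m) * x m =
      ∑ κ ∈ Finset.range (P.natDegree + 1),
        ∑ m ∈ Finset.Icc J (v.natDegree - 2 * p - (p * i + κ)),
          P.coeff κ * v.coeff (p * (i + 2) + κ + m) * x m := by
  simp only [shiftL, coeff_shift_invert_mul, Finset.sum_mul]
  rw [Finset.sum_comm]
  refine Finset.sum_congr rfl fun κ _ => (Finset.sum_subset (fun m hm => ?_) fun m hm hm' => ?_).symm
  · rw [Finset.mem_Icc] at hm
    rw [Finset.mem_Ico]
    omega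
  · rw [Finset.mem_Ico] at hm
    rw [Finset.mem_Icc] at hm'
    have e : p * (i + 2) = p * i + 2 * p := by ring
    have hv : v.coeff (p * (i + 2) + κ + m) = 0 :=
      coeff_eq_zero_of_natDegree_lt (by rw [e]; omega)
    rw [hv, mul_zero, zero_mul]

theorem sum_smul_ofLaurent {ι M : Type*} [AddCommGroup M] [Module k M] [Module (UV n f) M]
    [IsScalarTower k (UV n f) M] (S : Finset ι) (g : ι → k) (L : ι → k[T;T⁻¹]) (y : UV n f) (δ : M) :
    ∑ m ∈ S, g m • (UV.ofLaurent n f (L m) * y) • δ =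
      (UV.ofLaurent n f (∑ m ∈ S, g m • L m) * y) • δ := by
  rw [map_sum, Finset.sum_mul, Finset.sum_smul]
  refine Finset.sum_congr rfl fun m _ => ?_
  rw [LaurentPolynomial.smul_eq_C_mul, map_mul, UV.ofLaurent_C, mul_assoc,
    ← Algebra.smul_def, smul_assoc]

end Identity

/-! ### The `V`-component of the Frobenius class and the polynomial `Q`. -/

section Decomposition

open scoped LaurentPolynomial

variable {p : ℕ} [Fact p.Prime] {k : Type*} [Field k] [CharP k p] {n r : ℕ} {f f' : k[X]}
  {hg : f' = f.map (frobenius k p)}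

theorem UV.aeval_tInv_infPoly (hf : f.natDegree ≤ r * n) :
    aeval (UV.tInv n f) (infPoly n r f) = (UV.tInv n f ^ r * UV.y n f) ^ n := by
  rw [resV_rel r hf, aeval_def]

/-- Write `y ^ (-p j) = y ^ (-a n) y ^ (-b)` with `y ^ n = t ^ (r n) f₂(1/t)`. The factor `f₂ ^ a`
of `s ^ (p - 1) + v'` cancels, leaving `t` to the power `p (i + 2) - 2 - r n a`, which is the stated
exponent since `p j = a n + b`. -/
theorem ofLaurent_Q (hf : f.natDegree ≤ r * n) {a b i j : ℕ} (hab : p * j = a * n + b)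
    {v Q : k[X]} (hQ : infPoly n r f ^ a * Q = X ^ (p - 1) + derivative v) :
    (UV.t n f ^ p) ^ i * (UV.yInv n f ^ p) ^ j * (UV.t n f ^ (p - 1) + UV.t n f ^ (2 * p) *
      UV.tInv n f ^ 2 * aeval (UV.tInv n f) (derivative v)) =
    UV.ofLaurent n f (LaurentPolynomial.T ((r : ℤ) * b - 2 + p * ((i : ℤ) + 2 - r * j)) *
      LaurentPolynomial.invert (toLaurent Q)) * UV.yInv n f ^ b := by
  have hp : 1 ≤ p := (Fact.out : p.Prime).one_lt.le
  have hN : (r : ℤ) * b - 2 + p * ((i : ℤ) + 2 - r * j) =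
      (p * (i + 2) : ℕ) + -((2 + r * n * a : ℕ) : ℤ) := by
    have h1 : (p : ℤ) * j = a * n + b := by exact_mod_cast hab
    push_cast
    linear_combination (-(r : ℤ)) * h1
  rw [hN, LaurentPolynomial.T_add, map_mul, map_mul, UV.ofLaurent_T, UV.ofLaurent_T_neg,
    UV.ofLaurent_invert]
  have h1 := congrArg (aeval (UV.tInv n f)) hQ
  rw [map_mul, map_pow, UV.aeval_tInv_infPoly hf, map_add, map_pow, aeval_X] at h1
  have h2 := congrArg (· ^ (a * n)) (UV.y_mul_yInv (n := n) (f := f))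
  have h3 := congrArg (· ^ (p + 1)) (UV.t_mul_tInv (n := n) (f := f))
  simp only [mul_pow, one_pow] at h2 h3
  rw [← pow_mul, ← pow_mul, hab, pow_add _ (a * n) b]
  obtain ⟨e, rfl⟩ : ∃ e, p = e + 1 := ⟨p - 1, by omega⟩
  rw [Nat.add_sub_cancel] at h1 ⊢
  set t := UV.t n f
  set t' := UV.tInv n f
  set y := UV.y n f
  set Y := UV.yInv n f
  set A := aeval t' (derivative v)
  set q := aeval t' Q
  linear_combination (-(t ^ ((e + 1) * (i + 2)) * t' ^ 2 * Y ^ b * Y ^ (a * n))) * h1 +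
    (t ^ ((e + 1) * (i + 2)) * t' ^ (2 + r * n * a) * q * Y ^ b) * h2 -
    (t ^ ((e + 1) * i) * Y ^ (a * n) * Y ^ b * t ^ e) * h3

end Decomposition

/-! ### Hodge components of a cocycle given by Laurent polynomials. -/

section Decomposition

open scoped LaurentPolynomial

variable {k : Type*} [Field k] {n r : ℕ} {f : k[X]} (hf : f.natDegree ≤ r * n)

theorem eq_add_of_sub_add_add_eq_zero {M : Type*} [AddCommGroup M] {v u a s : M}
    (h : v - u + (a + s) = 0) : u - a = v + s := by
  rw [← sub_eq_zero, ← neg_eq_zero, ← h]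
  abel

theorem add_neg_add_of_eq_neg {M : Type*} [AddCommGroup M] {a s z w : M} (h : w = -z) :
    a + -s + w = a - s - z := by
  rw [h]
  abel

theorem zero_add_add_sub_of_eq_neg {M : Type*} [AddCommGroup M] {a s z w : M} (h : w = -z) :
    0 + s + (a - w) = a + (s + z) := by
  rw [h]
  abel

theorem ofLaurent_add_mul_smul {M : Type*} [AddCommGroup M] [Module (UV n f) M] (L₁ L₂ : k[T;T⁻¹])
    (y : UV n f) (δ : M) : (UV.ofLaurent n f (L₁ + L₂) * y) • δ =
      (UV.ofLaurent n f L₁ * y) • δ + (UV.ofLaurent n f L₂ * y) • δ := by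
  rw [map_add, add_mul, add_smul]

theorem resΩU_D (c : UBar n f) : resΩU n f (D k _ c) = D k _ (resU n f c) := kaehlerMap_D ..

theorem cechD0_mem_ker (x : UBar n f × VRing n r f) :
    cechD0 n r f hf x ∈ LinearMap.ker (cechD1 n r f hf) := by
  change resΩV n r f hf (D k _ x.2) - resΩU n f (D k _ x.1) +
    D k _ (resU n f x.1 - resV n f r hf x.2) = 0
  rw [resΩV_D, resΩU_D, map_sub]
  abel

/-- The form on `y ≠ 0` is determined by the other two components, so cocycles need only be compared
on `V` and in their functions. -/
theorem eq_of_mem_ker_of_snd_eq (hn : 1 ≤ n) (hnk : (n : k) ≠ 0) (ht : IsCoprime X f)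
    {x y : CechTriple n r f} (hx : x ∈ LinearMap.ker (cechD1 n r f hf))
    (hy : y ∈ LinearMap.ker (cechD1 n r f hf)) (h : x.2 = y.2) : x = y := by
  have hx' : resΩV n r f hf x.2.1 - resΩU n f x.1 + D k _ x.2.2 = 0 := hx
  have hy' : resΩV n r f hf y.2.1 - resΩU n f y.1 + D k _ y.2.2 = 0 := hy
  refine Prod.ext (resΩU_injective hn hnk ht ?_) h
  rw [h] at hx'
  have h1 := hx'.trans hy'.symm
  simpa using h1

/-- By the cocycle condition the restriction of `ω_U - dA` is `ω_V + ∑ g_m d h_m`, so the latter has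
no polar terms at `t = 0`. -/
theorem coeff_eq_zero_of_mem_ker (hn : 1 ≤ n) (hnk : (n : k) ≠ 0) (ht : IsCoprime X f) {b : ℕ}
    (hb : 1 ≤ b) (hbn : b + 1 ≤ n) {x : CechTriple n r f}
    (hx : x ∈ LinearMap.ker (cechD1 n r f hf)) {L : k[T;T⁻¹]}
    (hV : resΩV n r f hf x.2.1 = (UV.ofLaurent n f L * UV.yInv n f ^ b) • D k _ (UV.t n f))
    {S : Finset ℕ} {g : ℕ → k} {A : UBar n f}
    (hH : x.2.2 = resU n f A + ∑ m ∈ S, g m • hFun n f m (n - b)) {q : ℤ} (hq : q < 0) :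
    (L + ∑ m ∈ S, g m • dhL n f m (n - b)).coeff q = 0 := by
  have hx' : resΩV n r f hf x.2.1 - resΩU n f x.1 + D k _ x.2.2 = 0 := hx
  obtain ⟨u, hu⟩ := UBar.exists_eq_smul_D hnk.isUnit (x.1 - D k _ A)
  refine UV.coeff_eq_zero_of_resU hn ht hb (by omega) (u := u)
    (UV.smul_D_injective hnk.isUnit ?_) hq
  rw [← resΩU_smul_D, ← hu, map_sub, resΩU_D, map_add, add_mul, add_smul, ← hV,
    ← sum_smul_ofLaurent]
  rw [hH, map_add, map_sum] at hx'
  simp only [Derivation.map_smul, D_hFun_eq hnk _ hb hbn] at hx'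
  exact (eq_add_of_sub_add_add_eq_zero hx').symm

theorem sum_smul_triple {ι R M₁ M₂ M₃ : Type*} [Semiring R] [AddCommGroup M₁] [AddCommGroup M₂]
    [AddCommGroup M₃] [Module R M₁] [Module R M₂] [Module R M₃] (S : Finset ι) (g : ι → R)
    (u : ι → M₁) (v : ι → M₂) (w : ι → M₃) : ∑ m ∈ S, g m • (u m, -v m, w m) =
      (∑ m ∈ S, g m • u m, -∑ m ∈ S, g m • v m, ∑ m ∈ S, g m • w m) := by
  refine Prod.ext ?_ (Prod.ext ?_ ?_) <;> simp [Prod.fst_sum, Prod.snd_sum]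

theorem omegaForm_sum_mem (h : IsCoprime (infPoly n r f) (derivative (infPoly n r f))) {b : ℕ}
    (hbn : b + 1 ≤ n) (γ : ℕ → k) :
    ∑ μ ∈ Finset.range (r * b - 1), γ μ • omegaForm h μ b ∈ H0Ω n r f hf :=
  Submodule.sum_mem _ fun μ hμ => Submodule.smul_mem _ _
    (omegaForm_mem hf h hbn (by rw [Finset.mem_range] at hμ; omega))

theorem resV_sum_smul_pow (J E e : ℕ) (hJ : r * e ≤ J) (g : ℕ → k) :
    resV n f r hf (∑ m ∈ Finset.Ico J E,
      g m • (VRing.s n f r ^ (m - r * e) * VRing.z n f r ^ e)) =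
      ∑ m ∈ Finset.Ico J E, g m • hFun n f m e := by
  rw [map_sum]
  refine Finset.sum_congr rfl fun m hm => ?_
  rw [resV_smul, hFun_eq_resV hf (hJ.trans (Finset.mem_Ico.1 hm).1)]

/-- Restriction of forms from `V` is injective, so the identity of forms reduces to the identity
`hL` of Laurent polynomials. -/
theorem eq_sum_omegaForm_sub_sum_alphaV (h : IsCoprime (infPoly n r f) (derivative (infPoly n r f)))
    (hr : 1 ≤ r) (hnk : (n : k) ≠ 0) (ht : IsCoprime X f) {b : ℕ} (hb : 1 ≤ b)
    (hbn : b + 1 ≤ n) {ω : Ω[VRing n r f⁄k]} {L : k[T;T⁻¹]}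
    (hV : resΩV n r f hf ω = (UV.ofLaurent n f L * UV.yInv n f ^ b) • D k _ (UV.t n f))
    {S₁ S₂ : Finset ℕ} {g γ : ℕ → k}
    (hL : L + ∑ m ∈ S₁, g m • alphaL n f m (n - b) + ∑ m ∈ S₂, g m • dhL n f m (n - b) =
      ∑ μ ∈ Finset.range (r * b - 1), γ μ • LaurentPolynomial.T (μ : ℤ))
    {Z : VRing n r f} (hZ : resV n f r hf Z = ∑ m ∈ S₂, g m • hFun n f m (n - b)) :
    ω = (∑ μ ∈ Finset.range (r * b - 1), γ μ • omegaForm h μ b).2 -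
      ∑ m ∈ S₁, g m • alphaV h m (n - b) - D k _ Z := by
  refine resΩV_injective hf h (by omega) hnk ht ?_
  have h1 : ∑ m ∈ S₁, g m • resΩV n r f hf (alphaV h m (n - b)) =
      (UV.ofLaurent n f (∑ m ∈ S₁, g m • alphaL n f m (n - b)) * UV.yInv n f ^ b) •
        D k _ (UV.t n f) := by
    simp only [resΩV_alphaV_eq hf h hnk hr _ hb hbn]
    exact sum_smul_ofLaurent ..
  have h2 : ∑ m ∈ S₂, g m • D k _ (hFun n f m (n - b)) =
      (UV.ofLaurent n f (∑ m ∈ S₂, g m • dhL n f m (n - b)) * UV.yInv n f ^ b) •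
        D k _ (UV.t n f) := by
    simp only [D_hFun_eq hnk _ hb hbn]
    exact sum_smul_ofLaurent ..
  have h3 : ∑ μ ∈ Finset.range (r * b - 1), γ μ • resΩV n r f hf (omegaForm h μ b).2 =
      (UV.ofLaurent n f (∑ μ ∈ Finset.range (r * b - 1), γ μ • LaurentPolynomial.T (μ : ℤ)) *
        UV.yInv n f ^ b) • D k _ (UV.t n f) := by
    rw [← sum_smul_ofLaurent]
    refine Finset.sum_congr rfl fun μ hμ => ?_
    rw [resΩV_omegaForm hf h hbn (by rw [Finset.mem_range] at hμ; omega)]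
  rw [hV, map_sub, map_sub, resΩV_D, hZ, Prod.snd_sum, map_sum, map_sum, map_sum]
  simp only [map_smul, Derivation.map_smul, Prod.smul_snd]
  rw [h1, h2, h3, ← hL, ofLaurent_add_mul_smul, ofLaurent_add_mul_smul, add_sub_right_comm,
    add_sub_cancel_right, add_sub_cancel_right]

/-- The number `r (n - b)` separates the `h_{m, n-b}` that are basis elements of `H¹(𝒪)`, handled by
`τ`, from those regular on `V`, handled by a coboundary. -/
theorem exists_eq_toH1dR_add (h : IsCoprime (infPoly n r f) (derivative (infPoly n r f)))
    (hn : 1 ≤ n) (hr : 1 ≤ r) (hnk : (n : k) ≠ 0) (ht : IsCoprime X f) {b : ℕ} (hb : 1 ≤ b)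
    (hbn : b + 1 ≤ n) {x : CechTriple n r f} {c : H1dR n r f hf} (hx : HasClass hf x c)
    {L : k[T;T⁻¹]}
    (hV : resΩV n r f hf x.2.1 = (UV.ofLaurent n f L * UV.yInv n f ^ b) • D k _ (UV.t n f))
    {E : ℕ} (hE : r * (n - b) ≤ E) {g : ℕ → k} {A : UBar n f}
    (hH : x.2.2 = resU n f A + ∑ m ∈ Finset.Ico 1 E, g m • hFun n f m (n - b)) {γ : ℕ → k}
    (hL : L + ∑ m ∈ Finset.Ico 1 (r * (n - b)), g m • alphaL n f m (n - b) +
      ∑ m ∈ Finset.Ico (r * (n - b)) E, g m • dhL n f m (n - b) =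
      ∑ μ ∈ Finset.range (r * b - 1), γ μ • LaurentPolynomial.T (μ : ℤ))
    {τ : H1O n r f hf →ₗ[k] H1dR n r f hf} (hτ : IsHodgeSplitting hf h τ) :
    ∃ ξ : H1O n r f hf, c = H0Ω.toH1dR n r f hf
        ⟨∑ μ ∈ Finset.range (r * b - 1), γ μ • omegaForm h μ b, omegaForm_sum_mem hf h hbn γ⟩ +
      τ ξ := by
  have hJ : 1 ≤ r * (n - b) := Nat.mul_pos hr (by omega)
  have hZ := resV_sum_smul_pow hf (r * (n - b)) E (n - b) le_rfl g
  have h2 := eq_sum_omegaForm_sub_sum_alphaV hf h hr hnk ht hb hbn hV hL hZ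
  have hy := HasClass.sum hf (Finset.Ico 1 (r * (n - b)))
    fun m hm => (hτ m (n - b) (by omega) (by omega) (Finset.mem_Ico.1 hm).1
      (by rw [Finset.mem_Ico] at hm; omega)).smul hf (g m)
  rw [sum_smul_triple] at hy
  have hy' := (hasClass_toH1dR hf ⟨_, omegaForm_sum_mem hf h hbn γ⟩).add hf hy
  have hξ : τ (∑ m ∈ Finset.Ico 1 (r * (n - b)),
      g m • Submodule.Quotient.mk (hFun n f m (n - b))) = ∑ m ∈ Finset.Ico 1 (r * (n - b)),
        g m • τ (Submodule.Quotient.mk (hFun n f m (n - b))) :=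
    (_root_.map_sum τ _ _).trans (Finset.sum_congr rfl fun m _ => τ.map_smul _ _)
  refine ⟨_, ((hx.eq_iff hf hy').2 ?_).trans (congrArg _ hξ.symm)⟩
  -- The function component is `A` plus basis terms plus a function `Z` from `V`, so the correcting
  -- coboundary is that of `(A, -Z)`.
  refine ⟨(A, -∑ m ∈ Finset.Ico (r * (n - b)) E,
    g m • (VRing.s n f r ^ (m - r * (n - b)) * VRing.z n f r ^ (n - b))), ?_⟩
  rw [eq_sub_iff_add_eq']
  refine eq_of_mem_ker_of_snd_eq hf hn hnk ht (Submodule.add_mem _ hy'.choose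
    (cechD0_mem_ker hf _)) hx.choose (Prod.ext ?_ ?_)
  · exact (add_neg_add_of_eq_neg (Derivation.map_neg _ _)).trans h2.symm
  · rw [hH, ← Finset.sum_Ico_consecutive _ hJ hE, ← hZ]
    exact zero_add_add_sub_of_eq_neg (RingHom.map_neg (resV n f r hf) _)

theorem exists_add_sum_Ico_hFun {p N M a j : ℕ} {v I : k[X]}
    (hI : X ^ (v.natDegree - 2 * p + 1) ∣ f * I - 1) (hN : 2 * p ≤ N) (hM : M + j = (a + 1) * n)
    (E₀ : ℕ) : ∃ (A : UBar n f) (E : ℕ), E₀ ≤ E ∧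
      UV.t n f ^ N * aeval (UV.tInv n f) v * UV.yInv n f ^ M =
      resU n f A + ∑ m ∈ Finset.Ico 1 E, (shiftL N v (I ^ (a + 1))).coeff (-m) • hFun n f m j := by
  obtain ⟨A, B, hA⟩ := exists_add_sum_hFun hI hN hM
  refine ⟨A, max B E₀ + 1, (le_max_right _ _).trans (Nat.le_succ _), ?_⟩
  rw [hA _ (le_max_left _ _)]
  rfl

theorem shift_add_two_le (b : ℕ) {p i j : ℕ} (hi : i + 2 ≤ r * j) :
    (r : ℤ) * b - 2 + p * ((i : ℤ) + 2 - r * j) + 2 ≤ r * b := by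
  have h1 : ((i + 2 : ℕ) : ℤ) ≤ (r * j : ℕ) := Int.ofNat_le.2 hi
  push_cast at h1
  have h2 := mul_nonpos_of_nonneg_of_nonpos (Int.natCast_nonneg p) (sub_nonpos.2 h1)
  linarith only [h2]

end Decomposition

/-! ### The projection of the Frobenius class to `H⁰(Ω)`. -/

section Frobenius

open scoped LaurentPolynomial

variable {p : ℕ} [Fact p.Prime] {k : Type*} [Field k] [CharP k p] {n r : ℕ} {f f' : k[X]}
  {hg : f' = f.map (frobenius k p)}

theorem fst_symm_eq_of_eq_add {R M N P : Type*} [Semiring R] [AddCommMonoid M] [AddCommMonoid N]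
    [AddCommMonoid P] [Module R M] [Module R N] [Module R P] {e : (M × N) ≃ₗ[R] P} {α : M →ₗ[R] P}
    {β : N →ₗ[R] P} (he : ∀ x y, e (x, y) = α x + β y) {c : P} {x : M} {y : N}
    (h : c = α x + β y) : (e.symm c).1 = x := by
  rw [h, ← he, e.symm_apply_apply]

set_option maxHeartbeats 800000 in
theorem IsFrobeniusData.exists_eq_toH1dR_add (hd : f.natDegree < r * n)
    (hd' : f'.natDegree ≤ r * n) (hn : 1 ≤ n) (hr : 1 ≤ r) (hnk : (n : k) ≠ 0)
    (ht : IsCoprime X f) (hc : IsCoprime (infPoly n r f) (derivative (infPoly n r f)))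
    (hc' : IsCoprime (infPoly n r f') (derivative (infPoly n r f'))) {v w Q I : k[X]} {φU φV h}
    (H : IsFrobeniusData n r hg v w φU φV h) {i j a b : ℕ} (hi : i + 2 ≤ r * j)
    (hab : p * j = a * n + b) (hb : 1 ≤ b) (hbn : b + 1 ≤ n)
    (hQ : infPoly n r f ^ a * Q = X ^ (p - 1) + derivative v)
    (hI : X ^ (v.natDegree - 2 * p + 1) ∣ f * I - 1) {ω : Ω[UBar n f'⁄k] × Ω[VRing n r f'⁄k]}
    (hω : ω ∈ H0Ω n r f' hd')
    (hω' : ω.1 = (UBar.t n f' ^ i * UBar.yInv n f' ^ j) • D k _ (UBar.t n f'))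
    {c : H1dR n r f hd.le} (hcl : HasClass hd.le (φU ω.1, φV ω.2, h (resΩU n _ ω.1)) c)
    {τ : H1O n r f hd.le →ₗ[k] H1dR n r f hd.le} (hτ : IsHodgeSplitting hd.le hc τ) :
    ∃ (η : H0Ω n r f hd.le) (ξ : H1O n r f hd.le), c = H0Ω.toH1dR n r f hd.le η + τ ξ ∧
      (η.1 : Ω[UBar n f⁄k] × Ω[VRing n r f⁄k]) =
        ∑ μ ∈ Finset.range (r * b - 1),
          ((∑ κ ∈ Finset.range ((I ^ (a + 1)).natDegree + 1),
              ∑ m ∈ Finset.Icc (r * (n - b)) (v.natDegree - 2 * p - (p * i + κ)),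
                ((n : k) * (μ + 1) - b * (μ + m + 1)) / n * (I ^ (a + 1)).coeff κ *
                  f.coeff (μ + m + 1) * v.coeff (p * (i + 2) + κ + m)) +
            coeffInt Q ((r : ℤ) * b - 2 + p * ((i : ℤ) + 2 - r * j) - μ)) • omegaForm hc μ b := by
  have hJ : 1 ≤ r * (n - b) := Nat.mul_pos hr (by omega)
  -- `p (i + 2) ≥ 2 p` bounds the pole, and `p j + (n - b) = (a + 1) n`. The cutoff `E` is taken
  -- beyond both `r (n - b)` and `deg v`.
  obtain ⟨A, E, hE, hA⟩ := exists_add_sum_Ico_hFun (n := n) (N := p * (i + 2)) (M := p * j)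
    (j := n - b) (a := a) hI (by rw [mul_comm 2]; exact Nat.mul_le_mul_left _ (by omega))
    (by rw [hab, add_mul]; omega) (r * (n - b) + v.natDegree + 1)
  have hrel : relFrobUV hg (UV.t n f' ^ i * UV.yInv n f' ^ j) =
      (UV.t n f ^ p) ^ i * (UV.yInv n f ^ p) ^ j := by
    rw [map_mul, map_pow, map_pow, relFrobUV_t, relFrobUV_yInv]
  have hres : resΩU n f' ω.1 = (UV.t n f' ^ i * UV.yInv n f' ^ j) • D k _ (UV.t n f') := by
    rw [hω', resΩU_smul_D, map_mul, map_pow, map_pow, resU_t, resU_yInv]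
  have hH : h (resΩU n _ ω.1) =
      resU n f A + ∑ m ∈ Finset.Ico 1 E,
        (shiftL (p * (i + 2)) v (I ^ (a + 1))).coeff (-m) • hFun n f m (n - b) := by
    rw [← hA, hres, H.apply_UV, hrel]
    ring
  have hV : resΩV n r f hd.le (φV ω.2) =
      (UV.ofLaurent n f (LaurentPolynomial.T ((r : ℤ) * b - 2 + p * ((i : ℤ) + 2 - r * j)) *
        LaurentPolynomial.invert (toLaurent Q)) * UV.yInv n f ^ b) • D k _ (UV.t n f) := by
    have h1 : resΩU n f' ω.1 = resΩV n r f' hd' ω.2 := hω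
    rw [resΩV_phiV hg hd.le hd' hn hnk hc' H.smul_V H.D_s (h1.symm.trans hres), hrel,
      ofLaurent_Q hd.le hab hQ]
  obtain ⟨ξ, h1⟩ := Superelliptic.exists_eq_toH1dR_add hd.le hc hn hr hnk ht hb hbn hcl hV
    (by omega) hH (laurent_identity hnk hd (by omega) (shift_add_two_le b hi) Q _ hJ (by omega)
      fun q hq => coeff_eq_zero_of_mem_ker hd.le hn hnk ht hb hbn hcl.choose hV hH hq) hτ
  refine ⟨_, ξ, h1, ?_⟩
  dsimp only
  refine Finset.sum_congr rfl fun μ _ => ?_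
  congr 2
  rw [sum_shiftL_mul hJ (by omega)]
  refine Finset.sum_congr rfl fun κ _ => Finset.sum_congr rfl fun m _ => ?_
  ring

theorem IsFrobeniusData.fst_symm_eq (hd : f.natDegree < r * n)
    (hd' : f'.natDegree ≤ r * n) (hn : 1 ≤ n) (hr : 1 ≤ r) (hnk : (n : k) ≠ 0)
    (ht : IsCoprime X f) (hc : IsCoprime (infPoly n r f) (derivative (infPoly n r f)))
    (hc' : IsCoprime (infPoly n r f') (derivative (infPoly n r f'))) {v w Q I : k[X]} {φU φV h}
    (H : IsFrobeniusData n r hg v w φU φV h) {i j a b : ℕ} (hi : i + 2 ≤ r * j)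
    (hab : p * j = a * n + b) (hb : 1 ≤ b) (hbn : b + 1 ≤ n)
    (hQ : infPoly n r f ^ a * Q = X ^ (p - 1) + derivative v)
    (hI : X ^ (v.natDegree - 2 * p + 1) ∣ f * I - 1) {ω : Ω[UBar n f'⁄k] × Ω[VRing n r f'⁄k]}
    (hω : ω ∈ H0Ω n r f' hd')
    (hω' : ω.1 = (UBar.t n f' ^ i * UBar.yInv n f' ^ j) • D k _ (UBar.t n f'))
    {c : H1dR n r f hd.le} (hcl : HasClass hd.le (φU ω.1, φV ω.2, h (resΩU n _ ω.1)) c)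
    {τ : H1O n r f hd.le →ₗ[k] H1dR n r f hd.le} (hτ : IsHodgeSplitting hd.le hc τ)
    {e : (H0Ω n r f hd.le × H1O n r f hd.le) ≃ₗ[k] H1dR n r f hd.le}
    (he : ∀ ω x, e (ω, x) = H0Ω.toH1dR n r f hd.le ω + τ x) :
    ((e.symm c).1 : Ω[UBar n f⁄k] × Ω[VRing n r f⁄k]) =
        ∑ μ ∈ Finset.range (r * b - 1),
          ((∑ κ ∈ Finset.range ((I ^ (a + 1)).natDegree + 1),
              ∑ m ∈ Finset.Icc (r * (n - b)) (v.natDegree - 2 * p - (p * i + κ)),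
                ((n : k) * (μ + 1) - b * (μ + m + 1)) / n * (I ^ (a + 1)).coeff κ *
                  f.coeff (μ + m + 1) * v.coeff (p * (i + 2) + κ + m)) +
            coeffInt Q ((r : ℤ) * b - 2 + p * ((i : ℤ) + 2 - r * j) - μ)) • omegaForm hc μ b := by
  obtain ⟨η, ξ, h1, h2⟩ := H.exists_eq_toH1dR_add hd hd' hn hr hnk ht hc hc' hi hab hb hbn hQ hI hω
    hω' hcl hτ
  exact (congrArg Subtype.val (fst_symm_eq_of_eq_add he h1)).trans h2

end Frobenius

/-! ### Assembly of the proposition. -/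

section Setting

theorem mod_bounds_of_coprime {p n j : ℕ} (hn : n.Coprime p) (hj₁ : 1 ≤ j) (hj : j + 1 ≤ n) :
    1 ≤ p * j % n ∧ p * j % n + 1 ≤ n := by
  refine ⟨Nat.pos_of_ne_zero fun h => ?_, Nat.mod_lt _ (by omega)⟩
  have := Nat.le_of_dvd hj₁ (hn.dvd_of_dvd_mul_left (Nat.dvd_of_mod_eq_zero h))
  omega

/-- Both terms on the right of the relation are divisible by `g ^ a` because `a ≤ p - 1`, and `g` is
prime to `g'`. -/
theorem pow_dvd_of_relation {k : Type*} [Field k] {g u w c : k[X]} {p a : ℕ}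
    (hg : IsCoprime g (derivative g))
    (h : derivative g ^ p * u = g ^ (p - 1) * derivative g + c * w * g ^ p) (ha : a < p) :
    g ^ a ∣ u := by
  refine (hg.pow (m := a) (n := p)).dvd_of_dvd_mul_left ?_
  rw [h]
  exact dvd_add (Dvd.dvd.mul_right (pow_dvd_pow _ (by omega)) _)
    (Dvd.dvd.mul_left (pow_dvd_pow _ ha.le) _)

variable {p : ℕ} [Fact p.Prime] {k : Type*} [Field k] [CharP k p] {n r : ℕ} {f : (W1 p k)[X]}

theorem prH0_omegaForm_fst (hf : f.natDegree ≤ r * n)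
    (h : IsCoprime (infPoly n r (f.map (W1.red p k))) (derivative (infPoly n r (f.map (W1.red p k)))))
    {i j : ℕ} (hω : omegaForm h i j ∈ H0Ω n r _ (natDegree_red_le hf)) :
    (prH0 f hf ⟨omegaForm h i j, hω⟩).1.1 =
      (UBar.t n ((f.map (W1.sigma p k)).map (W1.red p k)) ^ i * UBar.yInv n _ ^ j) •
        D k _ (UBar.t n _) := by
  refine (kaehlerMap_smul_D _ _ _ _ _).trans ?_
  rw [map_mul, map_pow, map_pow, UBar.map_t, UBar.map_yInv]

variable [PerfectRing k p]

set_option maxHeartbeats 1000000 in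
theorem exists_isDeligneIllusie (hf : f.natDegree ≤ r * n) (hn : 1 ≤ n) (hnk : (n : k) ≠ 0)
    (ht : IsCoprime X (f.map (W1.red p k)))
    (hc : IsCoprime (infPoly n r (f.map (W1.red p k)))
      (derivative (infPoly n r (f.map (W1.red p k))))) {v w : k[X]} (hv : FrobVRel n r f v w) :
    ∃ Φ, IsDeligneIllusie f hf hnk hv Φ ∧
      ∃ φU φV h, IsFrobeniusData n r (map_red_sigma f) v w φU φV h ∧
        ∀ ω, HasClass (natDegree_red_le hf) (φU ω.1.1, φV ω.1.2, h (resΩU n _ ω.1.1)) (Φ ω) := by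
  obtain ⟨φU, φV, h, H⟩ := exists_isFrobeniusData (n := n)
    (g := (f.map (W1.red p k) : @Polynomial k CommRing.toCommSemiring.toSemiring))
    (g' := ((f.map (W1.sigma p k)).map (W1.red p k) :
      @Polynomial k CommRing.toCommSemiring.toSemiring)) (map_red_sigma f) hn hnk hc
    hv.derivative_eq
  obtain ⟨Φ, hΦ⟩ := H.exists_hasClass (natDegree_red_le hf) (natDegree_sigma_red_le hf) hn hnk
    (isCoprime_infPoly_sigma hc)
  exact ⟨Φ, H.isDeligneIllusie hf hn hnk
    (fun h => ne_zero_of_isCoprime_X ht (by rw [h, coeff_zero])) hv hΦ, φU, φV, h, H, hΦ⟩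

set_option maxHeartbeats 4000000 in
theorem exists_equiv_fst_symm {F : (WittVector p k)[X]} (hf : (modP2 F).natDegree ≤ r * n)
    (hf₀ : (modP F).natDegree ≤ r * n) (hlt : (modP F).natDegree < r * n) (hn : 1 ≤ n) (hr : 1 ≤ r)
    (hnk : (n : k) ≠ 0) (ht : IsCoprime X (modP F))
    (hc : IsCoprime (infPoly n r (modP F)) (derivative (infPoly n r (modP F)))) {v w Q I : k[X]}
    (hv : FrobVRel n r (modP2 F) v w)
    {i j a b : ℕ} (hi : i + 2 ≤ r * j) (hab : p * j = a * n + b) (hb : 1 ≤ b) (hbn : b + 1 ≤ n)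
    (hQ : infPoly n r (modP F) ^ a * Q = X ^ (p - 1) + derivative v)
    (hI : X ^ (v.natDegree - 2 * p + 1) ∣ modP F * I - 1)
    (hω : omegaForm hc i j ∈ H0Ω n r (modP F) hf₀) {Φ τ}
    (hu : ∀ Φ', IsDeligneIllusie (modP2 F) hf hnk hv Φ' → Φ' = Φ)
    (hτ : IsHodgeSplitting hf₀ hc τ) :
    ∃ e : (H0Ω n r (modP F) hf₀ × H1O n r (modP F) hf₀) ≃ₗ[k] H1dR n r (modP F) hf₀,
      (∀ ω x, e (ω, x) = H0Ω.toH1dR n r (modP F) hf₀ ω + τ x) ∧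
      ((e.symm (Φ (prH0 (modP2 F) hf ⟨omegaForm hc i j, hω⟩))).1 :
        Ω[UBar n (modP F)⁄k] × Ω[VRing n r (modP F)⁄k]) =
      ∑ μ ∈ Finset.range (r * b - 1),
        ((∑ κ ∈ Finset.range ((I ^ (a + 1)).natDegree + 1),
            ∑ m ∈ Finset.Icc (r * (n - b)) (v.natDegree - 2 * p - (p * i + κ)),
              ((n : k) * (μ + 1) - b * (μ + m + 1)) / n * (I ^ (a + 1)).coeff κ *
                (modP F).coeff (μ + m + 1) * v.coeff (p * (i + 2) + κ + m)) +
          coeffInt Q ((r : ℤ) * b - 2 + p * ((i : ℤ) + 2 - r * j) - μ)) • omegaForm hc μ b := by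
  obtain ⟨Φ', h', φU, φV, h, H, hcl⟩ := exists_isDeligneIllusie hf hn hnk ht hc hv
  cases hu Φ' h'
  obtain ⟨e, he⟩ := hτ.exists_equiv hf₀ hn hr ht
  exact ⟨e, he, H.fst_symm_eq hlt (natDegree_sigma_red_le hf) hn hr hnk ht hc
    (isCoprime_infPoly_sigma hc) hi hab hb hbn hQ hI (prH0 (modP2 F) hf ⟨omegaForm hc i j, hω⟩).2
    (prH0_omegaForm_fst hf hc _) (hcl _) hτ he⟩

end Setting

end Superelliptic

set_option maxHeartbeats 8000000 in
theorem mainTheorem1 (p : ℕ) [Fact p.Prime] (k : Type*) [Field k] [Finite k] [CharP k p]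
    (n l r : ℕ) (hn : n.Coprime p) (hlr : l + 1 = r * n) (hpl : ¬ p ∣ l)
    (F : (WittVector p k)[X]) (hl : F.natDegree = l) (hlead : IsUnit F.leadingCoeff)
    (hsep : IsCoprime F (derivative F)) (ht : IsCoprime X (modP F))
    (v w : k[X]) (hv : FrobVRel n r (modP2 F) v w)
    (I : k[X]) (hI : X ^ (v.natDegree - 2 * p + 1) ∣ modP F * I - 1)
    (i j : ℕ) (hj₁ : 1 ≤ j) (hj : j + 1 ≤ n) (hi : i + 2 ≤ r * j) :
    let hl' : F.natDegree + 1 = r * n := by rw [hl, hlr]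
    let hf := natDegree_modP2_le hl'
    let hf₀ := natDegree_red_le hf
    let hc := isCoprime_infPoly_modP hl' hlead hsep
    let hn' := natCast_ne_zero (k := k) hn
    let f₂ := infPoly n r (modP F)
    let a := p * j / n
    let b := p * j % n
    let d := v.natDegree - 2 * p
    let IP := I ^ (a + 1)
    let Q := (X ^ (p - 1) + derivative v) / f₂ ^ a
    (1 ≤ b ∧ b + 1 ≤ n) ∧
    f₂ ^ a ∣ X ^ (p - 1) + derivative v ∧
    (∃! Φ', IsDeligneIllusie (modP2 F) hf hn' hv Φ') ∧
    (∃! τ, IsHodgeSplitting hf₀ hc τ) ∧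
    ∀ Φ' τ, IsDeligneIllusie (modP2 F) hf hn' hv Φ' →
      IsHodgeSplitting hf₀ hc τ →
      ∃ e : (H0Ω n r (modP F) hf₀ × H1O n r (modP F) hf₀) ≃ₗ[k]
          H1dR n r (modP F) hf₀,
        (∀ ω x, e (ω, x) = H0Ω.toH1dR n r (modP F) hf₀ ω + τ x) ∧
        ((e.symm (Φ' (prH0 (modP2 F) hf
            ⟨omegaForm hc i j, omegaForm_mem hf₀ hc hj hi⟩))).1 :
          Ω[UBar n (modP F)⁄k] × Ω[VRing n r (modP F)⁄k]) =
        ∑ μ ∈ Finset.range (r * b - 1),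
          ((∑ κ ∈ Finset.range (IP.natDegree + 1),
              ∑ m ∈ Finset.Icc (r * (n - b)) (d - (p * i + κ)),
                ((n : k) * (μ + 1) - b * (μ + m + 1)) / n * IP.coeff κ * (modP F).coeff (μ + m + 1) *
                  v.coeff (p * (i + 2) + κ + m)) +
            coeffInt Q
              ((r : ℤ) * b - 2 + p * ((i : ℤ) + 2 - r * j) - μ)) •
          omegaForm hc μ b := by
  have hp : p.Prime := Fact.out
  -- A finite field is perfect, so the kernel of `W₁ → k` is generated by `p`.
  have := PerfectField.toPerfectRing (K := k) p
  intro hl' hf hf₀ hc hn' f₂ a b d IP Q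
  have hr : 1 ≤ r := Nat.pos_of_ne_zero fun h => by rw [h, zero_mul] at hlr; omega
  have hn1 : 1 ≤ n := by omega
  have hlt : (modP F).natDegree < r * n := by
    have : (modP F).natDegree ≤ (modP2 F).natDegree := natDegree_map_le
    have : (modP2 F).natDegree ≤ F.natDegree := natDegree_map_le
    omega
  have hb : 1 ≤ b ∧ b + 1 ≤ n := mod_bounds_of_coprime hn hj₁ hj
  have hab : p * j = a * n + b := (Nat.div_add_mod' _ _).symm
  -- Here `a < p` because `j < n`.
  have hdvd : f₂ ^ a ∣ X ^ (p - 1) + derivative v :=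
    pow_dvd_of_relation hc hv.derivative_eq
      ((Nat.div_lt_iff_lt_mul hn1).2 (Nat.mul_lt_mul_of_pos_left (by omega) hp.pos))
  have hf0 : (modP F) ≠ 0 := fun h => ne_zero_of_isCoprime_X ht (by rw [h, coeff_zero])
  have hQ : f₂ ^ a * Q = X ^ (p - 1) + derivative v :=
    EuclideanDomain.mul_div_cancel' (pow_ne_zero _ ((reflect_eq_zero_iff (N := r * n)).not.2 hf0)) hdvd
  obtain ⟨Φ, hΦ, -⟩ := exists_isDeligneIllusie hf hn1 hn' ht hc hv
  have hu : ∀ Φ₁ Φ₂, IsDeligneIllusie (modP2 F) hf hn' hv Φ₁ →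
      IsDeligneIllusie (modP2 F) hf hn' hv Φ₂ → Φ₁ = Φ₂ :=
    fun _ _ h₁ h₂ => h₁.unique hf hn1 hn' ht hc h₂
  have hτ := isHodgeSplitting_existsUnique hf₀ hc hn' hn1 hr ht
  clear_value hf₀ hf hc hn'
  refine ⟨hb, hdvd, ⟨Φ, hΦ, fun Φ' hΦ' => hu _ _ hΦ' hΦ⟩, hτ, fun Φ' τ hΦ' hτ => ?_⟩
  exact exists_equiv_fst_symm hf hf₀ hlt hn1 hr hn' ht hc hv hi hab hb.1 hb.2 hQ hI _
    (fun _ h => hu _ _ h hΦ') hτ
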